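/- All graphs are finite and simple, and classes of graphs are closed under isomorphism. A graph $H$ is a minor of $G$ if there are pairwise disjoint nonempty connected vertex sets $B_a$ ($a\in V(H)$) in $G$ such that $G$ has an edge between $B_a$ and $B_b$ whenever $ab\in E(H)$. For $k\ge 1$, a graph is $k$-connected if it has more than $k$ vertices and remains connected whenever fewer than $k$ vertices are deleted. A graph is internally $3$-connected if it is obtained from a $3$-connected graph by subdividing each edge at most once. Let $\mathcal P$ be the class of type-I graphs: graphs $G$ having a Hamiltonian cycle $C$ such that, calling the edges of $G$ outside $C$ chords, and saying that two chords $ab$, $cd$ with four distinct ends cross if their ends appear on $C$ in the order $a,c,b,d,a$ (in one of the two directions of $C$), * every chord crosses at most one other chord, and * if chords $ab$ and $cd$ cross, then either $ac$ and $bd$ are both edges of $C$, or $ad$ and $bc$ are both edges of $C$. Let $\mathcal C$ consist of $C_3, C_4, C_5, C_6$, $K_4\backslash e$, $K_{2,3}$ and all internally $3$-connected graphs, let $\mathcal C_1=\{C_3,C_4,C_5,C_6,K_4\backslash e,K_{3,3}\backslash e\}$, and let $\mathcal C_2=\mathcal C\setminus\mathcal C_1$. (Here $K\backslash e$ is $K$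 with one edge deleted.) For each positive integer $n$, let $\mathcal D_n$ be the class of all $2$-connected graphs without a $K_{2,n}$-minor, and let $\mathcal D_n'=\mathcal D_n\cap\mathcal C_2$. Let $G_1, H_1,\dots,H_t$ be disjoint graphs ($t\ge 0$). Let $z_1,\dots,z_t$ be distinct, pairwise nonadjacent vertices of $G_1$, where $z_i$ has exactly two neighbours $x_i,y_i$, and let $w_i$ be a vertex of $H_i$ with exactly two neighbours $x_i',y_i'$. The $2$-sum of $G_1$ with $H_1,\dots,H_t$ over these vertices is the simple graph obtained by deleting all the $z_i$ and $w_i$ and identifying $x_i$ with $x_i'$ and $y_i$ with $y_i'$ for every $i$ (parallel edges being merged; so two identified vertices are adjacent if they were adjacent in at least one of the graphs). For classes $\mathcal G_1,\mathcal G_2$ of graphs, let $\mathcal G_1\oplus\mathcal G_2$ be the class of all $2$-sums of one graph from $\mathcal G_1$ with finitely many (possibly no) graphs from $\mathcal G_2$. For a class $\mathcal G$ let $\mathcal G^1=\mathcal G$ and $\mathcal G^{k+1}=\mathcal G^k\oplus\mathcal G$ for $k\ge1$. **Lemma.** For every positive integer $n$, $$\mathcal D_n\subseteq(\mathcal P\cup\mathcal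 D_n')^n .$$ -/

import Mathlib

universe u

namespace TwoSumDecomp

/-- A class of graphs (all classes used below are closed under isomorphism). -/
abbrev GraphClass : Type (u + 1) := ∀ V : Type u, SimpleGraph V → Prop

/-- `H` is a minor of `G`: there are pairwise disjoint connected (in particular nonempty) branch
sets in `G`, one for each vertex of `H`, joined by an edge of `G` whenever the corresponding
vertices are adjacent in `H`. -/
def HasMinor {V W : Type*} (G : SimpleGraph V) (H : SimpleGraph W) : Prop :=
  ∃ B : W → Set V,
    (∀ a, (G.induce (B a)).Connected) ∧
    (∀ a b, a ≠ b → Disjoint (B a) (B b)) ∧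
    ∀ a b, H.Adj a b → ∃ x ∈ B a, ∃ y ∈ B b, G.Adj x y

/-- A finite graph is `k`-connected if it has more than `k` vertices and deleting fewer than `k`
vertices always leaves a connected graph. (`Nat.card` is `0` on infinite types, so this
predicate only holds for finite graphs.) -/
def IsKConnected {V : Type*} (k : ℕ) (G : SimpleGraph V) : Prop :=
  k < Nat.card V ∧ ∀ S : Finset V, S.card < k → (G.induce (S : Set V)ᶜ).Connected

/-- The graph obtained from `H` by subdividing once each edge in the set `S`. -/
def subdivide {W : Type*} (H : SimpleGraph W) (S : Set (Sym2 W)) : SimpleGraph (W ⊕ S) where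
  Adj
    | .inl a, .inl b => H.Adj a b ∧ s(a, b) ∉ S
    | .inl a, .inr e => a ∈ e.1
    | .inr e, .inl a => a ∈ e.1
    | .inr _, .inr _ => False
  symm := ⟨by
    rintro (a | e) (b | f) h
    · exact ⟨h.1.symm, by rw [Sym2.eq_swap]; exact h.2⟩
    · exact h
    · exact h
    · exact h⟩
  loopless := ⟨by
    rintro (a | e) h
    · exact H.loopless.irrefl a h.1
    · exact h⟩

/-- `G` is obtained from a 3-connected graph by subdividing each edge at most once. -/
def IsInternallyThreeConnected {V : Type u} (G : SimpleGraph V) : Prop :=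
  ∃ (W : Type u) (H : SimpleGraph W) (S : Set (Sym2 W)),
    IsKConnected 3 H ∧ S ⊆ H.edgeSet ∧ Nonempty (G ≃g subdivide H S)

/-- The complete bipartite graph `K_{m,n}`. -/
abbrev completeBip (m n : ℕ) : SimpleGraph (Fin m ⊕ Fin n) :=
  completeBipartiteGraph (Fin m) (Fin n)

/-- `K_4` minus an edge. -/
def K4MinusEdge : SimpleGraph (Fin 4) := (⊤ : SimpleGraph (Fin 4)).deleteEdges {s(0, 1)}

/-- `K_{3,3}` minus an edge. -/
def K33MinusEdge : SimpleGraph (Fin 3 ⊕ Fin 3) :=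
  (completeBip 3 3).deleteEdges {s(Sum.inl 0, Sum.inr 0)}

/-- The class consisting of `C_3`, `C_4`, `C_5`, `C_6`, `K_4 \ e`, `K_{2,3}` and all internally
3-connected graphs. -/
def ClassC : GraphClass.{u} := fun _ G =>
  Nonempty (G ≃g SimpleGraph.cycleGraph 3) ∨ Nonempty (G ≃g SimpleGraph.cycleGraph 4) ∨
  Nonempty (G ≃g SimpleGraph.cycleGraph 5) ∨ Nonempty (G ≃g SimpleGraph.cycleGraph 6) ∨
  Nonempty (G ≃g K4MinusEdge) ∨ Nonempty (G ≃g completeBip 2 3) ∨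
  IsInternallyThreeConnected G

/-- The class consisting of `C_3`, `C_4`, `C_5`, `C_6`, `K_4 \ e` and `K_{3,3} \ e`. -/
def ClassC1 : GraphClass.{u} := fun _ G =>
  Nonempty (G ≃g SimpleGraph.cycleGraph 3) ∨ Nonempty (G ≃g SimpleGraph.cycleGraph 4) ∨
  Nonempty (G ≃g SimpleGraph.cycleGraph 5) ∨ Nonempty (G ≃g SimpleGraph.cycleGraph 6) ∨
  Nonempty (G ≃g K4MinusEdge) ∨ Nonempty (G ≃g K33MinusEdge)

/-- The members of `ClassC` that are not in `ClassC1`. -/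
def ClassC2 : GraphClass.{u} := fun V G => ClassC V G ∧ ¬ ClassC1 V G

/-- The class of all (finite) 2-connected graphs without a `K_{2,n}`-minor. -/
def ClassD (n : ℕ) : GraphClass.{u} := fun _ G =>
  IsKConnected 2 G ∧ ¬ HasMinor G (completeBip 2 n)

/-- The members of `ClassD n` that belong to `ClassC2`. -/
def ClassD' (n : ℕ) : GraphClass.{u} := fun V G => ClassD n V G ∧ ClassC2 V G

/-- The chords `ab` and `cd` of a cycle with vertices `0, 1, …, m-1` (in this order) cross: in one
of the two directions of the cycle, the vertices appear in the order `a, c, b, d, a`. -/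
def Cross {m : ℕ} (a b c d : Fin m) : Prop :=
  (sbtw a c b ∧ sbtw b d a) ∨ (sbtw a d b ∧ sbtw b c a)

/-- Type-I graphs. The reference Hamiltonian cycle `C` of `G` is given by an enumeration
`e 0, e 1, …, e (m-1)` of the vertices of `G` in which cyclically consecutive vertices are
adjacent; the edges of `C` correspond to those of `cycleGraph m`. -/
def ClassP : GraphClass.{u} := fun V G =>
  ∃ (m : ℕ) (e : Fin m ≃ V),
    let C : SimpleGraph (Fin m) := SimpleGraph.cycleGraph m
    let Chord : Fin m → Fin m → Prop := fun a b => G.Adj (e a) (e b) ∧ ¬ C.Adj a b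
    3 ≤ m ∧
    (∀ a b, C.Adj a b → G.Adj (e a) (e b)) ∧
    -- every chord crosses at most one other chord
    (∀ a b c d c' d', Chord a b → Chord c d → Chord c' d' →
      Cross a b c d → Cross a b c' d' → s(c, d) = s(c', d')) ∧
    -- the ends of two crossing chords are joined by two disjoint edges of `C`
    (∀ a b c d, Chord a b → Chord c d → Cross a b c d →
      (C.Adj a c ∧ C.Adj b d) ∨ (C.Adj a d ∧ C.Adj b c))

/-- `G` is a 2-sum of `G₁` with the graphs `H i`, over the vertices `z i` of `G₁` and `w i` of
`H i`. The `z i` are distinct and pairwise nonadjacent; `z i` has exactly the two neighbours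
`x i`, `y i` in `G₁`, and `w i` has exactly the two neighbours `x' i`, `y' i` in `H i`.
`G` is the union of the images of `G₁` minus all `z i` (under `f`) and of `H i` minus `w i`
(under `g i`), where exactly `x i` is identified with `x' i` and `y i` with `y' i`. In particular
the images of `x i` and `y i` are adjacent in `G` as soon as they are adjacent in at least one
of the graphs that are summed there. -/
structure TwoSum {V V₁ ι : Type*} {W : ι → Type*} (G : SimpleGraph V)
    (G₁ : SimpleGraph V₁) (H : ∀ i, SimpleGraph (W i)) where
  z : ι → V₁
  x : ι → V₁
  y : ι → V₁
  w : ∀ i, W i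
  x' : ∀ i, W i
  y' : ∀ i, W i
  z_injective : Function.Injective z
  z_not_adj : ∀ i j, ¬ G₁.Adj (z i) (z j)
  x_ne_y : ∀ i, x i ≠ y i
  neighborSet_z : ∀ i, G₁.neighborSet (z i) = {x i, y i}
  x'_ne_y' : ∀ i, x' i ≠ y' i
  neighborSet_w : ∀ i, (H i).neighborSet (w i) = {x' i, y' i}
  f : V₁ → V
  g : ∀ i, W i → V
  f_injOn : Set.InjOn f (Set.range z)ᶜ
  g_injOn : ∀ i, Set.InjOn (g i) {w i}ᶜ
  glue_x : ∀ i, f (x i) = g i (x' i)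
  glue_y : ∀ i, f (y i) = g i (y' i)
  f_inter_g : ∀ i, ∀ a ∉ Set.range z, ∀ b, b ≠ w i → f a = g i b →
    (a = x i ∧ b = x' i) ∨ (a = y i ∧ b = y' i)
  g_inter_g : ∀ i j, i ≠ j → ∀ b, b ≠ w i → ∀ c, c ≠ w j → g i b = g j c →
    b = x' i ∨ b = y' i
  cover : ∀ v, (∃ a ∉ Set.range z, f a = v) ∨ ∃ i b, b ≠ w i ∧ g i b = v
  adj_iff : ∀ u v, G.Adj u v ↔
    (∃ a ∉ Set.range z, ∃ b ∉ Set.range z, G₁.Adj a b ∧ f a = u ∧ f b = v) ∨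
    ∃ i a b, a ≠ w i ∧ b ≠ w i ∧ (H i).Adj a b ∧ g i a = u ∧ g i b = v

/-- The 2-sum `𝒢₁ ⊕ 𝒢₂`: all graphs obtained by 2-summing one graph from `𝒢₁` with finitely many
(possibly no) graphs from `𝒢₂`. -/
def sumClass (𝒢₁ 𝒢₂ : GraphClass.{u}) : GraphClass.{u} := fun _ G =>
  ∃ (V₁ : Type u) (G₁ : SimpleGraph V₁) (t : ℕ) (W : Fin t → Type u)
    (H : ∀ i, SimpleGraph (W i)),
    𝒢₁ V₁ G₁ ∧ (∀ i, 𝒢₂ (W i) (H i)) ∧ Nonempty (TwoSum G G₁ H)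

/-- The powers `𝒢 ^ 1 = 𝒢` and `𝒢 ^ (k + 1) = 𝒢 ^ k ⊕ 𝒢` for `k ≥ 1`; the exponent `0` is not
used, and its value is the empty class. -/
def powClass (𝒢 : GraphClass.{u}) : ℕ → GraphClass.{u}
  | 0 => fun _ _ => False
  | 1 => 𝒢
  | k + 2 => sumClass (powClass 𝒢 (k + 1)) 𝒢

/-- The union of two classes of graphs. -/
def unionClass (𝒢₁ 𝒢₂ : GraphClass.{u}) : GraphClass.{u} := fun V G => 𝒢₁ V G ∨ 𝒢₂ V G

end TwoSumDecomp

/-! A 2-separation `{u, v}` of the graph cuts off a `Region` `C`. Its complexity is the largest `k`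
for which it has a `K_{2,k}`-minor whose two hubs contain `u` and `v` (`RootedMinor`). Leaves found
on the two sides of the same separation add up to a `K_{2,n}`-minor of the whole graph, so the two
sides cannot both be complex.

A region either has a cut vertex between its ends (series), or is a union of two regions (parallel),
or is rigid. In the rigid case the maximal proper parts with two neighbours are disjoint and
nonadjacent, by submodularity of the number of neighbours. Replacing each of them, and the outside,
by a virtual edge gives a 3-connected torso. Subdividing the virtual edges yields an internally
3-connected minor of `G`, hence a graph of the base class. A parallel region has the node `K_{2,3}`
instead.

Passing to a child of a parallel node costs one leaf. The same holds for a torso, because two edges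
of a 3-connected graph are linked by two disjoint connected sets together with a third set adjacent
to both (`exists_triple`). The only exception is `K_4` with opposite virtual edges for parent and
child. Series compositions and such `K_4`s need not reduce the complexity, so arbitrarily long runs
of them have to fit into a single factor. They do: they line up along a path, each `K_4`
contributing a pair of crossing chords, and closing the path gives a type-I graph (`Strip`). Thus a
region without rooted `K_{2,k+1}`-minor is a strip whose inserted pieces have depth at most `2k - 1`
(`hasStrip_of_not_rootedMinor`): two levels for each leaf lost.

For the bound, let `K = ⌊(n - 1) / 2⌋` and choose an inclusion-minimal region with a rooted
`K_{2,K+1}`-minor, or any region if there is none. Neither the outside nor a proper subregion has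
such a minor. Rooting the decomposition at the node of the chosen region gives `2K + 1 ≤ n` levels.
A graph without regions is 3-connected or a triangle and lies in the base class itself. -/

namespace TwoSumDecomp

/-! ### Connected vertex sets and small separators. -/

section Connectivity

variable {V : Type*} {G : SimpleGraph V} {S T : Set V} {x y : V}

/-- The vertex set `S` induces a connected subgraph of `G`. -/
def Conn (G : SimpleGraph V) (S : Set V) : Prop := (G.induce S).Connected

/-- Connectedness in closure form: a nonempty subset closed under adjacency within the set is
everything. Later arguments use this form in place of walks. -/
theorem conn_iff : Conn G S ↔ S.Nonempty ∧
    ∀ T ⊆ S, T.Nonempty → (∀ x ∈ T, ∀ y ∈ S, G.Adj x y → y ∈ T) → S ⊆ T := by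
  constructor
  · intro h
    refine ⟨Set.nonempty_coe_sort.mp h.nonempty, ?_⟩
    rintro T hT ⟨x, hx⟩ hc y hy
    obtain ⟨p⟩ := h.preconnected ⟨x, hT hx⟩ ⟨y, hy⟩
    have key : ∀ (a b : S), (G.induce S).Walk a b → a.1 ∈ T → b.1 ∈ T := by
      intro a b p
      induction p with
      | nil => exact id
      | cons h _ ih => exact fun ha => ih (hc _ ha _ (Subtype.prop _) h)
    exact key _ _ p hx
  · rintro ⟨⟨x, hx⟩, h⟩
    have hall : S ⊆ {y | ∃ hy : y ∈ S, (G.induce S).Reachable ⟨x, hx⟩ ⟨y, hy⟩} := by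
      refine h _ (fun y hy => hy.1) ⟨x, hx, SimpleGraph.Reachable.refl _⟩ ?_
      rintro y ⟨hy, hr⟩ z hz hyz
      exact ⟨hz, hr.trans (SimpleGraph.Adj.reachable (by simpa using hyz))⟩
    have : Nonempty S := ⟨⟨x, hx⟩⟩
    refine ⟨fun a b => ?_⟩
    exact (hall a.2).2.symm.trans (hall b.2).2

theorem Conn.nonempty (h : Conn G S) : S.Nonempty := (conn_iff.1 h).1

theorem Conn.subset (h : Conn G S) (hT : T ⊆ S) (hne : T.Nonempty)
    (hc : ∀ x ∈ T, ∀ y ∈ S, G.Adj x y → y ∈ T) : S ⊆ T :=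
  (conn_iff.1 h).2 T hT hne hc

/-- Variant of `Conn.subset` for sets that need not lie in `S`. -/
theorem Conn.subset' (h : Conn G S) (hx : x ∈ S) (hxT : x ∈ T)
    (hc : ∀ x ∈ T, x ∈ S → ∀ y ∈ S, G.Adj x y → y ∈ T) : S ⊆ T := by
  have := h.subset (T := T ∩ S) Set.inter_subset_right ⟨x, hxT, hx⟩
    (fun a ha b hb hab => ⟨hc a ha.1 ha.2 b hb hab, hb⟩)
  exact fun a ha => (this ha).1

theorem conn_of_forall (hx : x ∈ S)
    (h : ∀ T ⊆ S, T.Nonempty → (∀ x ∈ T, ∀ y ∈ S, G.Adj x y → y ∈ T) → S ⊆ T) : Conn G S :=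
  conn_iff.2 ⟨⟨x, hx⟩, h⟩

/-- A set is connected if every vertex lies in every closed subset containing a base vertex. -/
theorem conn_of_base (hx : x ∈ S)
    (h : ∀ T ⊆ S, x ∈ T → (∀ x ∈ T, ∀ y ∈ S, G.Adj x y → y ∈ T) → S ⊆ T) : Conn G S := by
  refine conn_of_forall hx fun T hT ⟨y, hy⟩ hc => ?_
  by_cases hxT : x ∈ T
  · exact h T hT hxT hc
  · have := h (S \ T) Set.sdiff_subset ⟨hx, hxT⟩ (fun a ha b hb hab =>
      ⟨hb, fun hbT => ha.2 (hc b hbT a ha.1 hab.symm)⟩)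
    exact absurd hy (this (hT hy)).2

theorem conn_singleton (x : V) : Conn G {x} :=
  conn_of_base (Set.mem_singleton x) fun _ _ hx _ => Set.singleton_subset_iff.2 hx

theorem Conn.union (hS : Conn G S) (hT : Conn G T) (h : (S ∩ T).Nonempty) :
    Conn G (S ∪ T) := by
  obtain ⟨x, hxS, hxT⟩ := h
  refine conn_of_base (Or.inl hxS) fun U _ hx hc => Set.union_subset ?_ ?_
  · exact hS.subset' hxS hx fun a ha _ b hb hab => hc a ha b (Or.inl hb) hab
  · exact hT.subset' hxT hx fun a ha _ b hb hab => hc a ha b (Or.inr hb) hab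

theorem Conn.union_adj (hS : Conn G S) (hT : Conn G T) (hx : x ∈ S) (hy : y ∈ T)
    (h : G.Adj x y) : Conn G (S ∪ T) := by
  refine conn_of_base (Or.inl hx) fun U _ hxU hc => Set.union_subset ?_ ?_
  · exact hS.subset' hx hxU fun a ha _ b hb hab => hc a ha b (Or.inl hb) hab
  · exact hT.subset' hy (hc x hxU y (Or.inr hy) h)
      fun a ha _ b hb hab => hc a ha b (Or.inr hb) hab

theorem Conn.insert_adj (hS : Conn G S) (hy : y ∈ S) (h : G.Adj x y) : Conn G (insert x S) :=
  (conn_singleton x).union_adj hS (Set.mem_singleton x) hy h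

/-- A connected set has an edge from each of its nonempty proper subsets to the rest. -/
theorem Conn.exists_adj (hS : Conn G S) (hT : T ⊆ S) (hne : T.Nonempty) (hy : y ∈ S)
    (hyT : y ∉ T) : ∃ a ∈ T, ∃ b ∈ S, b ∉ T ∧ G.Adj a b := by
  by_contra! hcon
  exact hyT (hS.subset hT hne
    (fun a ha b hb hab => by_contra fun hbT => hcon a ha b hb hbT hab) hy)

/-- The vertex set of the component of `x` in the subgraph induced by `S`. -/
def comp (G : SimpleGraph V) (S : Set V) (x : V) : Set V :=
  {y | x ∈ S ∧ y ∈ S ∧ ∀ T : Set V, x ∈ T → (∀ p ∈ T, ∀ q ∈ S, G.Adj p q → q ∈ T) → y ∈ T}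

theorem comp_subset : comp G S x ⊆ S := fun _ h => h.2.1

theorem mem_comp_self (hx : x ∈ S) : x ∈ comp G S x := ⟨hx, hx, fun _ h _ => h⟩

theorem comp_subset_of (hx : x ∈ T) (hc : ∀ p ∈ T, ∀ q ∈ S, G.Adj p q → q ∈ T) :
    comp G S x ⊆ T := fun _ h => h.2.2 T hx hc

theorem comp_closed {p q : V} (hp : p ∈ comp G S x) (hq : q ∈ S) (h : G.Adj p q) :
    q ∈ comp G S x :=
  ⟨hp.1, hq, fun T hx hc => hc p (hp.2.2 T hx hc) q hq h⟩

theorem conn_comp (hx : x ∈ S) : Conn G (comp G S x) := by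
  refine conn_of_base (mem_comp_self hx) fun T hT hxT hc => ?_
  exact comp_subset_of hxT fun p hp q hq h => hc p hp q (comp_closed (hT hp) hq h) h

theorem Conn.subset_comp (hT : Conn G T) (hTS : T ⊆ S) (hx : x ∈ T) : T ⊆ comp G S x :=
  hT.subset' hx (mem_comp_self (hTS hx)) fun _ ha _ _ hb hab => comp_closed ha (hTS hb) hab

/-- Removing the component of `u` in `A - y` from a connected set `A` leaves a connected set. -/
theorem Conn.peel {A : Set V} {u : V} (hA : Conn G A) (hy : y ∈ A) (hu : u ∈ A) (hyu : y ≠ u) :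
    Conn G (A \ comp G (A \ {y}) u) := by
  set R := comp G (A \ {y}) u with hR
  have hyR : y ∉ R := fun h => (comp_subset h).2 rfl
  have huR : u ∈ R := mem_comp_self ⟨hu, fun h => hyu h.symm⟩
  refine conn_of_base ⟨hy, hyR⟩ fun T hT hyT hc => ?_
  by_contra hcon
  obtain ⟨z, hz, hzT⟩ := Set.not_subset.1 hcon
  -- A vertex missed by `T` would lie in a set closed in `A`: apart from `y`, which is in `T`, no
  -- vertex of `A \ R` has a neighbour in `R`.
  have hsub : A ⊆ (A \ R) \ T := by
    refine hA.subset (fun a ha => ha.1.1) ⟨z, hz, hzT⟩ fun a ha b hb hab => ?_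
    have hay : a ≠ y := fun h => ha.2 (h ▸ hyT)
    have hbR : b ∉ R := fun h => ha.1.2 (comp_closed h ⟨ha.1.1, hay⟩ hab.symm)
    exact ⟨⟨hb, hbR⟩, fun hbT => ha.2 (hc b hbT a ha.1 hab.symm)⟩
  exact (hsub hu).1.2 huR

/-- If `A` is connected, then `y` is adjacent to the component of `u` in `A - y`. -/
theorem Conn.adj_comp {A : Set V} {u : V} (hA : Conn G A) (hy : y ∈ A) (hu : u ∈ A)
    (hyu : y ≠ u) : ∃ a ∈ comp G (A \ {y}) u, G.Adj a y := by
  have huR : u ∈ comp G (A \ {y}) u := mem_comp_self ⟨hu, fun h => hyu h.symm⟩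
  obtain ⟨a, ha, b, hb, hbn, hab⟩ := hA.exists_adj (T := comp G (A \ {y}) u)
    (fun a ha => (comp_subset ha).1) ⟨u, huR⟩ hy (fun h => (comp_subset h).2 rfl)
  have : b = y := by
    by_contra hne
    exact hbn (comp_closed ha ⟨hb, hne⟩ hab)
  exact ⟨a, ha, this ▸ hab⟩

/-- No vertex of `G` separates a set from a further vertex. -/
def No1Sep (G : SimpleGraph V) : Prop :=
  ∀ (K : Set V) (p o : V), K.Nonempty → p ∉ K → o ∉ K → o ≠ p →
    ∃ x ∈ K, ∃ y, y ∉ K ∧ y ≠ p ∧ G.Adj x y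

/-- No two vertices of `G` separate a set from a further vertex. -/
def No2Sep (G : SimpleGraph V) : Prop :=
  ∀ (K : Set V) (p q o : V), K.Nonempty → p ∉ K → q ∉ K → o ∉ K → o ≠ p → o ≠ q →
    ∃ x ∈ K, ∃ y, y ∉ K ∧ y ≠ p ∧ y ≠ q ∧ G.Adj x y

/-- The two cut vertices in `No2Sep` need not be distinct. -/
theorem No2Sep.no1Sep (h : No2Sep G) : No1Sep G := fun K p o hK hp ho hop => by
  obtain ⟨x, hx, y, hy, h1, _, h3⟩ := h K p p o hK hp hp ho hop hop
  exact ⟨x, hx, y, hy, h1, h3⟩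

theorem IsKConnected.finite {k : ℕ} (h : IsKConnected k G) : Finite V :=
  (Nat.card_pos_iff.1 (lt_of_le_of_lt (Nat.zero_le k) h.1)).2

theorem IsKConnected.no1Sep (h : IsKConnected 2 G) : No1Sep G := by
  classical
  intro K p o hK hp ho hop
  have hc : Conn G (({p} : Finset V) : Set V)ᶜ := h.2 {p} (by simp)
  obtain ⟨a, ha, b, hb, hbK, hab⟩ := hc.exists_adj (T := K) (y := o)
    (fun a ha => by simpa using fun h : a = p => hp (h ▸ ha)) hK (by simpa using hop) ho
  exact ⟨a, ha, b, hbK, by simpa using hb, hab⟩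

theorem IsKConnected.no2Sep (h : IsKConnected 3 G) : No2Sep G := by
  classical
  intro K p q o hK hp hq ho hop hoq
  have hc : Conn G (({p, q} : Finset V) : Set V)ᶜ :=
    h.2 {p, q} (lt_of_le_of_lt Finset.card_le_two (by norm_num))
  obtain ⟨a, ha, b, hb, hbK, hab⟩ := hc.exists_adj (T := K) (y := o)
    (fun a ha => by
      simp only [Finset.coe_insert, Finset.coe_singleton, Set.mem_compl_iff, Set.mem_insert_iff,
        Set.mem_singleton_iff, not_or]
      exact ⟨fun h => hp (h ▸ ha), fun h => hq (h ▸ ha)⟩) hK (by simp [hop, hoq]) ho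
  simp only [Finset.coe_insert, Finset.coe_singleton, Set.mem_compl_iff, Set.mem_insert_iff,
        Set.mem_singleton_iff, not_or] at hb
  exact ⟨a, ha, b, hbK, hb.1, hb.2, hab⟩

end Connectivity

/-! ### Linking two edges of a 3-connected graph. -/

section Linkage

variable {V : Type*} {H : SimpleGraph V} {u v a b : V}

/-- Two disjoint connected sets, one through `u` and `a`, the other through `v` and `b`, together
with a third connected set adjacent to both. -/
def Triple (H : SimpleGraph V) (u v a b : V) : Prop :=
  ∃ A B D : Set V, Conn H A ∧ Conn H B ∧ Conn H D ∧ Disjoint A B ∧ Disjoint A D ∧ Disjoint B D ∧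
    u ∈ A ∧ a ∈ A ∧ v ∈ B ∧ b ∈ B ∧
    (∃ x ∈ D, ∃ y ∈ A, H.Adj x y) ∧ ∃ x ∈ D, ∃ y ∈ B, H.Adj x y

theorem Triple.swap (h : Triple H u v a b) : Triple H v u b a := by
  obtain ⟨A, B, D, hA, hB, hD, h1, h2, h3, h4, h5, h6, h7, h8, h9⟩ := h
  exact ⟨B, A, D, hB, hA, hD, h1.symm, h3, h2, h6, h7, h4, h5, h9, h8⟩

theorem Triple.reverse (h : Triple H u v a b) : Triple H a b u v := by
  obtain ⟨A, B, D, hA, hB, hD, h1, h2, h3, h4, h5, h6, h7, h8, h9⟩ := h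
  exact ⟨A, B, D, hA, hB, hD, h1, h2, h3, h5, h4, h7, h6, h8, h9⟩

/-- A partition into two connected sets, one through `u` and `a`, the other through
`v` and `b`. -/
structure Linkage (H : SimpleGraph V) (u v a b : V) (A : Set V) : Prop where
  conn : Conn H A
  conn_compl : Conn H Aᶜ
  u_mem : u ∈ A
  a_mem : a ∈ A
  v_mem : v ∈ Aᶜ
  b_mem : b ∈ Aᶜ

theorem Linkage.swap {A : Set V} (h : Linkage H u v a b A) : Linkage H v u b a Aᶜ :=
  ⟨h.conn_compl, by rw [compl_compl]; exact h.conn, h.v_mem, h.b_mem,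
    by rw [compl_compl]; exact h.u_mem, by rw [compl_compl]; exact h.a_mem⟩

theorem Linkage.reverse {A : Set V} (h : Linkage H u v a b A) : Linkage H a b u v A :=
  ⟨h.conn, h.conn_compl, h.a_mem, h.u_mem, h.b_mem, h.v_mem⟩

/-- Start from `{v}ᶜ`, a connected side containing `u`, `a` and `b`, and shrink it. Cutting at a
vertex `y` with a neighbour on the other side hands over everything that `y` separates from `u`. In
a minimal side such a cut separates at least one of `a`, `b` from `u`; if it separates exactly one,
this is the linkage. -/
theorem exists_linkage [Finite V] (h1 : No1Sep H) (huv : u ≠ v) (hva : v ≠ a) (hvb : v ≠ b)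
    (hua : u ≠ a) (hab : a ≠ b) :
    ∃ A, Linkage H u v a b A ∨ Linkage H u v b a A := by
  classical
  let P : Set V → Prop := fun A => Conn H A ∧ Conn H Aᶜ ∧ u ∈ A ∧ v ∈ Aᶜ ∧ a ∈ A ∧ b ∈ A
  have hP : ∃ A, P A := by
    refine ⟨{v}ᶜ, ?_, by rw [compl_compl]; exact conn_singleton v, huv, by simp, hva.symm,
      hvb.symm⟩
    refine conn_of_base (x := u) huv fun T hT huT hc => ?_
    by_contra hcon
    obtain ⟨o, ho, hoT⟩ := Set.not_subset.1 hcon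
    obtain ⟨x, hx, y, hy, hyv, hxy⟩ := h1 T v o ⟨u, huT⟩ (fun h => hT h rfl) hoT ho
    exact hy (hc x hx y hyv hxy)
  obtain ⟨A, hAP, hmin⟩ := WellFounded.has_min (measure (fun A : Set V => A.ncard)).wf
    {A | P A} hP
  replace hmin : ∀ A', P A' → A.ncard ≤ A'.ncard := fun A' h' => not_lt.1 (hmin A' h')
  obtain ⟨hA, hAc, huA, hvA, haA, hbA⟩ := hAP
  -- moving the part of `A` cut off by `y` to the other side
  have move : ∀ y ∈ A, y ≠ u → (∃ z ∈ Aᶜ, H.Adj y z) →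
      Conn H (comp H (A \ {y}) u) ∧ Conn H (comp H (A \ {y}) u)ᶜ := by
    rintro y hy hyu ⟨z, hz, hyz⟩
    refine ⟨conn_comp ⟨huA, fun h => hyu h.symm⟩, ?_⟩
    have hyR : y ∉ comp H (A \ {y}) u := fun h => (comp_subset h).2 rfl
    have := (hA.peel hy huA hyu).union_adj hAc (x := y) (y := z) ⟨hy, hyR⟩ hz hyz
    convert this using 1
    ext x
    simp only [Set.mem_compl_iff, Set.mem_union, Set.mem_sdiff]
    constructor
    · intro hx
      by_cases hxA : x ∈ A
      · exact Or.inl ⟨hxA, hx⟩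
      · exact Or.inr hxA
    · rintro (hx | hx) h
      · exact hx.2 h
      · exact hx (comp_subset h).1
  by_contra! hcon
  -- Keeping both `a` and `b` contradicts minimality, keeping exactly one contradicts `hcon`.
  have both : ∀ y ∈ A, y ≠ u → (∃ z ∈ Aᶜ, H.Adj y z) →
      a ∉ comp H (A \ {y}) u ∧ b ∉ comp H (A \ {y}) u := by
    intro y hy hyu hz
    obtain ⟨c1, c2⟩ := move y hy hyu hz
    have huR : u ∈ comp H (A \ {y}) u := mem_comp_self ⟨huA, fun h => hyu h.symm⟩
    have hvR : v ∉ comp H (A \ {y}) u := fun h => hvA (comp_subset h).1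
    by_cases ha : a ∈ comp H (A \ {y}) u <;> by_cases hb : b ∈ comp H (A \ {y}) u
    · have := hmin _ ⟨c1, c2, huR, hvR, ha, hb⟩
      have hlt : (comp H (A \ {y}) u).ncard < A.ncard :=
        Set.ncard_lt_ncard ⟨fun x hx => (comp_subset hx).1, fun h => (comp_subset (h hy)).2 rfl⟩
          (Set.toFinite _)
      omega
    · exact absurd ⟨c1, c2, huR, ha, hvR, hb⟩ (hcon _).1
    · exact absurd ⟨c1, c2, huR, hb, hvR, ha⟩ (hcon _).2
    · exact ⟨ha, hb⟩
  have hY : {y | y ∈ A ∧ y ≠ u ∧ ∃ z ∈ Aᶜ, H.Adj y z}.Nonempty := by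
    obtain ⟨x, hx, y, hy, hyu, hxy⟩ := h1 (A \ {u}) u v ⟨a, haA, hua.symm⟩ (fun h => h.2 rfl)
      (fun h => hvA h.1) huv.symm
    exact ⟨x, hx.1, hx.2, y, fun hyA => hy ⟨hyA, hyu⟩, hxy⟩
  -- The cut vertex farthest from `u`, in the sense that it cuts off the least. As `y` alone does
  -- not separate what lies behind it from `u`, some `y2` behind it also has a neighbour in `Aᶜ`;
  -- cutting at `y2` removes strictly less.
  obtain ⟨y, ⟨hyA, hyu, hyz⟩, hymin⟩ := WellFounded.has_min
    (measure (fun y : V => (A \ comp H (A \ {y}) u).ncard)).wf _ hY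
  obtain ⟨haR, hbR⟩ := both y hyA hyu hyz
  set R := comp H (A \ {y}) u with hR
  have huR : u ∈ R := mem_comp_self ⟨huA, fun h => hyu h.symm⟩
  have hyR : y ∉ R := fun h => (comp_subset h).2 rfl
  have hK : ((A \ R) \ {y}).Nonempty := by
    by_cases hay : a = y
    · exact ⟨b, ⟨hbA, hbR⟩, fun h => hab (hay.trans h.symm)⟩
    · exact ⟨a, ⟨haA, haR⟩, hay⟩
  obtain ⟨y2, hy2, w, hw, hwy, hy2w⟩ := h1 ((A \ R) \ {y}) y u hK (fun h => h.2 rfl)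
    (fun h => h.1.2 huR) (fun h => hyu h.symm)
  have hwA : w ∉ A := fun hwA => by
    have hwR : w ∈ R := by_contra fun h => hw ⟨⟨hwA, h⟩, hwy⟩
    exact hy2.1.2 (comp_closed hwR ⟨hy2.1.1, hy2.2⟩ hy2w.symm)
  have hy2u : y2 ≠ u := fun h => hy2.1.2 (h ▸ huR)
  refine hymin y2 ⟨hy2.1.1, hy2u, w, hwA, hy2w⟩ ?_
  show (A \ comp H (A \ {y2}) u).ncard < (A \ R).ncard
  have hRsub : R ⊆ comp H (A \ {y2}) u :=
    (conn_comp (S := A \ {y}) ⟨huA, fun h => hyu h.symm⟩).subset_comp (S := A \ {y2})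
      (fun x hx => ⟨(comp_subset hx).1, fun h : x = y2 => hy2.1.2 (h ▸ hx)⟩) huR
  obtain ⟨c, hc, hcy⟩ := hA.adj_comp hyA huA hyu
  have hyR2 : y ∈ comp H (A \ {y2}) u :=
    comp_closed (hRsub hc) ⟨hyA, fun h => hy2.2 h.symm⟩ hcy
  exact Set.ncard_lt_ncard ⟨fun x hx => ⟨hx.1, fun h => hx.2 (hRsub h)⟩,
    fun h => (h ⟨hyA, hyR⟩).2 hyR2⟩ (Set.toFinite _)

/-- The third set is the part of `A` outside the component of `u` in `A - y`. It contains `y`, which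
has neighbours both in that component and in `Aᶜ`. -/
theorem Linkage.triple_of_not_sep_of_adj {A : Set V} (h : Linkage H u v a b A) {y : V}
    (hy : y ∈ A) (hyu : y ≠ u) (hns : a ∈ comp H (A \ {y}) u) (hyB : ∃ z ∈ Aᶜ, H.Adj y z) :
    Triple H u v a b := by
  obtain ⟨z, hz, hyz⟩ := hyB
  obtain ⟨c, hc, hcy⟩ := h.conn.adj_comp hy h.u_mem hyu
  have hu : u ∈ A \ {y} := ⟨h.u_mem, fun h => hyu h.symm⟩
  have hyR : y ∉ comp H (A \ {y}) u := fun h => (comp_subset h).2 rfl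
  refine ⟨_, Aᶜ, _, conn_comp hu, h.conn_compl, h.conn.peel hy h.u_mem hyu, ?_, ?_, ?_,
    mem_comp_self hu, hns, h.v_mem, h.b_mem, ⟨y, ⟨hy, hyR⟩, c, hc, hcy.symm⟩,
    ⟨y, ⟨hy, hyR⟩, z, hz, hyz⟩⟩
  · exact Set.disjoint_left.2 fun x hx hx' => hx' (comp_subset hx).1
  · exact Set.disjoint_left.2 fun x hx hx' => hx'.2 hx
  · exact Set.disjoint_left.2 fun x hx hx' => hx hx'.1

/-- Let `Y` be the vertices of `A` with a neighbour in `Aᶜ`, and `K` the component of `d` in `A \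
Y`. The neighbours `N` of `K` all lie in `Y`. Reach `N` from `u` and from `a`; since two vertices do
not separate `K`, there is a further `y ∈ N`, and the two connections joined through `K` avoid it.
So `y` is a vertex as required by `triple_of_not_sep_of_adj`. -/
theorem Linkage.triple_of_not_adj {A : Set V} (h : Linkage H u v a b A) (h2 : No2Sep H)
    (huv : H.Adj u v) (hab : H.Adj a b) {d : V} (hd : d ∈ A) (hdB : ∀ z ∈ Aᶜ, ¬ H.Adj d z) :
    Triple H u v a b := by
  let Y : Set V := {y | y ∈ A ∧ ∃ z ∈ Aᶜ, H.Adj y z}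
  let K : Set V := comp H (A \ Y) d
  let N : Set V := {y | y ∈ Y ∧ ∃ x ∈ K, H.Adj x y}
  have hdY : d ∈ A \ Y := ⟨hd, fun hY => by obtain ⟨_, z, hz, h⟩ := hY; exact hdB z hz h⟩
  have hdK : d ∈ K := mem_comp_self hdY
  have hKA : K ⊆ A := fun x hx => (comp_subset hx).1
  have hKY : ∀ x ∈ K, x ∉ Y := fun x hx => (comp_subset hx).2
  have hNK : ∀ x ∈ K, ∀ y, y ∉ K → H.Adj x y → y ∈ N := by
    intro x hx y hy hxy
    by_cases hyA : y ∈ A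
    · refine ⟨by_contra fun hyY => hy (comp_closed hx ⟨hyA, hyY⟩ hxy), x, hx, hxy⟩
    · exact absurd ⟨hKA hx, y, hyA, hxy⟩ (hKY x hx)
  -- a connected set from an end of the path to `N`
  have reach : ∀ e ∈ Y, ∃ n ∈ N, ∃ R : Set V, Conn H R ∧ e ∈ R ∧ n ∈ R ∧ R ⊆ A ∧
      ∀ x ∈ R, x ∈ N → x = n := by
    intro e he
    by_cases heN : e ∈ N
    · exact ⟨e, heN, {e}, conn_singleton e, rfl, rfl, Set.singleton_subset_iff.2 he.1,
        fun x hx _ => hx⟩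
    · have heR : e ∈ A \ N := ⟨he.1, heN⟩
      have hdisj : comp H (A \ N) e ⊆ Kᶜ := by
        have := comp_subset_of (G := H) (S := A \ N) (x := e) (T := (A \ N) \ K)
          ⟨heR, fun h => hKY e h he⟩ (fun p hp q hq hpq => ⟨hq, fun hqK =>
            hp.1.2 (hNK q hqK p hp.2 hpq.symm)⟩)
        exact fun x hx => (this hx).2
      obtain ⟨x, hx, y, hyA, hyR, hxy⟩ := h.conn.exists_adj (T := comp H (A \ N) e)
        (fun x hx => (comp_subset hx).1) ⟨e, mem_comp_self heR⟩ (hKA hdK)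
        (fun hdR => hdisj hdR hdK)
      have hyN : y ∈ N := by_contra fun hyN => hyR (comp_closed hx ⟨hyA, hyN⟩ hxy)
      refine ⟨y, hyN, comp H (A \ N) e ∪ {y},
        (conn_comp heR).union_adj (conn_singleton y) hx rfl hxy, Or.inl (mem_comp_self heR),
        Or.inr rfl, Set.union_subset (fun x hx => (comp_subset hx).1)
          (Set.singleton_subset_iff.2 hyA), ?_⟩
      rintro z (hz | hz) hzN
      · exact absurd hzN (comp_subset hz).2
      · exact hz
  obtain ⟨nu, hnu, Ru, hRu, huR, hnuR, hRuA, hRuN⟩ := reach u ⟨h.u_mem, v, h.v_mem, huv⟩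
  obtain ⟨na, hna, Ra, hRa, haR, hnaR, hRaA, hRaN⟩ := reach a ⟨h.a_mem, b, h.b_mem, hab⟩
  obtain ⟨x, hx, y, hyK, hyu, hya, hxy⟩ := h2 K nu na v ⟨d, hdK⟩ (fun hk => hKY _ hk hnu.1)
    (fun hk => hKY _ hk hna.1) (fun hk => h.v_mem (hKA hk)) (fun hv => h.v_mem (hv ▸ hnu.1.1))
    (fun hv => h.v_mem (hv ▸ hna.1.1))
  have hyN : y ∈ N := hNK x hx y hyK hxy
  have hyRu : y ∉ Ru := fun h' => hyu (hRuN y h' hyN)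
  have hyRa : y ∉ Ra := fun h' => hya (hRaN y h' hyN)
  obtain ⟨xu, hxu, hxu'⟩ := hnu.2
  obtain ⟨xa, hxa, hxa'⟩ := hna.2
  have hC : Conn H ((Ru ∪ K) ∪ Ra) :=
    (hRu.union_adj (conn_comp hdY) hnuR hxu hxu'.symm).union_adj hRa (Or.inr hxa) hnaR hxa'
  refine h.triple_of_not_sep_of_adj hyN.1.1 (fun hyu => hyRu (hyu ▸ huR)) ?_ hyN.1.2
  refine hC.subset_comp ?_ (Or.inl (Or.inl huR)) (Or.inr haR)
  rintro z ((hz | hz) | hz)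
  · exact ⟨hRuA hz, fun h : z = y => hyRu (h ▸ hz)⟩
  · exact ⟨hKA hz, fun h : z = y => hyK (h ▸ hz)⟩
  · exact ⟨hRaA hz, fun h : z = y => hyRa (h ▸ hz)⟩

/-- Read contrapositively: without a `Triple`, every connected subset of `A` through `u` and `a`
uses all of `A`. This forces the path-like structure recorded in `Ladder`. -/
theorem Linkage.triple_of_not_sep {A : Set V} (h : Linkage H u v a b A) (h2 : No2Sep H)
    (huv : H.Adj u v) (hab : H.Adj a b) {y : V} (hy : y ∈ A) (hyu : y ≠ u)
    {C : Set V} (hC : Conn H C) (hCA : C ⊆ A) (hyC : y ∉ C) (huC : u ∈ C) (haC : a ∈ C) :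
    Triple H u v a b := by
  by_cases hyB : ∃ z ∈ Aᶜ, H.Adj y z
  · exact h.triple_of_not_sep_of_adj hy hyu (hC.subset_comp (S := A \ {y})
      (fun x hx => ⟨hCA hx, fun h : x = y => hyC (h ▸ hx)⟩) huC haC) hyB
  · push Not at hyB
    exact h.triple_of_not_adj h2 huv hab hy hyB

/-- In a connected set, one of two vertices reaches a third one while avoiding the other. -/
theorem Conn.avoid {Q : Set V} {r s : V} (hQ : Conn H Q) (hr : r ∈ Q) (hs : s ∈ Q) (hb : b ∈ Q)
    (hrs : r ≠ s) : (∃ C ⊆ Q, Conn H C ∧ r ∈ C ∧ b ∈ C ∧ s ∉ C) ∨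
      ∃ C ⊆ Q, Conn H C ∧ s ∈ C ∧ b ∈ C ∧ r ∉ C := by
  by_cases hbr : b = r
  · exact Or.inl ⟨{r}, Set.singleton_subset_iff.2 hr, conn_singleton r, rfl, hbr, hrs.symm⟩
  by_cases hbs : b = s
  · exact Or.inr ⟨{s}, Set.singleton_subset_iff.2 hs, conn_singleton s, rfl, hbs, hrs⟩
  have hbS : b ∈ Q \ {r, s} := ⟨hb, by simp [hbr, hbs]⟩
  set R := comp H (Q \ {r, s}) b with hR
  obtain ⟨x, hx, y, hyQ, hyR, hxy⟩ := hQ.exists_adj (T := R) (y := r)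
    (fun x hx => (comp_subset hx).1) ⟨b, mem_comp_self hbS⟩ hr
    (fun h => (comp_subset h).2 (Or.inl rfl))
  have hy : y = r ∨ y = s := by
    by_contra hne
    exact hyR (comp_closed hx ⟨hyQ, by simpa using hne⟩ hxy)
  have hc : Conn H (R ∪ {y}) := (conn_comp hbS).union_adj (conn_singleton y) hx rfl hxy
  have hsub : R ∪ {y} ⊆ Q :=
    Set.union_subset (fun x hx => (comp_subset hx).1) (Set.singleton_subset_iff.2 hyQ)
  rcases hy with rfl | rfl
  · exact Or.inl ⟨_, hsub, hc, Or.inr rfl, Or.inl (mem_comp_self hbS), fun h => by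
      rcases h with h | h
      · exact (comp_subset h).2 (Or.inr rfl)
      · exact hrs h.symm⟩
  · exact Or.inr ⟨_, hsub, hc, Or.inr rfl, Or.inl (mem_comp_self hbS), fun h => by
      rcases h with h | h
      · exact (comp_subset h).2 (Or.inl rfl)
      · exact hrs h⟩

/-- A linkage whose two sides are split at adjacent vertices `d` and `q`. -/
structure Ladder (H : SimpleGraph V) (u v a b d q : V) (U U' Q Q' : Set V) : Prop where
  cover : ∀ x, x ∈ U ∨ x = d ∨ x ∈ U' ∨ x ∈ Q ∨ x = q ∨ x ∈ Q'
  linkage : Linkage H u v a b (U ∪ {d} ∪ U')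
  disj_U_U' : Disjoint U U'
  disj_Q_Q' : Disjoint Q Q'
  d_notMem : d ∉ U ∧ d ∉ U'
  q_notMem : q ∉ Q ∧ q ∉ Q'
  compl_eq : (U ∪ {d} ∪ U')ᶜ = Q ∪ {q} ∪ Q'
  conn_U : Conn H U
  conn_U' : Conn H U'
  conn_Q' : Q'.Nonempty → Conn H Q'
  conn_Qq : Conn H (Q ∪ {q})
  u_mem : u ∈ U
  a_mem : a ∈ U'
  v_mem : v ∈ Q ∪ {q}
  b_mem : Q'.Nonempty → b ∈ Q'
  adj_dq : H.Adj d q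
  adj_dU : ∃ x ∈ U, H.Adj d x
  adj_dU' : ∃ x ∈ U', H.Adj d x
  not_adj_U : ∀ x ∈ U, ∀ y ∈ U', ¬ H.Adj x y
  not_adj_Q : ∀ x ∈ Q, ∀ y ∈ Q', ¬ H.Adj x y

/-- The edge `pr` crosses over, so `U ∪ Q'` against `Q ∪ {q, d} ∪ U'` is a second linkage, joining
`u` to `b` and `v` to `a`. Since `{d, r}` does not separate `u` from `U' ∪ (Q' \ {r})`, one more
edge leaves this set. Wherever it ends, either `{d}` becomes free to be the third set, or one of the
two linkages has an avoidable vertex. -/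
theorem Ladder.triple {d q p r : V} {U U' Q Q' : Set V} (L : Ladder H u v a b d q U U' Q Q')
    (h2 : No2Sep H) (huv : H.Adj u v) (hab : H.Adj a b)
    (hp : p ∈ U) (hr : r ∈ Q') (hpr : H.Adj p r) : Triple H u v a b ∨ Triple H u v b a := by
  by_contra hno
  have hno1 : ¬ Triple H u v a b := fun h => hno (Or.inl h)
  have hno2 : ¬ Triple H u v b a := fun h => hno (Or.inr h)
  have hQ' : Conn H Q' := L.conn_Q' ⟨r, hr⟩
  have hbQ' : b ∈ Q' := L.b_mem ⟨r, hr⟩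
  have hsubQ : Q ∪ {q} ∪ Q' ⊆ (U ∪ {d} ∪ U')ᶜ := L.compl_eq.ge
  have dAB : ∀ x, x ∈ U ∪ {d} ∪ U' → x ∈ Q ∪ {q} ∪ Q' → False := fun x hx hx' => hsubQ hx' hx
  have hcompl : (U ∪ Q')ᶜ = Q ∪ {q} ∪ ({d} ∪ U') := by
    ext x
    have d2 : x ∈ U → x ∉ U' := fun h => Set.disjoint_left.1 L.disj_U_U' h
    have d3 : x ∈ Q → x ∉ Q' := fun h => Set.disjoint_left.1 L.disj_Q_Q' h
    constructor
    · intro hx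
      rcases L.cover x with h | h | h | h | h | h
      · exact absurd (Or.inl h) hx
      · exact Or.inr (Or.inl h)
      · exact Or.inr (Or.inr h)
      · exact Or.inl (Or.inl h)
      · exact Or.inl (Or.inr h)
      · exact absurd (Or.inr h) hx
    · rintro (hx | hx) (h | h)
      · exact dAB x (Or.inl (Or.inl h)) (Or.inl hx)
      · rcases hx with hx | hx
        · exact d3 hx h
        · exact L.q_notMem.2 (Set.mem_singleton_iff.1 hx ▸ h)
      · rcases hx with hx | hx
        · exact L.d_notMem.1 (Set.mem_singleton_iff.1 hx ▸ h)
        · exact d2 h hx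
      · rcases hx with hx | hx
        · exact dAB x (Or.inl (Or.inr hx)) (Or.inr h)
        · exact dAB x (Or.inr hx) (Or.inr h)
  obtain ⟨d', hd', hdd'⟩ := L.adj_dU'
  have cdU' : Conn H ({d} ∪ U') :=
    (conn_singleton d).union_adj L.conn_U' (Set.mem_singleton d) hd' hdd'
  have link2 : Linkage H u v b a (U ∪ Q') := by
    refine ⟨L.conn_U.union_adj hQ' hp hr hpr, ?_, Or.inl L.u_mem, Or.inr hbQ', ?_, ?_⟩
    · rw [hcompl]
      exact L.conn_Qq.union_adj cdU' (x := q) (y := d) (by simp) (by simp) L.adj_dq.symm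
    · rw [hcompl]; exact Or.inl L.v_mem
    · rw [hcompl]; exact Or.inr (Or.inr L.a_mem)
  have huQ' : ∀ x ∈ Q', x ≠ u := fun x hx hxu =>
    dAB x (Or.inl (Or.inl (hxu ▸ L.u_mem))) (Or.inr hx)
  -- a vertex of `Q'` that reaches `b` avoiding `s`
  have avoidA : ∀ (s t p' : V) (C : Set V), s ∈ Q' → t ∈ Q' → C ⊆ Q' → Conn H C → t ∈ C → b ∈ C →
      s ∉ C → p' ∈ U → H.Adj p' t → False := by
    intro s t p' C hs ht hCQ hC htC hbC hsC hp' hpt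
    refine hno2 (link2.triple_of_not_sep h2 huv hab.symm (Or.inr hs) (huQ' s hs)
      (L.conn_U.union_adj hC hp' htC hpt) (Set.union_subset_union_right _ hCQ) ?_
      (Or.inl L.u_mem) (Or.inr hbC))
    rintro (h | h)
    · exact dAB s (Or.inl (Or.inl h)) (Or.inr hs)
    · exact hsC h
  have avoidB : ∀ (s t : V) (C : Set V), s ∈ Q' → t ∈ Q' → C ⊆ Q' → Conn H C → t ∈ C → b ∈ C →
      s ∉ C → H.Adj q t → False := by
    intro s t C hs ht hCQ hC htC hbC hsC hqt
    have hsQ : s ∉ Q ∪ {q} := by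
      rintro (h | h)
      · exact Set.disjoint_left.1 L.disj_Q_Q' h hs
      · exact L.q_notMem.2 ((Set.mem_singleton_iff.1 h) ▸ hs)
    refine hno1 (L.linkage.swap.triple_of_not_sep h2 huv.symm hab.symm (y := s)
      (C := Q ∪ {q} ∪ C) ?_ ?_
      (L.conn_Qq.union_adj hC (Or.inr rfl) htC hqt) ?_ ?_ (Or.inl L.v_mem) (Or.inr hbC)).swap
    · rw [L.compl_eq]; exact Or.inr hs
    · exact fun h => hsQ (h ▸ L.v_mem)
    · rw [L.compl_eq]; exact Set.union_subset_union_right _ hCQ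
    · exact fun h => h.elim hsQ hsC
  obtain ⟨e, heU, hde⟩ := L.adj_dU
  obtain ⟨x, hx, y, hy, hyd, hyr, hxy⟩ := h2 (U' ∪ (Q' \ {r})) d r u ⟨a, Or.inl L.a_mem⟩
    (by
      rintro (h | h)
      · exact L.d_notMem.2 h
      · exact dAB d (Or.inl (Or.inr rfl)) (Or.inr h.1))
    (by
      rintro (h | h)
      · exact dAB r (Or.inr h) (Or.inr hr)
      · exact h.2 rfl)
    (by
      rintro (h | h)
      · exact Set.disjoint_left.1 L.disj_U_U' L.u_mem h
      · exact huQ' u h.1 rfl)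
    (fun h => L.d_notMem.1 (h ▸ L.u_mem)) (fun h => huQ' r hr h.symm)
  have hyleft : y ∈ U ∨ y ∈ Q ∪ {q} := by
    rcases L.cover y with h | h | h | h | h | h
    · exact Or.inl h
    · exact absurd h hyd
    · exact absurd (Or.inl h) hy
    · exact Or.inr (Or.inl h)
    · exact Or.inr (Or.inr h)
    · exact absurd (Or.inr ⟨h, hyr⟩) hy
  rcases hx with hx | ⟨hx, hxr⟩
  · rcases hyleft with hyU | hyQ
    · exact L.not_adj_U y hyU x hx hxy.symm
    -- The new edge joins `U'` to `Q ∪ {q}` directly, so the second linkage no longer needs `d`.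
    · refine hno2 ⟨U ∪ Q', (Q ∪ {q}) ∪ U', {d}, link2.conn,
        L.conn_Qq.union_adj L.conn_U' hyQ hx hxy.symm, conn_singleton d, ?_, ?_, ?_,
        Or.inl L.u_mem, Or.inr hbQ', Or.inl L.v_mem, Or.inr L.a_mem, ⟨d, rfl, e, Or.inl heU, hde⟩,
        ⟨d, rfl, q, Or.inl (Or.inr rfl), L.adj_dq⟩⟩
      · rw [Set.disjoint_left]
        intro z hz hz'
        have : z ∈ (U ∪ Q')ᶜ := by
          rw [hcompl]
          rcases hz' with h | h
          · exact Or.inl h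
          · exact Or.inr (Or.inr h)
        exact this hz
      · rw [Set.disjoint_right]
        rintro z rfl hz
        have : z ∈ (U ∪ Q')ᶜ := by rw [hcompl]; exact Or.inr (Or.inl rfl)
        exact this hz
      · rw [Set.disjoint_right]
        rintro z rfl (hz | hz)
        · exact dAB z (Or.inl (Or.inr rfl)) (Or.inl hz)
        · exact L.d_notMem.2 hz
  -- Both `r` and `x` are now entrances to `Q'`. One of them reaches `b` inside `Q'` without the
  -- other, and the other is then avoidable.
  · have hrx : r ≠ x := fun h => hxr h.symm
    rcases hyleft with hyU | hyQ | hyq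
    · rcases hQ'.avoid (b := b) hr hx hbQ' hrx with ⟨C, hCQ, hC, h1, h3, h4⟩ | ⟨C, hCQ, hC, h1, h3, h4⟩
      · exact avoidA x r p C hx hr hCQ hC h1 h3 h4 hp hpr
      · exact avoidA r x y C hr hx hCQ hC h1 h3 h4 hyU hxy.symm
    · exact L.not_adj_Q y hyQ x hx hxy.symm
    · rw [Set.mem_singleton_iff.1 hyq] at hxy
      rcases hQ'.avoid (b := b) hr hx hbQ' hrx with ⟨C, hCQ, hC, h1, h3, h4⟩ | ⟨C, hCQ, hC, h1, h3, h4⟩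
      · exact avoidA x r p C hx hr hCQ hC h1 h3 h4 hp hpr
      · exact avoidB r x C hr hx hCQ hC h1 h3 h4 hxy.symm

theorem Conn.comp_union {A : Set V} {y : V} (hA : Conn H A) (hy : y ∈ A) (hu : u ∈ A) :
    Conn H (comp H (A \ {y}) u ∪ {y}) := by
  by_cases hyu : y = u
  -- A component is empty by definition when its base vertex is outside the ambient set.
  · have : comp H (A \ {y}) u = ∅ := by
      ext x
      simp only [Set.mem_empty_iff_false, iff_false]
      exact fun hx => hx.1.2 hyu.symm
    rw [this, Set.empty_union]
    exact conn_singleton y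
  · obtain ⟨c, hc, hcy⟩ := hA.adj_comp hy hu hyu
    exact (conn_comp (S := A \ {y}) ⟨hu, fun h => hyu h.symm⟩).union_adj (conn_singleton y) hc rfl hcy

/-- If some path inside a connected set from `u` to `a` must use `y`, and all other vertices are
separating too, then the set splits at `y`. -/
theorem Linkage.split {A : Set V} {y : V} (h : Linkage H u v a b A) (h2 : No2Sep H)
    (huv : H.Adj u v) (hab : H.Adj a b) (hy : y ∈ A) (no : ¬ Triple H u v a b) :
    A = comp H (A \ {y}) u ∪ {y} ∪ comp H (A \ {y}) a ∧
      Disjoint (comp H (A \ {y}) u) (comp H (A \ {y}) a) := by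
  constructor
  · refine Set.Subset.antisymm (fun x hx => ?_) (Set.union_subset (Set.union_subset
      (fun x hx => (comp_subset hx).1) (Set.singleton_subset_iff.2 hy))
      (fun x hx => (comp_subset hx).1))
    by_contra hcon
    have hC := (h.conn.comp_union hy h.u_mem).union (h.conn.comp_union hy h.a_mem)
      ⟨y, Or.inr rfl, Or.inr rfl⟩
    have hend : ∀ e ∈ A, e ∈ comp H (A \ {y}) e ∪ {y} := by
      intro e he
      by_cases hey : e = y
      · exact Or.inr hey
      · exact Or.inl (mem_comp_self ⟨he, hey⟩)
    have hsub : ∀ e, comp H (A \ {y}) e ∪ {y} ⊆ A := fun e =>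
      Set.union_subset (fun x hx => (comp_subset hx).1) (Set.singleton_subset_iff.2 hy)
    refine no (h.triple_of_not_sep h2 huv hab hx ?_ hC (Set.union_subset (hsub u) (hsub a)) ?_
      (Or.inl (hend u h.u_mem)) (Or.inr (hend a h.a_mem)))
    · rintro rfl
      exact hcon (Or.inl (hend x hx))
    · simp only [Set.mem_union, Set.mem_singleton_iff] at hcon ⊢
      tauto
  · rw [Set.disjoint_left]
    intro x hxu hxa
    have hu := hxu.1
    have ha := hxa.1
    have hC := (conn_comp hu).union (conn_comp ha) ⟨x, hxu, hxa⟩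
    exact no (h.triple_of_not_sep h2 huv hab hy (fun h => hu.2 h.symm) hC
      (Set.union_subset (fun x hx => (comp_subset hx).1) (fun x hx => (comp_subset hx).1))
      (fun h => h.elim (fun h => (comp_subset h).2 rfl) (fun h => (comp_subset h).2 rfl))
      (Or.inl (mem_comp_self hu)) (Or.inr (mem_comp_self ha)))

/-- Both sides split by `Linkage.split`. The vertex `d` is not an end, but `q` may be `v` or `b`, in
which case `Q` or `Q'` is empty; this is why the corresponding fields of `Ladder` are conditional.
-/
theorem Linkage.ladder {A : Set V} {d q : V} (h : Linkage H u v a b A) (h2 : No2Sep H)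
    (huv : H.Adj u v) (hab : H.Adj a b) (hd : d ∈ A) (hdu : d ≠ u) (hda : d ≠ a) (hq : q ∈ Aᶜ)
    (hdq : H.Adj d q) (no : ¬ Triple H u v a b) :
    Ladder H u v a b d q (comp H (A \ {d}) u) (comp H (A \ {d}) a) (comp H (Aᶜ \ {q}) v)
      (comp H (Aᶜ \ {q}) b) := by
  obtain ⟨e1, d1⟩ := h.split h2 huv hab hd no
  obtain ⟨e2, d2⟩ := h.swap.split h2 huv.symm hab.symm hq (fun h => no h.swap)
  have hu : u ∈ A \ {d} := ⟨h.u_mem, fun h => hdu h.symm⟩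
  have ha : a ∈ A \ {d} := ⟨h.a_mem, fun h => hda h.symm⟩
  have nonadj : ∀ (S : Set V) (e f : V), Disjoint (comp H S e) (comp H S f) →
      ∀ x ∈ comp H S e, ∀ y ∈ comp H S f, ¬ H.Adj x y := fun S e f hdis x hx y hy hxy =>
    Set.disjoint_left.1 hdis (comp_closed hx (comp_subset hy) hxy) hy
  obtain ⟨c1, hc1, hc1d⟩ := h.conn.adj_comp hd h.u_mem hdu
  obtain ⟨c2, hc2, hc2d⟩ := h.conn.adj_comp hd h.a_mem hda
  refine ⟨fun x => ?_, e1 ▸ h, d1, d2, ⟨fun h => (comp_subset h).2 rfl,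
    fun h => (comp_subset h).2 rfl⟩, ⟨fun h => (comp_subset h).2 rfl,
    fun h => (comp_subset h).2 rfl⟩, ?_, conn_comp hu, conn_comp ha, ?_,
    h.conn_compl.comp_union hq h.v_mem, mem_comp_self hu, mem_comp_self ha, ?_, ?_, hdq,
    ⟨c1, hc1, hc1d.symm⟩, ⟨c2, hc2, hc2d.symm⟩, nonadj _ _ _ d1, nonadj _ _ _ d2⟩
  · have hx : x ∈ A ∨ x ∈ Aᶜ := em _
    rcases hx with hx | hx
    · rw [e1] at hx
      rcases hx with (hx | hx) | hx
      · exact Or.inl hx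
      · exact Or.inr (Or.inl hx)
      · exact Or.inr (Or.inr (Or.inl hx))
    · rw [e2] at hx
      rcases hx with (hx | hx) | hx
      · exact Or.inr (Or.inr (Or.inr (Or.inl hx)))
      · exact Or.inr (Or.inr (Or.inr (Or.inr (Or.inl hx))))
      · exact Or.inr (Or.inr (Or.inr (Or.inr (Or.inr hx))))
  · rw [← e1, ← e2]
  · rintro ⟨x, hx⟩
    exact conn_comp hx.1
  · by_cases hvq : v = q
    · exact Or.inr hvq
    · exact Or.inl (mem_comp_self ⟨h.v_mem, hvq⟩)
  · rintro ⟨x, hx⟩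
    exact mem_comp_self hx.1

/-- If there is no `Triple`, then `d` has a neighbour `q` on the other side and the linkage is a
ladder with rung `dq`. Two vertices do not separate the part near `u` and `v` from the part near `a`
and `b`, so some edge passes between them; it must cross over, and `Ladder.triple` applies to the
ladder or to its reverse. -/
theorem Linkage.triple_of_mem {A : Set V} {d : V} (h : Linkage H u v a b A) (h2 : No2Sep H)
    (huv : H.Adj u v) (hab : H.Adj a b) (hd : d ∈ A) (hdu : d ≠ u) (hda : d ≠ a) :
    Triple H u v a b ∨ Triple H u v b a := by
  by_contra hno
  have hno1 : ¬ Triple H u v a b := fun h => hno (Or.inl h)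
  have hno2 : ¬ Triple H u v b a := fun h => hno (Or.inr h)
  have hq : ∃ q ∈ Aᶜ, H.Adj d q := by
    by_contra! hcon
    exact hno1 (h.triple_of_not_adj h2 huv hab hd hcon)
  obtain ⟨q, hq, hdq⟩ := hq
  have L := h.ladder h2 huv hab hd hdu hda hq hdq hno1
  have L' := h.reverse.ladder h2 hab huv hd hda hdu hq hdq (fun h => hno1 h.reverse)
  obtain ⟨x, hx, y, hy, hyd, hyq, hxy⟩ := h2
    (comp H (A \ {d}) u ∪ comp H (Aᶜ \ {q}) v) d q a ⟨u, Or.inl L.u_mem⟩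
    (by
      rintro (h | h)
      · exact L.d_notMem.1 h
      · exact (comp_subset h).1 hd)
    (by
      rintro (h | h)
      · exact hq (comp_subset h).1
      · exact L.q_notMem.1 h)
    (by
      rintro (h' | h')
      · exact Set.disjoint_left.1 L.disj_U_U' h' L.a_mem
      · exact (comp_subset h').1 h.a_mem) hda.symm (fun haq => hq (haq ▸ h.a_mem))
  have hy' : y ∈ comp H (A \ {d}) a ∨ y ∈ comp H (Aᶜ \ {q}) b := by
    rcases L.cover y with h | h | h | h | h | h
    · exact absurd (Or.inl h) hy
    · exact absurd h hyd
    · exact Or.inl h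
    · exact absurd (Or.inr h) hy
    · exact absurd h hyq
    · exact Or.inr h
  rcases hx with hx | hx <;> rcases hy' with hy' | hy'
  · exact L.not_adj_U x hx y hy' hxy
  · exact hno (L.triple h2 huv hab hx hy' hxy)
  · rcases L'.triple h2 hab huv hy' hx hxy.symm with h | h
    · exact hno1 h.reverse
    · exact hno2 h.swap.reverse.swap.swap
  · exact L.not_adj_Q x hx y hy' hxy

/-- The first set is `{u}` and the third is `{d}` for a neighbour `d` of `u` other than `v` and `b`;
all remaining vertices stay connected after deleting `u` and `d`. -/
theorem triple_of_common_end (h3 : IsKConnected 3 H) (huv : H.Adj u v) (hub : H.Adj u b) :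
    Triple H u v u b := by
  classical
  have h2 := h3.no2Sep
  have hne := h3.1
  have : Finite V := h3.finite
  have : ∃ o, o ∉ ({u, v, b} : Set V) := by
    by_contra! hcon
    have h1 : (Set.univ : Set V) ⊆ {u, v, b} := fun x _ => hcon x
    have h2 := Set.ncard_le_ncard h1 (Set.toFinite _)
    rw [Set.ncard_univ] at h2
    have h4 : ({u, v, b} : Set V).ncard ≤ 3 := by
      refine (Set.ncard_insert_le _ _).trans ?_
      have := Set.ncard_insert_le v ({b} : Set V)
      rw [Set.ncard_singleton] at this
      omega
    omega
  obtain ⟨o, ho⟩ := this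
  simp only [Set.mem_insert_iff, Set.mem_singleton_iff, not_or] at ho
  obtain ⟨x, hx, d, hd, hdv, hdb, hud⟩ := h2 {u} v b o ⟨u, rfl⟩ (fun h => huv.ne h.symm)
    (fun h => hub.ne h.symm) ho.1 ho.2.1 ho.2.2
  rw [Set.mem_singleton_iff] at hx hd
  subst hx
  have hB : Conn H {x, d}ᶜ := by
    have := h3.2 {x, d} (lt_of_le_of_lt Finset.card_le_two (by norm_num))
    rw [Finset.coe_insert, Finset.coe_singleton] at this
    exact this
  obtain ⟨w, hw, y, hy, hyx, hdy⟩ := h2.no1Sep {d} x v ⟨d, rfl⟩ (fun h => hd h.symm)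
    (fun h => hdv h.symm) (fun h => huv.ne h.symm)
  rw [Set.mem_singleton_iff] at hw hy
  subst hw
  refine ⟨{x}, {x, w}ᶜ, {w}, conn_singleton x, hB, conn_singleton w, ?_, ?_, ?_, rfl, rfl, ?_, ?_,
    ⟨w, rfl, x, rfl, hud.symm⟩, ⟨w, rfl, y, ?_, hdy⟩⟩
  · simp
  · simpa using fun h : x = w => hd h.symm
  · simp
  · simpa using ⟨fun h => huv.ne h.symm, fun h => hdv h.symm⟩
  · simpa using ⟨fun h => hub.ne h.symm, fun h => hdb h.symm⟩
  · simpa using ⟨hyx, hy⟩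

/-- Two edges of a 3-connected graph other than a perfect matching of `K_4` are joined by a
`Triple`. -/
theorem exists_triple (h3 : IsKConnected 3 H) (huv : H.Adj u v) (hab : H.Adj a b)
    : Triple H u v a b ∨ Triple H u v b a ∨
      (u ≠ a ∧ u ≠ b ∧ v ≠ a ∧ v ≠ b ∧ ∀ x, x = u ∨ x = v ∨ x = a ∨ x = b) := by
  have := h3.finite
  by_cases hua : u = a
  · subst hua
    exact Or.inl (triple_of_common_end h3 huv hab)
  by_cases hub : u = b
  · subst hub
    exact Or.inr (Or.inl (triple_of_common_end h3 huv hab.symm))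
  by_cases hva : v = a
  · subst hva
    exact Or.inr (Or.inl (triple_of_common_end h3 huv.symm hab).swap)
  by_cases hvb : v = b
  · subst hvb
    exact Or.inl (triple_of_common_end h3 huv.symm hab.symm).swap
  have h2 := h3.no2Sep
  by_cases hall : ∀ x, x = u ∨ x = v ∨ x = a ∨ x = b
  · exact Or.inr (Or.inr ⟨hua, hub, hva, hvb, hall⟩)
  push Not at hall
  obtain ⟨d, hdu, hdv, hda, hdb⟩ := hall
  -- A fifth vertex `d` lies on one of the two sides of any linkage, and the sides are
  -- interchangeable.
  have key : ∀ a b : V, H.Adj a b → d ≠ a → d ≠ b → ∀ A, Linkage H u v a b A →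
      Triple H u v a b ∨ Triple H u v b a := by
    intro a b hab hda hdb A hA
    by_cases hd : d ∈ A
    · exact hA.triple_of_mem h2 huv hab hd hdu hda
    · exact (hA.swap.triple_of_mem h2 huv.symm hab.symm hd hdv hdb).imp Triple.swap Triple.swap
  obtain ⟨A, hA | hA⟩ := exists_linkage h2.no1Sep huv.ne hva hvb hua hab.ne
  · rcases key a b hab hda hdb A hA with h | h
    exacts [Or.inl h, Or.inr (Or.inl h)]
  · rcases key b a hab.symm hdb hda A hA with h | h
    exacts [Or.inr (Or.inl h), Or.inl h]

end Linkage

/-! ### Frames and their 2-sums. -/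

/-- A graph `N` with marked pairwise nonadjacent vertices `z i` of degree two, whose unmarked
vertices are placed injectively into `V`. -/
structure Frame (V : Type u) (ι : Type u) where
  W : Type u
  N : SimpleGraph W
  φ : W → V
  z : ι → W
  s : ι → W
  t : ι → W
  z_injective : Function.Injective z
  z_not_adj : ∀ i j, ¬ N.Adj (z i) (z j)
  s_ne_t : ∀ i, s i ≠ t i
  neighborSet_z : ∀ i, N.neighborSet (z i) = {s i, t i}
  φ_injOn : Set.InjOn φ (Set.range z)ᶜ

namespace Frame

variable {V ι : Type u} (F : Frame V ι)

/-- The vertices of `V` used by the frame. -/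
def verts : Set V := F.φ '' (Set.range F.z)ᶜ

/-- The edges of the frame between unmarked vertices, as a relation on `V`. -/
def edges (a b : V) : Prop :=
  ∃ p ∉ Set.range F.z, ∃ q ∉ Set.range F.z, F.N.Adj p q ∧ F.φ p = a ∧ F.φ q = b

/-- The two vertices of `V` next to a marked vertex. -/
def ends (i : ι) : Set V := {F.φ (F.s i), F.φ (F.t i)}

variable {F}

theorem adj_z_iff {i : ι} {a : F.W} : F.N.Adj (F.z i) a ↔ a = F.s i ∨ a = F.t i := by
  rw [← SimpleGraph.mem_neighborSet, F.neighborSet_z]; rfl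

theorem s_notMem (i : ι) : F.s i ∉ Set.range F.z := fun ⟨j, hj⟩ =>
  F.z_not_adj i j (hj ▸ adj_z_iff.2 (Or.inl rfl))

theorem t_notMem (i : ι) : F.t i ∉ Set.range F.z := fun ⟨j, hj⟩ =>
  F.z_not_adj i j (hj ▸ adj_z_iff.2 (Or.inr rfl))

theorem mem_verts {p : F.W} (hp : p ∉ Set.range F.z) : F.φ p ∈ F.verts := ⟨p, hp, rfl⟩

theorem s_mem (i : ι) : F.φ (F.s i) ∈ F.verts := mem_verts (s_notMem i)

theorem t_mem (i : ι) : F.φ (F.t i) ∈ F.verts := mem_verts (t_notMem i)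

theorem ends_subset (i : ι) : F.ends i ⊆ F.verts :=
  Set.insert_subset (s_mem i) (Set.singleton_subset_iff.2 (t_mem i))

theorem edges_symm {a b : V} (h : F.edges a b) : F.edges b a := by
  obtain ⟨p, hp, q, hq, h, h1, h2⟩ := h
  exact ⟨q, hq, p, hp, h.symm, h2, h1⟩

theorem edges_ne {a b : V} (h : F.edges a b) : a ≠ b := by
  obtain ⟨p, hp, q, hq, h, rfl, rfl⟩ := h
  exact fun heq => h.ne (F.φ_injOn hp hq heq)

theorem edges_mem {a b : V} (h : F.edges a b) : a ∈ F.verts ∧ b ∈ F.verts := by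
  obtain ⟨p, hp, q, hq, -, rfl, rfl⟩ := h
  exact ⟨mem_verts hp, mem_verts hq⟩

end Frame

/-- Change of the index set of a 2-sum. -/
def TwoSum.reindex {V V₁ ι κ : Type*} {W : ι → Type*} {G : SimpleGraph V} {G₁ : SimpleGraph V₁}
    {H : ∀ i, SimpleGraph (W i)} (S : TwoSum G G₁ H) (e : κ ≃ ι) :
    TwoSum G G₁ (fun k => H (e k)) where
  z k := S.z (e k)
  x k := S.x (e k)
  y k := S.y (e k)
  w k := S.w (e k)
  x' k := S.x' (e k)
  y' k := S.y' (e k)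
  z_injective := S.z_injective.comp e.injective
  z_not_adj i j := S.z_not_adj _ _
  x_ne_y i := S.x_ne_y _
  neighborSet_z i := S.neighborSet_z _
  x'_ne_y' i := S.x'_ne_y' _
  neighborSet_w i := S.neighborSet_w _
  f := S.f
  g k := S.g (e k)
  f_injOn := by
    rw [show Set.range (fun k => S.z (e k)) = Set.range S.z from e.surjective.range_comp S.z]
    exact S.f_injOn
  g_injOn i := S.g_injOn _
  glue_x i := S.glue_x _
  glue_y i := S.glue_y _
  f_inter_g i := by
    rw [show Set.range (fun k => S.z (e k)) = Set.range S.z from e.surjective.range_comp S.z]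
    exact S.f_inter_g _
  g_inter_g i j hij := S.g_inter_g _ _ (fun h => hij (e.injective h))
  cover v := by
    rw [show Set.range (fun k => S.z (e k)) = Set.range S.z from e.surjective.range_comp S.z]
    refine (S.cover v).imp id ?_
    rintro ⟨i, h⟩
    obtain ⟨k, rfl⟩ := e.surjective i
    exact ⟨k, h⟩
  adj_iff u v := by
    rw [show Set.range (fun k => S.z (e k)) = Set.range S.z from e.surjective.range_comp S.z,
      S.adj_iff]
    refine or_congr Iff.rfl ⟨?_, fun ⟨k, h⟩ => ⟨e k, h⟩⟩
    rintro ⟨i, h⟩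
    obtain ⟨k, rfl⟩ := e.surjective i
    exact ⟨k, h⟩

theorem sumClass_of_twoSum {𝒢₁ 𝒢₂ : GraphClass.{u}} {V V₁ ι : Type u} [Finite ι] {W : ι → Type u}
    {G : SimpleGraph V} {G₁ : SimpleGraph V₁} {H : ∀ i, SimpleGraph (W i)} (h₁ : 𝒢₁ V₁ G₁)
    (h₂ : ∀ i, 𝒢₂ (W i) (H i)) (S : TwoSum G G₁ H) : sumClass 𝒢₁ 𝒢₂ V G := by
  obtain ⟨t, ⟨e⟩⟩ := Finite.exists_equiv_fin ι
  exact ⟨V₁, G₁, t, _, _, h₁, fun i => h₂ (e.symm i), ⟨S.reindex e.symm⟩⟩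

/-- Every graph is the 2-sum of an isomorphic graph with no graphs. -/
theorem sumClass_of_iso {𝒢₁ 𝒢₂ : GraphClass.{u}} {V V₁ : Type u} {G : SimpleGraph V}
    {G₁ : SimpleGraph V₁} (h₁ : 𝒢₁ V₁ G₁) (e : G₁ ≃g G) : sumClass 𝒢₁ 𝒢₂ V G := by
  refine ⟨V₁, G₁, 0, fun _ => PUnit, fun _ => ⊥, h₁, fun i => i.elim0, ⟨?_⟩⟩
  exact
  { z := fun i => i.elim0
    x := fun i => i.elim0
    y := fun i => i.elim0
    w := fun i => i.elim0
    x' := fun i => i.elim0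
    y' := fun i => i.elim0
    z_injective := fun i => i.elim0
    z_not_adj := fun i => i.elim0
    x_ne_y := fun i => i.elim0
    neighborSet_z := fun i => i.elim0
    x'_ne_y' := fun i => i.elim0
    neighborSet_w := fun i => i.elim0
    f := e
    g := fun i => i.elim0
    f_injOn := e.injective.injOn
    g_injOn := fun i => i.elim0
    glue_x := fun i => i.elim0
    glue_y := fun i => i.elim0
    f_inter_g := fun i => i.elim0
    g_inter_g := fun i => i.elim0
    cover := fun v => Or.inl ⟨e.symm v, fun ⟨i, _⟩ => i.elim0, e.apply_symm_apply v⟩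
    adj_iff := fun u v => by
      constructor
      · intro h
        refine Or.inl ⟨e.symm u, fun ⟨i, _⟩ => i.elim0, e.symm v, fun ⟨i, _⟩ => i.elim0, ?_,
          e.apply_symm_apply u, e.apply_symm_apply v⟩
        exact e.symm.map_adj_iff.2 h
      · rintro (⟨a, -, b, -, h, rfl, rfl⟩ | ⟨i, -⟩)
        · exact e.map_adj_iff.2 h
        · exact i.elim0 }

theorem powClass_succ {𝒢 : GraphClass.{u}} {k : ℕ} {V : Type u} {G : SimpleGraph V}
    (h : powClass 𝒢 k V G) : powClass 𝒢 (k + 1) V G := by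
  cases k with
  | zero => exact h.elim
  | succ k => exact sumClass_of_iso h SimpleGraph.Iso.refl

theorem powClass_mono {𝒢 : GraphClass.{u}} {k l : ℕ} (hkl : k ≤ l) {V : Type u}
    {G : SimpleGraph V} (h : powClass 𝒢 k V G) : powClass 𝒢 l V G := by
  induction hkl with
  | refl => exact h
  | step _ ih => exact powClass_succ ih

/-- Replacing every marked vertex of a frame by a further frame is a 2-sum. -/
theorem exists_sum_frame {𝒢₁ 𝒢₂ : GraphClass.{u}} {V ι : Type u} [Finite ι] {κ : ι → Type u}
    (F : Frame V ι) (N : ∀ i, Frame V (Option (κ i))) (hF : 𝒢₁ F.W F.N)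
    (hN : ∀ i, 𝒢₂ (N i).W (N i).N)
    (hs : ∀ i, (N i).φ ((N i).s none) = F.φ (F.s i))
    (ht : ∀ i, (N i).φ ((N i).t none) = F.φ (F.t i))
    (hNF : ∀ i, (N i).verts ∩ F.verts ⊆ F.ends i)
    (hNN : ∀ i j, i ≠ j → (N i).verts ∩ (N j).verts ⊆ F.ends i) :
    ∃ F' : Frame V (Σ i, κ i), sumClass 𝒢₁ 𝒢₂ F'.W F'.N ∧
      F'.verts = F.verts ∪ ⋃ i, (N i).verts ∧
      (∀ a b, F'.edges a b ↔ F.edges a b ∨ ∃ i, (N i).edges a b) ∧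
      ∀ i j, F'.φ (F'.s ⟨i, j⟩) = (N i).φ ((N i).s (some j)) ∧
        F'.φ (F'.t ⟨i, j⟩) = (N i).φ ((N i).t (some j)) := by
  classical
  set X : Set V := F.verts ∪ ⋃ i, (N i).verts with hX
  have hFX : F.verts ⊆ X := Set.subset_union_left
  have hNX : ∀ i, (N i).verts ⊆ X := fun i =>
    (Set.subset_iUnion (fun i => (N i).verts) i).trans Set.subset_union_right
  let E : V → V → Prop := fun a b => F.edges a b ∨ ∃ i, (N i).edges a b
  have hEsymm : ∀ a b, E a b → E b a := fun a b h =>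
    h.imp Frame.edges_symm fun ⟨i, h⟩ => ⟨i, Frame.edges_symm h⟩
  have hEne : ∀ a b, E a b → a ≠ b := fun a b h =>
    h.elim Frame.edges_ne fun ⟨i, h⟩ => Frame.edges_ne h
  let s₀ : (Σ i, κ i) → V := fun p => (N p.1).φ ((N p.1).s (some p.2))
  let t₀ : (Σ i, κ i) → V := fun p => (N p.1).φ ((N p.1).t (some p.2))
  have hs₀ : ∀ p, s₀ p ∈ X := fun p => hNX p.1 (Frame.s_mem _)
  have ht₀ : ∀ p, t₀ p ∈ X := fun p => hNX p.1 (Frame.t_mem _)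
  -- The sum lives on the used vertices of `V` together with one abstract vertex for each marked
  -- vertex of the `N i` other than `none`; the latter is consumed by the gluing.
  let M : SimpleGraph (X ⊕ Σ i, κ i) :=
    { Adj := fun a b => match a, b with
        | .inl a, .inl b => E a b
        | .inl a, .inr p => a.1 = s₀ p ∨ a.1 = t₀ p
        | .inr p, .inl a => a.1 = s₀ p ∨ a.1 = t₀ p
        | .inr _, .inr _ => False
      symm := ⟨by
        rintro (a | p) (b | q) h
        · exact hEsymm _ _ h
        · exact h
        · exact h
        · exact h⟩
      loopless := ⟨by
        rintro (a | p) h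
        · exact hEne _ _ h rfl
        · exact h⟩ }
  have hst₀ : ∀ p, s₀ p ≠ t₀ p := fun p h => (N p.1).s_ne_t (some p.2)
    ((N p.1).φ_injOn (Frame.s_notMem _) (Frame.t_notMem _) h)
  have hrange : (Set.range (Sum.inr : (Σ i, κ i) → X ⊕ Σ i, κ i))ᶜ = Set.range Sum.inl := by
    simp
  let F' : Frame V (Σ i, κ i) :=
    { W := X ⊕ Σ i, κ i
      N := M
      φ := Sum.elim (fun a => a.1) s₀
      z := Sum.inr
      s := fun p => Sum.inl ⟨s₀ p, hs₀ p⟩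
      t := fun p => Sum.inl ⟨t₀ p, ht₀ p⟩
      z_injective := Sum.inr_injective
      z_not_adj := fun p q h => h
      s_ne_t := fun p h => hst₀ p (by simpa using h)
      neighborSet_z := fun p => by
        ext (a | q)
        · simp only [SimpleGraph.mem_neighborSet, Set.mem_insert_iff, Set.mem_singleton_iff,
            Sum.inl.injEq, Subtype.ext_iff]
          rfl
        · simp only [SimpleGraph.mem_neighborSet, Set.mem_insert_iff, Set.mem_singleton_iff,
            reduceCtorEq, or_self, iff_false]
          exact fun h => h
      φ_injOn := by
        rw [hrange]
        rintro _ ⟨a, rfl⟩ _ ⟨b, rfl⟩ h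
        exact congrArg _ (Subtype.ext h) }
  have hF'v : F'.verts = X := by
    show Sum.elim (fun a : X => a.1) s₀ '' (Set.range Sum.inr)ᶜ = X
    rw [hrange, ← Set.range_comp]
    exact Subtype.range_coe
  have hF'e : ∀ a b, F'.edges a b ↔ E a b := by
    intro a b
    constructor
    · rintro ⟨p, hp, q, hq, h, rfl, rfl⟩
      rcases p with p | p
      · rcases q with q | q
        · exact h
        · exact absurd ⟨q, rfl⟩ hq
      · exact absurd ⟨p, rfl⟩ hp
    · intro h
      have hab : a ∈ X ∧ b ∈ X := by
        rcases h with h | ⟨i, h⟩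
        · exact ⟨hFX (Frame.edges_mem h).1, hFX (Frame.edges_mem h).2⟩
        · exact ⟨hNX i (Frame.edges_mem h).1, hNX i (Frame.edges_mem h).2⟩
      exact ⟨Sum.inl ⟨a, hab.1⟩, (by rintro ⟨_, h⟩; exact Sum.inr_ne_inl h), Sum.inl ⟨b, hab.2⟩,
        (by rintro ⟨_, h⟩; exact Sum.inr_ne_inl h), h, rfl, rfl⟩
  refine ⟨F', ?_, hF'v, hF'e, fun i j => ⟨rfl, rfl⟩⟩
  -- The value at a marked vertex is arbitrary, since marked vertices are deleted in the 2-sum. The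
  -- same holds for `g` at `(N i).z none`.
  have hf : ∀ a, ∃ w : X ⊕ Σ i, κ i, a ∉ Set.range F.z → ∃ h, w = Sum.inl ⟨F.φ a, h⟩ := by
    intro a
    by_cases ha : a ∈ Set.range F.z
    · obtain ⟨i, rfl⟩ := ha
      exact ⟨Sum.inl ⟨F.φ (F.s i), hFX (Frame.s_mem i)⟩, fun h => absurd ⟨i, rfl⟩ h⟩
    · exact ⟨Sum.inl ⟨F.φ a, hFX (Frame.mem_verts ha)⟩, fun _ => ⟨_, rfl⟩⟩
  choose f hf using hf
  have hg : ∀ i b, ∃ w : X ⊕ Σ i, κ i, (b ∉ Set.range (N i).z → ∃ h, w = Sum.inl ⟨(N i).φ b, h⟩) ∧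
      ∀ j, b = (N i).z (some j) → w = Sum.inr ⟨i, j⟩ := by
    intro i b
    by_cases hb : b ∈ Set.range (N i).z
    · obtain ⟨j | j, rfl⟩ := hb
      · exact ⟨Sum.inl ⟨F.φ (F.s i), hFX (Frame.s_mem i)⟩, fun h => absurd ⟨none, rfl⟩ h,
          fun j h => by cases (N i).z_injective h⟩
      · refine ⟨Sum.inr ⟨i, j⟩, fun h => absurd ⟨some j, rfl⟩ h, fun j' h => ?_⟩
        cases (N i).z_injective h
        rfl
    · exact ⟨Sum.inl ⟨(N i).φ b, hNX i (Frame.mem_verts hb)⟩, fun _ => ⟨_, rfl⟩,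
        fun j h => absurd ⟨_, h.symm⟩ hb⟩
  choose g hg using hg
  have hgr : ∀ i b, b ∉ Set.range (N i).z → ∃ h, g i b = Sum.inl ⟨(N i).φ b, h⟩ :=
    fun i b => (hg i b).1
  have hgz : ∀ i j, g i ((N i).z (some j)) = Sum.inr ⟨i, j⟩ := fun i j => (hg i _).2 j rfl
  have hcase : ∀ i b, b ≠ (N i).z none → b ∉ Set.range (N i).z ∨ ∃ j, b = (N i).z (some j) := by
    intro i b hb
    by_cases h : b ∈ Set.range (N i).z
    · obtain ⟨j | j, rfl⟩ := h
      · exact absurd rfl hb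
      · exact Or.inr ⟨j, rfl⟩
    · exact Or.inl h
  have hne : ∀ i b, b ∉ Set.range (N i).z → b ≠ (N i).z none := fun i b hb h =>
    hb ⟨none, h.symm⟩
  have inl_eq : ∀ {a b : V} {ha : a ∈ X} {hb : b ∈ X},
      (Sum.inl ⟨a, ha⟩ : X ⊕ Σ i, κ i) = Sum.inl ⟨b, hb⟩ → a = b := fun h => by simpa using h
  have eq_inl : ∀ {a b : V} {ha : a ∈ X} {hb : b ∈ X}, a = b →
      (Sum.inl ⟨a, ha⟩ : X ⊕ Σ i, κ i) = Sum.inl ⟨b, hb⟩ := fun h => by simpa using h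
  refine sumClass_of_twoSum (H := fun i => (N i).N) hF hN ?_
  exact
  { z := F.z
    x := F.s
    y := F.t
    w := fun i => (N i).z none
    x' := fun i => (N i).s none
    y' := fun i => (N i).t none
    z_injective := F.z_injective
    z_not_adj := F.z_not_adj
    x_ne_y := F.s_ne_t
    neighborSet_z := F.neighborSet_z
    x'_ne_y' := fun i => (N i).s_ne_t none
    neighborSet_w := fun i => (N i).neighborSet_z none
    f := f
    g := g
    f_injOn := by
      intro a ha b hb hab
      obtain ⟨h1, e1⟩ := hf a ha
      obtain ⟨h2, e2⟩ := hf b hb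
      rw [e1, e2] at hab
      exact F.φ_injOn ha hb (inl_eq hab)
    g_injOn := by
      intro i a ha b hb hab
      rcases hcase i a ha with ha | ⟨j, rfl⟩ <;> rcases hcase i b hb with hb | ⟨k, rfl⟩
      · obtain ⟨h1, e1⟩ := hgr i a ha
        obtain ⟨h2, e2⟩ := hgr i b hb
        rw [e1, e2] at hab
        exact (N i).φ_injOn ha hb (inl_eq hab)
      · obtain ⟨h1, e1⟩ := hgr i a ha
        rw [e1, hgz] at hab
        cases hab
      · obtain ⟨h2, e2⟩ := hgr i b hb
        rw [e2, hgz] at hab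
        cases hab
      · rw [hgz, hgz] at hab
        cases hab
        rfl
    glue_x := fun i => by
      obtain ⟨h1, e1⟩ := hf _ (Frame.s_notMem i)
      obtain ⟨h2, e2⟩ := hgr i _ (Frame.s_notMem none)
      rw [e1, e2]
      simp [hs i]
    glue_y := fun i => by
      obtain ⟨h1, e1⟩ := hf _ (Frame.t_notMem i)
      obtain ⟨h2, e2⟩ := hgr i _ (Frame.t_notMem none)
      rw [e1, e2]
      simp [ht i]
    f_inter_g := by
      intro i a ha b hb hab
      obtain ⟨h1, e1⟩ := hf a ha
      rcases hcase i b hb with hb | ⟨k, rfl⟩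
      · obtain ⟨h2, e2⟩ := hgr i b hb
        rw [e1, e2] at hab
        have hab' : F.φ a = (N i).φ b := inl_eq hab
        rcases hNF i ⟨hab' ▸ Frame.mem_verts hb, Frame.mem_verts ha⟩ with h | h
        · exact Or.inl ⟨F.φ_injOn ha (Frame.s_notMem i) h, (N i).φ_injOn hb (Frame.s_notMem none)
            (by rw [hs, ← hab', h])⟩
        · exact Or.inr ⟨F.φ_injOn ha (Frame.t_notMem i) h, (N i).φ_injOn hb (Frame.t_notMem none)
            (by rw [ht, ← hab', h])⟩
      · rw [e1, hgz] at hab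
        cases hab
    g_inter_g := by
      intro i j hij b hb c hc hbc
      rcases hcase i b hb with hb | ⟨k, rfl⟩ <;> rcases hcase j c hc with hc | ⟨l, rfl⟩
      · obtain ⟨h1, e1⟩ := hgr i b hb
        obtain ⟨h2, e2⟩ := hgr j c hc
        rw [e1, e2] at hbc
        have hbc' : (N i).φ b = (N j).φ c := inl_eq hbc
        rcases hNN i j hij ⟨Frame.mem_verts hb, hbc' ▸ Frame.mem_verts hc⟩ with h | h
        · exact Or.inl ((N i).φ_injOn hb (Frame.s_notMem none) (by rw [hs, h]))
        · exact Or.inr ((N i).φ_injOn hb (Frame.t_notMem none) (by rw [ht, h]))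
      · obtain ⟨h1, e1⟩ := hgr i b hb
        rw [e1, hgz] at hbc
        cases hbc
      · obtain ⟨h2, e2⟩ := hgr j c hc
        rw [e2, hgz] at hbc
        cases hbc
      · rw [hgz, hgz] at hbc
        cases hbc
        exact absurd rfl hij
    cover := by
      rintro (⟨v, hv⟩ | ⟨i, j⟩)
      · rcases hv with ⟨a, ha, rfl⟩ | hv
        · obtain ⟨h1, e1⟩ := hf a ha
          exact Or.inl ⟨a, ha, e1⟩
        · obtain ⟨i, b, hb, rfl⟩ := Set.mem_iUnion.1 hv
          obtain ⟨h1, e1⟩ := hgr i b hb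
          exact Or.inr ⟨i, b, hne i b hb, e1⟩
      · exact Or.inr ⟨i, (N i).z (some j), (fun h => by cases (N i).z_injective h), hgz i j⟩
    adj_iff := by
      have hzs : ∀ i j, (N i).z (some j) ≠ (N i).z none := fun i j h => by
        cases (N i).z_injective h
      have hvirt : ∀ (v : X) (p : Σ i, κ i), (v.1 = s₀ p ∨ v.1 = t₀ p) →
          ∃ b, b ≠ (N p.1).z none ∧ (N p.1).N.Adj ((N p.1).z (some p.2)) b ∧
            g p.1 b = Sum.inl v := by
        rintro ⟨v, hv⟩ ⟨i, j⟩ (h | h)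
        · obtain ⟨h1, e1⟩ := hgr i _ (Frame.s_notMem (some j))
          exact ⟨(N i).s (some j), hne i _ (Frame.s_notMem _), Frame.adj_z_iff.2 (Or.inl rfl),
            by rw [e1]; simp only [Sum.inl.injEq, Subtype.mk.injEq]; exact h.symm⟩
        · obtain ⟨h1, e1⟩ := hgr i _ (Frame.t_notMem (some j))
          exact ⟨(N i).t (some j), hne i _ (Frame.t_notMem _), Frame.adj_z_iff.2 (Or.inr rfl),
            by rw [e1]; simp only [Sum.inl.injEq, Subtype.mk.injEq]; exact h.symm⟩
      have hvirt' : ∀ i j b, b ≠ (N i).z none → (N i).N.Adj ((N i).z (some j)) b →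
          M.Adj (Sum.inr ⟨i, j⟩) (g i b) := by
        intro i j b hb h
        rcases Frame.adj_z_iff.1 h with rfl | rfl
        · obtain ⟨h1, e1⟩ := hgr i _ (Frame.s_notMem (some j))
          rw [e1]
          exact Or.inl rfl
        · obtain ⟨h1, e1⟩ := hgr i _ (Frame.t_notMem (some j))
          rw [e1]
          exact Or.inr rfl
      intro u v
      constructor
      · intro h
        rcases u with ⟨u, hu⟩ | p <;> rcases v with ⟨v, hv⟩ | q
        · rcases h with ⟨a, ha, b, hb, hab, h1, h2⟩ | ⟨i, a, ha, b, hb, hab, h1, h2⟩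
          · obtain ⟨_, e1⟩ := hf a ha
            obtain ⟨_, e2⟩ := hf b hb
            exact Or.inl ⟨a, ha, b, hb, hab, by rw [e1]; exact eq_inl h1, by rw [e2]; exact eq_inl h2⟩
          · obtain ⟨_, e1⟩ := hgr i a ha
            obtain ⟨_, e2⟩ := hgr i b hb
            exact Or.inr ⟨i, a, b, hne i a ha, hne i b hb, hab, by rw [e1]; exact eq_inl h1,
              by rw [e2]; exact eq_inl h2⟩
        · obtain ⟨b, hb, hzb, hgb⟩ := hvirt _ q h
          exact Or.inr ⟨q.1, b, _, hb, hzs _ _, hzb.symm, hgb, hgz _ _⟩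
        · obtain ⟨b, hb, hzb, hgb⟩ := hvirt _ p h
          exact Or.inr ⟨p.1, _, b, hzs _ _, hb, hzb, hgz _ _, hgb⟩
        · exact absurd h (fun h => h)
      · rintro (⟨a, ha, b, hb, hab, rfl, rfl⟩ | ⟨i, a, b, ha, hb, hab, rfl, rfl⟩)
        · obtain ⟨_, e1⟩ := hf a ha
          obtain ⟨_, e2⟩ := hf b hb
          rw [e1, e2]
          exact Or.inl ⟨a, ha, b, hb, hab, rfl, rfl⟩
        · rcases hcase i a ha with ha' | ⟨j, rfl⟩
          · rcases hcase i b hb with hb' | ⟨k, rfl⟩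
            · obtain ⟨_, e1⟩ := hgr i a ha'
              obtain ⟨_, e2⟩ := hgr i b hb'
              rw [e1, e2]
              exact Or.inr ⟨i, a, ha', b, hb', hab, rfl, rfl⟩
            · rw [hgz]
              exact (hvirt' i k a ha hab.symm).symm
          · rw [hgz]
            exact hvirt' i j b hb hab }

/-! ### Decompositions of bounded depth and powers of a class. -/

/-- The piece with vertex set `X` and edge relation `E` decomposes, relative to its ends `u` and
`v`, into graphs of the class `𝒢` with at most `k` levels. -/
def Fill (𝒢 : GraphClass.{u}) {V : Type u} : ℕ → Set V → (V → V → Prop) → V → V → Prop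
  | 0, _, _, _, _ => False
  | k + 1, X, E, u, v => ∃ (κ : Type u) (_ : Finite κ) (F : Frame V (Option κ)) (Y : κ → Set V)
      (R : κ → V → V → Prop), 𝒢 F.W F.N ∧ F.φ (F.s none) = u ∧ F.φ (F.t none) = v ∧
      (∀ i, Fill 𝒢 k (Y i) (R i) (F.φ (F.s (some i))) (F.φ (F.t (some i)))) ∧
      (∀ i, Y i ∩ F.verts ⊆ F.ends (some i)) ∧
      (∀ i j, i ≠ j → Y i ∩ Y j ⊆ F.ends (some i)) ∧
      X = F.verts ∪ ⋃ i, Y i ∧ ∀ a b, E a b ↔ F.edges a b ∨ ∃ i, R i a b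

theorem Fill.succ {𝒢 : GraphClass.{u}} {V : Type u} {k : ℕ} :
    ∀ {X : Set V} {E : V → V → Prop} {u v : V}, Fill 𝒢 k X E u v → Fill 𝒢 (k + 1) X E u v := by
  induction k with
  | zero => exact fun h => h.elim
  | succ k ih =>
    rintro X E u v ⟨κ, hκ, F, Y, R, h1, h2, h3, h4, h5⟩
    exact ⟨κ, hκ, F, Y, R, h1, h2, h3, fun i => ih (h4 i), h5⟩

/-- A frame in `𝒢 ^ m` whose marked vertices are filled with `k` levels yields a graph in
`𝒢 ^ (m + k)`. -/
theorem powClass_of_fill {𝒢 : GraphClass.{u}} {V : Type u} {G : SimpleGraph V} (k : ℕ) :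
    ∀ (m : ℕ) (ι : Type u) [Finite ι] (F : Frame V ι) (Y : ι → Set V) (R : ι → V → V → Prop),
      2 ≤ m + k → 1 ≤ m → powClass 𝒢 m F.W F.N →
      (∀ i, Fill 𝒢 k (Y i) (R i) (F.φ (F.s i)) (F.φ (F.t i))) →
      (∀ i, Y i ∩ F.verts ⊆ F.ends i) → (∀ i j, i ≠ j → Y i ∩ Y j ⊆ F.ends i) →
      (F.verts ∪ ⋃ i, Y i = Set.univ) → (∀ a b, G.Adj a b ↔ F.edges a b ∨ ∃ i, R i a b) →
      powClass 𝒢 (m + k) V G := by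
  induction k with
  | zero =>
    intro m ι _ F Y R hm _ hF hfill _ _ hX hE
    -- `Fill` with no levels is impossible, so no marked vertex is left and the frame is isomorphic
    -- to `G`.
    have : IsEmpty ι := ⟨hfill⟩
    -- An exponent of at least two makes the power a class of 2-sums. These can be transported along
    -- an isomorphism, whereas `𝒢` is an arbitrary predicate; hence the hypothesis `2 ≤ m + k`.
    obtain ⟨m, rfl⟩ : ∃ m', m = m' + 2 := ⟨m - 2, by omega⟩
    have hr : Set.range F.z = ∅ := Set.range_eq_empty _
    have hinj : Function.Injective F.φ := by
      have := F.φ_injOn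
      rwa [hr, Set.compl_empty, Set.injOn_univ] at this
    have hsurj : Function.Surjective F.φ := by
      intro x
      have hx : x ∈ F.verts ∪ ⋃ i, Y i := hX ▸ Set.mem_univ x
      rw [Set.iUnion_of_empty, Set.union_empty] at hx
      obtain ⟨p, -, rfl⟩ := hx
      exact ⟨p, rfl⟩
    let e : F.N ≃g G :=
      { toEquiv := Equiv.ofBijective F.φ ⟨hinj, hsurj⟩
        map_rel_iff' := by
          intro a b
          show G.Adj (F.φ a) (F.φ b) ↔ F.N.Adj a b
          rw [hE]
          constructor
          · rintro (⟨p, -, q, -, h, h1, h2⟩ | ⟨i, -⟩)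
            · rwa [hinj h1, hinj h2] at h
            · exact isEmptyElim i
          · intro h
            exact Or.inl ⟨a, by simp [hr], b, by simp [hr], h, rfl, rfl⟩ }
    obtain ⟨V₁, G₁, t, W, H, h1, h2, ⟨S⟩⟩ := hF
    refine ⟨V₁, G₁, t, W, H, h1, h2, ⟨?_⟩⟩
    exact
    { S with
      f := fun a => e (S.f a)
      g := fun i a => e (S.g i a)
      f_injOn := fun a ha b hb h => S.f_injOn ha hb (e.injective h)
      g_injOn := fun i a ha b hb h => S.g_injOn i ha hb (e.injective h)
      glue_x := fun i => congrArg e (S.glue_x i)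
      glue_y := fun i => congrArg e (S.glue_y i)
      f_inter_g := fun i a ha b hb h => S.f_inter_g i a ha b hb (e.injective h)
      g_inter_g := fun i j hij b hb c hc h => S.g_inter_g i j hij b hb c hc (e.injective h)
      cover := fun v => by
        obtain ⟨w, rfl⟩ := e.surjective v
        refine (S.cover w).imp ?_ ?_
        · rintro ⟨a, ha, rfl⟩; exact ⟨a, ha, rfl⟩
        · rintro ⟨i, b, hb, rfl⟩; exact ⟨i, b, hb, rfl⟩
      adj_iff := fun u v => by
        obtain ⟨u, rfl⟩ := e.surjective u
        obtain ⟨v, rfl⟩ := e.surjective v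
        rw [e.map_adj_iff, S.adj_iff]
        simp only [e.injective.eq_iff] }
  | succ k ih =>
    intro m ι _ F Y R hm hm1 hF hfill hYF hYY hX hE
    choose κ hκ N Y' R' h𝒢 hs ht hfill' hYN hYY' hX' hE' using hfill
    have hNY : ∀ i, (N i).verts ⊆ Y i := fun i => by rw [hX' i]; exact Set.subset_union_left
    have hY'Y : ∀ i j, Y' i j ⊆ Y i := fun i j => by
      rw [hX' i]; exact (Set.subset_iUnion (Y' i) j).trans Set.subset_union_right
    have hends : ∀ i, F.ends i ⊆ (N i).verts := fun i => by
      rw [Frame.ends, ← hs i, ← ht i]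
      exact Frame.ends_subset none
    -- Powers grow outwards from the root. The top nodes of all pieces are attached at once, costing
    -- one exponent, and the pieces below them hang on the new marked vertices.
    obtain ⟨F', hF'c, hF'v, hF'e, hF's⟩ := exists_sum_frame F N hF h𝒢 hs ht
      (fun i x hx => hYF i ⟨hNY i hx.1, hx.2⟩)
      (fun i j hij x hx => hYY i j hij ⟨hNY i hx.1, hNY j hx.2⟩)
    have hF'ends : ∀ i j, F'.ends ⟨i, j⟩ = (N i).ends (some j) := fun i j => by
      rw [Frame.ends, Frame.ends, (hF's i j).1, (hF's i j).2]
    have hpow : powClass 𝒢 (m + 1) F'.W F'.N := by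
      obtain ⟨m, rfl⟩ : ∃ m', m = m' + 1 := ⟨m - 1, by omega⟩
      exact hF'c
    have := ih (m + 1) (Σ i, κ i) F' (fun p => Y' p.1 p.2) (fun p => R' p.1 p.2) (by omega)
      (by omega) hpow ?_ ?_ ?_ ?_ ?_
    · rwa [show m + 1 + k = m + (k + 1) by omega] at this
    · rintro ⟨i, j⟩
      rw [(hF's i j).1, (hF's i j).2]
      exact hfill' i j
    · rintro ⟨i, j⟩ x ⟨hx, hxF⟩
      rw [hF'ends]
      rw [hF'v] at hxF
      refine hYN i j ⟨hx, ?_⟩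
      rcases hxF with hxF | hxF
      · exact hends i (hYF i ⟨hY'Y i j hx, hxF⟩)
      · obtain ⟨i', hx'⟩ := Set.mem_iUnion.1 hxF
        by_cases hii : i = i'
        · subst hii
          exact hx'
        · exact hends i (hYY i i' hii ⟨hY'Y i j hx, hNY i' hx'⟩)
    · rintro ⟨i, j⟩ ⟨i', j'⟩ hne x ⟨hx, hx'⟩
      rw [hF'ends]
      by_cases hii : i = i'
      · subst hii
        exact hYY' i j j' (fun h => hne (by rw [h])) ⟨hx, hx'⟩
      · exact hYN i j ⟨hx, hends i (hYY i i' hii ⟨hY'Y i j hx, hY'Y i' j' hx'⟩)⟩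
    · rw [← hX, hF'v]
      ext x
      simp only [Set.mem_union, Set.mem_iUnion, hX', Sigma.exists, exists_or, or_assoc]
    · intro a b
      rw [hE, hF'e]
      simp only [hE', Sigma.exists, exists_or, or_assoc]

/-! ### Chords on a path and type-I graphs. -/

/-- Chords `(i, j)` of the path `0, 1, …, m` such that each chord crosses at most one other chord,
and the ends of crossing chords are consecutive. -/
structure LinearChords (m : ℕ) (R : ℕ → ℕ → Prop) : Prop where
  range : ∀ {i j}, R i j → i + 2 ≤ j ∧ j ≤ m
  cross : ∀ {i j k l}, R i j → R k l → i < k → k < j → j < l → k = i + 1 ∧ l = j + 1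
  not_triple : ∀ {i j}, R i j → R (i + 1) (j + 1) → ¬ R (i + 2) (j + 2)

/-- By `cross`, a chord crossing `(i, j)` is its shift by one, up or down. Both shifts together
would be three consecutive ones, which `not_triple` forbids. -/
theorem LinearChords.partner {m : ℕ} {R : ℕ → ℕ → Prop} (h : LinearChords m R) {i j k l k' l' : ℕ}
    (h1 : R i j) (h2 : R k l) (h3 : R k' l')
    (h4 : (i < k ∧ k < j ∧ j < l) ∨ (k < i ∧ i < l ∧ l < j))
    (h5 : (i < k' ∧ k' < j ∧ j < l') ∨ (k' < i ∧ i < l' ∧ l' < j)) : k = k' ∧ l = l' := by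
  rcases h4 with ⟨a1, a2, a3⟩ | ⟨a1, a2, a3⟩ <;> rcases h5 with ⟨b1, b2, b3⟩ | ⟨b1, b2, b3⟩
  · have := h.cross h1 h2 a1 a2 a3
    have := h.cross h1 h3 b1 b2 b3
    omega
  · obtain ⟨rfl, rfl⟩ := h.cross h1 h2 a1 a2 a3
    obtain ⟨rfl, rfl⟩ := h.cross h3 h1 b1 b2 b3
    exact absurd h2 (h.not_triple h3 h1)
  · obtain ⟨rfl, rfl⟩ := h.cross h2 h1 a1 a2 a3
    obtain ⟨rfl, rfl⟩ := h.cross h1 h3 b1 b2 b3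
    exact absurd h3 (h.not_triple h2 h1)
  · have := h.cross h2 h1 a1 a2 a3
    have := h.cross h3 h1 b1 b2 b3
    omega

/-- The cycle `0, 1, …, m + 1` with the chords `R`. -/
def chordGraph (m : ℕ) (R : ℕ → ℕ → Prop) : SimpleGraph (ULift.{u} (Fin (m + 2))) :=
  SimpleGraph.fromRel fun a b => b.down.val = a.down.val + 1 ∨
    (a.down.val = 0 ∧ b.down.val = m + 1) ∨ R a.down.val b.down.val

theorem cycleGraph_adj_iff {m : ℕ} (hm : 1 ≤ m) {a b : Fin (m + 2)} :
    (SimpleGraph.cycleGraph (m + 2)).Adj a b ↔ b.val = a.val + 1 ∨ a.val = b.val + 1 ∨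
      (a.val = 0 ∧ b.val = m + 1) ∨ (b.val = 0 ∧ a.val = m + 1) := by
  rw [SimpleGraph.cycleGraph_adj']
  have ha := a.isLt
  have hb := b.isLt
  rcases lt_trichotomy a b with h | h | h
  · rw [Fin.coe_sub_iff_lt.2 h, Fin.coe_sub_iff_le.2 h.le]
    rw [Fin.lt_def] at h
    omega
  · subst h
    have h0 : (a - a).val = 0 := by simp
    rw [h0]
    omega
  · rw [Fin.coe_sub_iff_lt.2 h, Fin.coe_sub_iff_le.2 h.le]
    rw [Fin.lt_def] at h
    omega

theorem sbtw_fin_iff {m : ℕ} {a b c : Fin m} : sbtw a b c ↔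
    (a.val < b.val ∧ b.val < c.val) ∨ (b.val < c.val ∧ c.val < a.val) ∨
      (c.val < a.val ∧ a.val < b.val) := Iff.rfl

/-- Crossing in the cyclic order becomes interleaving in the linear order once the ends of each
chord are sorted. -/
theorem Cross.interleave {m : ℕ} {a b c d : Fin m} (h : Cross a b c d) {i j k l : ℕ}
    (h1 : (i = a.val ∧ j = b.val) ∨ (i = b.val ∧ j = a.val))
    (h2 : (k = c.val ∧ l = d.val) ∨ (k = d.val ∧ l = c.val)) (hij : i < j) (hkl : k < l) :
    (i < k ∧ k < j ∧ j < l) ∨ (k < i ∧ i < l ∧ l < j) := by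
  simp only [Cross, sbtw_fin_iff] at h
  omega

theorem classP_chordGraph {m : ℕ} {R : ℕ → ℕ → Prop} (hm : 1 ≤ m) (hR : LinearChords m R) :
    ClassP.{u} _ (chordGraph m R) := by
  have hchord : ∀ a b : Fin (m + 2), (chordGraph.{u} m R).Adj ⟨a⟩ ⟨b⟩ ∧
      ¬ (SimpleGraph.cycleGraph (m + 2)).Adj a b → ∃ i j, R i j ∧
        ((i = a.val ∧ j = b.val) ∨ (i = b.val ∧ j = a.val)) := by
    rintro a b ⟨h, hn⟩
    rw [cycleGraph_adj_iff hm] at hn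
    obtain ⟨-, h⟩ := (SimpleGraph.fromRel_adj _ _ _).1 h
    rcases h with (h | h | h) | (h | h | h)
    · exact absurd (Or.inl h) hn
    · exact absurd (Or.inr (Or.inr (Or.inl h))) hn
    · exact ⟨_, _, h, Or.inl ⟨rfl, rfl⟩⟩
    · exact absurd (Or.inr (Or.inl h)) hn
    · exact absurd (Or.inr (Or.inr (Or.inr h))) hn
    · exact ⟨_, _, h, Or.inr ⟨rfl, rfl⟩⟩
  refine ⟨m + 2, Equiv.ulift.symm, ?_⟩
  intro C Chord
  refine ⟨by omega, ?_, ?_, ?_⟩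
  · intro a b h
    refine (SimpleGraph.fromRel_adj _ _ _).2 ⟨fun h' => h.ne (Equiv.ulift.symm.injective h'), ?_⟩
    rcases (cycleGraph_adj_iff hm).1 h with h | h | h | h
    · exact Or.inl (Or.inl h)
    · exact Or.inr (Or.inl h)
    · exact Or.inl (Or.inr (Or.inl h))
    · exact Or.inr (Or.inr (Or.inl h))
  · intro a b c d c' d' h1 h2 h3 h4 h5
    obtain ⟨i, j, hR1, e1⟩ := hchord a b h1
    obtain ⟨k, l, hR2, e2⟩ := hchord c d h2
    obtain ⟨k', l', hR3, e3⟩ := hchord c' d' h3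
    have r1 := (hR.range hR1).1
    have r2 := (hR.range hR2).1
    have r3 := (hR.range hR3).1
    obtain ⟨rfl, rfl⟩ := hR.partner hR1 hR2 hR3 (h4.interleave e1 e2 (by omega) (by omega))
      (h5.interleave e1 e3 (by omega) (by omega))
    rw [Sym2.eq_iff, Fin.ext_iff, Fin.ext_iff, Fin.ext_iff, Fin.ext_iff]
    omega
  · intro a b c d h1 h2 h3
    obtain ⟨i, j, hR1, e1⟩ := hchord a b h1
    obtain ⟨k, l, hR2, e2⟩ := hchord c d h2
    have r1 := (hR.range hR1).1
    have r2 := (hR.range hR2).1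
    rw [cycleGraph_adj_iff hm, cycleGraph_adj_iff hm, cycleGraph_adj_iff hm, cycleGraph_adj_iff hm]
    rcases h3.interleave e1 e2 (by omega) (by omega) with ⟨a1, a2, a3⟩ | ⟨a1, a2, a3⟩
    · have := hR.cross hR1 hR2 a1 a2 a3
      omega
    · have := hR.cross hR2 hR1 a1 a2 a3
      omega

/-! ### Strips and operations on them. -/

/-- A decomposition of a piece along a path of vertices and smaller pieces (the positions in
`virt`), together with chords as in a type-I graph. -/
structure Strip (𝒢 : GraphClass.{u}) {V : Type u} (L : ℕ) (X : Set V) (E : V → V → Prop)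
    (u v : V) where
  m : ℕ
  R : ℕ → ℕ → Prop
  virt : ℕ → Prop
  φ : ℕ → V
  Y : ℕ → Set V
  T : ℕ → V → V → Prop
  one_le : 1 ≤ m
  chords : LinearChords m R
  not_virt_zero : ¬ virt 0
  not_virt_last : ¬ virt m
  not_virt_succ : ∀ {i}, virt i → ¬ virt (i + 1)
  not_virt_of_R : ∀ {i j}, R i j → ¬ virt i ∧ ¬ virt j
  φ_zero : φ 0 = u
  φ_last : φ m = v
  φ_inj : ∀ {i j}, i ≤ m → j ≤ m → ¬ virt i → ¬ virt j → φ i = φ j → i = j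
  fill : ∀ {i}, i < m → virt i → Fill 𝒢 L (Y i) (T i) (φ (i - 1)) (φ (i + 1))
  attach : ∀ {i j}, i < m → virt i → j ≤ m → ¬ virt j → φ j ∈ Y i → j = i - 1 ∨ j = i + 1
  attach_virt : ∀ {i j x}, i < m → virt i → j < m → virt j → i ≠ j → x ∈ Y i → x ∈ Y j →
    x = φ (i - 1) ∨ x = φ (i + 1)
  mem_iff : ∀ x, x ∈ X ↔ (∃ i ≤ m, ¬ virt i ∧ φ i = x) ∨ ∃ i < m, virt i ∧ x ∈ Y i
  E_iff : ∀ a b, E a b ↔ (∃ i j, i ≤ m ∧ j ≤ m ∧ ¬ virt i ∧ ¬ virt j ∧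
    (j = i + 1 ∨ i = j + 1 ∨ R i j ∨ R j i) ∧ φ i = a ∧ φ j = b) ∨ ∃ i < m, virt i ∧ T i a b

namespace Strip

variable {𝒢 : GraphClass.{u}} {V : Type u} {L : ℕ} {X X₁ X₂ : Set V} {E E₁ E₂ : V → V → Prop}
  {u v c : V}

/-- Position `m + 1` closes the path to a cycle. It has degree two with neighbours `0` and `m`, so
it is the marked vertex `none` for the parent. A virtual position lies on no chord, hence also has
degree two, and two of them are never adjacent. -/
theorem fill_succ (S : Strip 𝒢 L X E u v) (h𝒢 : ∀ W G, ClassP.{u} W G → 𝒢 W G) :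
    Fill 𝒢 (L + 1) X E u v := by
  have hm := S.one_le
  let κ : Type u := ULift.{u} {i : ℕ // i < S.m ∧ S.virt i}
  have hfin : Finite {i : ℕ // i < S.m ∧ S.virt i} :=
    ((Set.finite_lt_nat S.m).subset (fun i hi => hi.1) : Set.Finite {i | i < S.m ∧ S.virt i})
  have hpos : ∀ {i}, S.virt i → 1 ≤ i := fun {i} hi => by
    rcases Nat.eq_zero_or_pos i with rfl | h
    · exact absurd hi S.not_virt_zero
    · exact h
  let z : Option κ → ULift.{u} (Fin (S.m + 2)) := fun o => match o with
    | none => ⟨⟨S.m + 1, by omega⟩⟩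
    | some i => ⟨⟨i.down.1, by have := i.down.2.1; omega⟩⟩
  let s : Option κ → ULift.{u} (Fin (S.m + 2)) := fun o => match o with
    | none => ⟨⟨0, by omega⟩⟩
    | some i => ⟨⟨i.down.1 - 1, by have := i.down.2.1; omega⟩⟩
  let t : Option κ → ULift.{u} (Fin (S.m + 2)) := fun o => match o with
    | none => ⟨⟨S.m, by omega⟩⟩
    | some i => ⟨⟨i.down.1 + 1, by have := i.down.2.1; omega⟩⟩
  have hval : ∀ {a b : ULift.{u} (Fin (S.m + 2))}, a = b ↔ a.down.val = b.down.val := by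
    intro a b
    rw [ULift.ext_iff, Fin.ext_iff]
  have hadj : ∀ a b : ULift.{u} (Fin (S.m + 2)), (chordGraph S.m S.R).Adj a b ↔
      a.down.val ≠ b.down.val ∧ ((b.down.val = a.down.val + 1 ∨
      (a.down.val = 0 ∧ b.down.val = S.m + 1) ∨ S.R a.down.val b.down.val) ∨
      (a.down.val = b.down.val + 1 ∨
      (b.down.val = 0 ∧ a.down.val = S.m + 1) ∨ S.R b.down.val a.down.val)) := by
    intro a b
    rw [chordGraph, SimpleGraph.fromRel_adj, Ne, hval]
  have hrange : ∀ a : ULift.{u} (Fin (S.m + 2)), a ∉ Set.range z ↔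
      a.down.val ≤ S.m ∧ ¬ S.virt a.down.val := by
    intro a
    have ha := a.down.isLt
    constructor
    · intro h
      have h1 : a.down.val ≠ S.m + 1 := fun h' => h ⟨none, hval.2 h'.symm⟩
      refine ⟨by omega, fun hv => ?_⟩
      have h2 : a.down.val ≠ S.m := fun h => S.not_virt_last (h ▸ hv)
      exact h ⟨some ⟨a.down.val, by omega, hv⟩, hval.2 rfl⟩
    · rintro ⟨h1, h2⟩ ⟨o, rfl⟩
      rcases o with _ | ⟨i, hi, hv⟩
      · change S.m + 1 ≤ S.m at h1
        omega
      · exact h2 hv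
  let F : Frame V (Option κ) :=
    { W := ULift.{u} (Fin (S.m + 2))
      N := chordGraph S.m S.R
      φ := fun a => S.φ a.down.val
      z := z
      s := s
      t := t
      z_injective := by
        rintro (_ | ⟨i, hi, hv⟩) (_ | ⟨j, hj, hw⟩) h
        · rfl
        · have : S.m + 1 = j := hval.1 h
          omega
        · have : i = S.m + 1 := hval.1 h
          omega
        · have : i = j := hval.1 h
          subst this
          rfl
      z_not_adj := by
        rintro (_ | ⟨i, hi, hv⟩) (_ | ⟨j, hj, hw⟩) h
        · exact h.ne rfl
        · obtain ⟨-, h⟩ := (hadj _ _).1 h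
          change (j = S.m + 1 + 1 ∨ (S.m + 1 = 0 ∧ j = S.m + 1) ∨ S.R (S.m + 1) j) ∨
            (S.m + 1 = j + 1 ∨ (j = 0 ∧ S.m + 1 = S.m + 1) ∨ S.R j (S.m + 1)) at h
          have := hpos hw
          have r1 := fun h => S.chords.range (i := S.m + 1) (j := j) h
          have r2 := fun h => S.chords.range (i := j) (j := S.m + 1) h
          rcases h with (h | h | h) | (h | h | h) <;> first | omega | skip
          · have := r1 h; omega
          · have := r2 h; omega
        · obtain ⟨-, h⟩ := (hadj _ _).1 h.symm
          change (i = S.m + 1 + 1 ∨ (S.m + 1 = 0 ∧ i = S.m + 1) ∨ S.R (S.m + 1) i) ∨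
            (S.m + 1 = i + 1 ∨ (i = 0 ∧ S.m + 1 = S.m + 1) ∨ S.R i (S.m + 1)) at h
          have := hpos hv
          have r1 := fun h => S.chords.range (i := S.m + 1) (j := i) h
          have r2 := fun h => S.chords.range (i := i) (j := S.m + 1) h
          rcases h with (h | h | h) | (h | h | h) <;> first | omega | skip
          · have := r1 h; omega
          · have := r2 h; omega
        · obtain ⟨-, h⟩ := (hadj _ _).1 h
          change (j = i + 1 ∨ (i = 0 ∧ j = S.m + 1) ∨ S.R i j) ∨
            (i = j + 1 ∨ (j = 0 ∧ i = S.m + 1) ∨ S.R j i) at h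
          rcases h with (rfl | h | h) | (rfl | h | h)
          · exact S.not_virt_succ hv hw
          · omega
          · exact (S.not_virt_of_R h).1 hv
          · exact S.not_virt_succ hw hv
          · omega
          · exact (S.not_virt_of_R h).1 hw
      s_ne_t := by
        rintro (_ | ⟨i, hi, hv⟩) h
        · have : 0 = S.m := hval.1 h
          omega
        · have : i - 1 = i + 1 := hval.1 h
          omega
      neighborSet_z := by
        rintro (_ | ⟨i, hi, hv⟩)
        · ext b
          have hb := b.down.isLt
          rw [SimpleGraph.mem_neighborSet, hadj, Set.mem_insert_iff, Set.mem_singleton_iff, hval,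
            hval]
          change (S.m + 1 ≠ b.down.val ∧ ((b.down.val = S.m + 1 + 1 ∨
            (S.m + 1 = 0 ∧ b.down.val = S.m + 1) ∨ S.R (S.m + 1) b.down.val) ∨
            (S.m + 1 = b.down.val + 1 ∨ (b.down.val = 0 ∧ S.m + 1 = S.m + 1) ∨
            S.R b.down.val (S.m + 1)))) ↔ b.down.val = 0 ∨ b.down.val = S.m
          have r1 := fun h => S.chords.range (i := S.m + 1) (j := b.down.val) h
          have r2 := fun h => S.chords.range (i := b.down.val) (j := S.m + 1) h
          constructor
          · rintro ⟨h0, (h | h | h) | (h | h | h)⟩ <;> first | omega | skip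
            · have := r1 h; omega
            · have := r2 h; omega
          · intro h
            refine ⟨by omega, Or.inr ?_⟩
            rcases h with h | h
            · exact Or.inr (Or.inl ⟨h, rfl⟩)
            · exact Or.inl (by omega)
        · ext b
          have hb := b.down.isLt
          have := hpos hv
          rw [SimpleGraph.mem_neighborSet, hadj, Set.mem_insert_iff, Set.mem_singleton_iff, hval,
            hval]
          change (i ≠ b.down.val ∧ ((b.down.val = i + 1 ∨
            (i = 0 ∧ b.down.val = S.m + 1) ∨ S.R i b.down.val) ∨
            (i = b.down.val + 1 ∨ (b.down.val = 0 ∧ i = S.m + 1) ∨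
            S.R b.down.val i))) ↔ b.down.val = i - 1 ∨ b.down.val = i + 1
          constructor
          · rintro ⟨h0, (h | h | h) | (h | h | h)⟩ <;> first | omega | skip
            · exact absurd hv (S.not_virt_of_R h).1
            · exact absurd hv (S.not_virt_of_R h).2
          · intro h
            refine ⟨by omega, ?_⟩
            rcases h with h | h
            · exact Or.inr (Or.inl (by omega))
            · exact Or.inl (Or.inl h)
      φ_injOn := by
        intro a ha b hb h
        rw [Set.mem_compl_iff, hrange] at ha hb
        exact hval.2 (S.φ_inj ha.1 hb.1 ha.2 hb.2 h) }
  have hverts : ∀ x, x ∈ F.verts ↔ ∃ i ≤ S.m, ¬ S.virt i ∧ S.φ i = x := by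
    intro x
    constructor
    · rintro ⟨a, ha, rfl⟩
      exact ⟨a.down.val, ((hrange a).1 ha).1, ((hrange a).1 ha).2, rfl⟩
    · rintro ⟨i, hi, hv, rfl⟩
      exact ⟨⟨⟨i, by omega⟩⟩, (hrange _).2 ⟨hi, hv⟩, rfl⟩
  refine ⟨κ, inferInstance, F, fun i => S.Y i.down.1, fun i => S.T i.down.1,
    h𝒢 _ _ (classP_chordGraph hm S.chords), S.φ_zero, S.φ_last,
    fun i => S.fill i.down.2.1 i.down.2.2, ?_, ?_, ?_, ?_⟩
  · rintro ⟨i, hi, hv⟩ x ⟨hx, hxF⟩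
    obtain ⟨j, hj, hvj, rfl⟩ := (hverts x).1 hxF
    rcases S.attach hi hv hj hvj hx with rfl | rfl
    · exact Or.inl rfl
    · exact Or.inr rfl
  · rintro ⟨i, hi, hv⟩ ⟨j, hj, hw⟩ hij x ⟨hx, hx'⟩
    exact S.attach_virt hi hv hj hw (fun h => hij (by subst h; rfl)) hx hx'
  · ext x
    rw [S.mem_iff, Set.mem_union, hverts, Set.mem_iUnion]
    refine or_congr Iff.rfl ⟨?_, ?_⟩
    · rintro ⟨i, hi, hv, hx⟩
      exact ⟨⟨i, hi, hv⟩, hx⟩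
    · rintro ⟨⟨i, hi, hv⟩, hx⟩
      exact ⟨i, hi, hv, hx⟩
  · intro a b
    rw [S.E_iff]
    refine or_congr ⟨?_, ?_⟩ ⟨?_, ?_⟩
    · rintro ⟨i, j, hi, hj, hv, hw, h, rfl, rfl⟩
      refine ⟨⟨⟨i, by omega⟩⟩, (hrange _).2 ⟨hi, hv⟩, ⟨⟨j, by omega⟩⟩, (hrange _).2 ⟨hj, hw⟩,
        (hadj _ _).2 ⟨?_, ?_⟩, rfl, rfl⟩
      · show i ≠ j
        rcases h with h | h | h | h
        · omega
        · omega
        · have := (S.chords.range h).1; omega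
        · have := (S.chords.range h).1; omega
      · rcases h with h | h | h | h
        · exact Or.inl (Or.inl h)
        · exact Or.inr (Or.inl h)
        · exact Or.inl (Or.inr (Or.inr h))
        · exact Or.inr (Or.inr (Or.inr h))
    · rintro ⟨p, hp, q, hq, h, rfl, rfl⟩
      obtain ⟨hp1, hp2⟩ := (hrange p).1 hp
      obtain ⟨hq1, hq2⟩ := (hrange q).1 hq
      obtain ⟨h0, h⟩ := (hadj p q).1 h
      refine ⟨_, _, hp1, hq1, hp2, hq2, ?_, rfl, rfl⟩
      rcases h with (h | h | h) | (h | h | h)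
      · exact Or.inl h
      · omega
      · exact Or.inr (Or.inr (Or.inl h))
      · exact Or.inr (Or.inl h)
      · omega
      · exact Or.inr (Or.inr (Or.inr h))
    · rintro ⟨i, hi, hv, h⟩
      exact ⟨⟨i, hi, hv⟩, h⟩
    · rintro ⟨⟨i, hi, hv⟩, h⟩
      exact ⟨i, hi, hv, h⟩

end Strip

namespace Strip

variable {𝒢 : GraphClass.{u}} {V : Type u} {L : ℕ} {X X₁ X₂ : Set V} {E E' E₁ E₂ : V → V → Prop}
  {u v c : V}

/-- A single edge. -/
noncomputable def edge (huv : u ≠ v) (hX : ∀ x, x ∈ X ↔ x = u ∨ x = v)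
    (hE : ∀ a b, E a b ↔ (a = u ∧ b = v) ∨ (a = v ∧ b = u)) : Strip 𝒢 L X E u v where
  m := 1
  R _ _ := False
  virt _ := False
  φ i := if i = 0 then u else v
  Y _ := ∅
  T _ _ _ := False
  one_le := le_rfl
  chords := ⟨False.elim, False.elim, False.elim⟩
  not_virt_zero := id
  not_virt_last := id
  not_virt_succ := False.elim
  not_virt_of_R := False.elim
  φ_zero := if_pos rfl
  φ_last := if_neg one_ne_zero
  φ_inj := by
    intro i j hi hj _ _ h
    interval_cases i <;> interval_cases j <;> simp_all
  fill _ h := h.elim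
  attach _ h := h.elim
  attach_virt _ h := h.elim
  mem_iff x := by
    rw [hX]
    constructor
    · rintro (rfl | rfl)
      · exact Or.inl ⟨0, by omega, id, if_pos rfl⟩
      · exact Or.inl ⟨1, by omega, id, if_neg one_ne_zero⟩
    · rintro (⟨i, hi, -, rfl⟩ | ⟨i, -, h, -⟩)
      · interval_cases i
        · exact Or.inl rfl
        · exact Or.inr rfl
      · exact h.elim
  E_iff a b := by
    rw [hE]
    constructor
    · rintro (⟨rfl, rfl⟩ | ⟨rfl, rfl⟩)
      · exact Or.inl ⟨0, 1, by omega, by omega, id, id, Or.inl rfl, rfl, rfl⟩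
      · exact Or.inl ⟨1, 0, by omega, by omega, id, id, Or.inr (Or.inl rfl), rfl, rfl⟩
    · rintro (⟨i, j, hi, hj, -, -, h, rfl, rfl⟩ | ⟨i, -, h, -⟩)
      · interval_cases i <;> interval_cases j <;> simp_all
      · exact h.elim

/-- A single smaller piece. -/
noncomputable def item (huv : u ≠ v) (hu : u ∈ X) (hv : v ∈ X) (h : Fill 𝒢 L X E u v) :
    Strip 𝒢 L X E u v where
  m := 2
  R _ _ := False
  virt i := i = 1
  φ i := if i = 0 then u else v
  Y _ := X
  T _ := E
  one_le := by omega
  chords := ⟨False.elim, False.elim, False.elim⟩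
  not_virt_zero := by omega
  not_virt_last := by omega
  not_virt_succ := by omega
  not_virt_of_R := False.elim
  φ_zero := if_pos rfl
  φ_last := if_neg two_ne_zero
  φ_inj := by
    intro i j hi hj _ _ h
    interval_cases i <;> interval_cases j <;> simp_all
  fill := by
    rintro i - rfl
    exact h
  attach := by
    rintro i j - rfl hj hj1 -
    omega
  attach_virt := by
    rintro i j x - rfl - rfl hij
    exact absurd rfl hij
  mem_iff x := by
    constructor
    · exact fun hx => Or.inr ⟨1, by omega, rfl, hx⟩
    · rintro (⟨i, hi, -, rfl⟩ | ⟨i, -, -, hx⟩)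
      · split_ifs
        exacts [hu, hv]
      · exact hx
  E_iff a b := by
    constructor
    · exact fun h => Or.inr ⟨1, by omega, rfl, h⟩
    · rintro (⟨i, j, hi, hj, h1, h2, h, -, -⟩ | ⟨i, -, -, h⟩)
      · simp only [or_false] at h
        omega
      · exact h

/-- Adding an edge between the ends. -/
noncomputable def chord (S : Strip 𝒢 L X E u v) (huv : ¬ E u v)
    (hE : ∀ a b, E' a b ↔ E a b ∨ (a = u ∧ b = v) ∨ (a = v ∧ b = u)) : Strip 𝒢 L X E' u v :=
  -- The chord `(0, m)` must not be a path edge; with `m = 1` the ends would be adjacent already.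
  have hm : 2 ≤ S.m := by
    by_contra hlt
    have h1 : S.m = 1 := by have := S.one_le; omega
    refine huv ((S.E_iff _ _).2 (Or.inl ⟨0, 1, by omega, by omega, S.not_virt_zero,
      fun h => S.not_virt_last (by rwa [h1]), Or.inl rfl, S.φ_zero, ?_⟩))
    exact (congrArg S.φ h1.symm).trans S.φ_last
  { S with
    R := fun i j => S.R i j ∨ (i = 0 ∧ j = S.m)
    chords := by
      refine ⟨?_, ?_, ?_⟩
      · rintro i j (h | ⟨rfl, rfl⟩)
        · exact S.chords.range h
        · omega
      · rintro i j k l (h | ⟨rfl, rfl⟩) (h' | ⟨rfl, rfl⟩) h1 h2 h3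
        · exact S.chords.cross h h' h1 h2 h3
        · omega
        · have := S.chords.range h'
          omega
        · omega
      · rintro i j (h | ⟨rfl, rfl⟩) (h' | ⟨h', h''⟩) (h3 | ⟨h3, h3'⟩) <;> first | omega | skip
        · exact S.chords.not_triple h h' h3
        · have := S.chords.range h'
          omega
    not_virt_of_R := by
      rintro i j (h | ⟨rfl, rfl⟩)
      · exact S.not_virt_of_R h
      · exact ⟨S.not_virt_zero, S.not_virt_last⟩
    E_iff := by
      intro a b
      rw [hE, S.E_iff]
      constructor
      · rintro ((⟨i, j, h1, h2, h3, h4, h5, h6⟩ | h) | ⟨rfl, rfl⟩ | ⟨rfl, rfl⟩)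
        · refine Or.inl ⟨i, j, h1, h2, h3, h4, ?_, h6⟩
          tauto
        · exact Or.inr h
        · exact Or.inl ⟨0, S.m, by omega, le_rfl, S.not_virt_zero, S.not_virt_last,
            Or.inr (Or.inr (Or.inl (Or.inr ⟨rfl, rfl⟩))), S.φ_zero, S.φ_last⟩
        · exact Or.inl ⟨S.m, 0, le_rfl, by omega, S.not_virt_last, S.not_virt_zero,
            Or.inr (Or.inr (Or.inr (Or.inr ⟨rfl, rfl⟩))), S.φ_last, S.φ_zero⟩
      · rintro (⟨i, j, h1, h2, h3, h4, (h | h | (h | ⟨rfl, rfl⟩) | (h | ⟨rfl, rfl⟩)), h6⟩ | h)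
        · exact Or.inl (Or.inl ⟨i, j, h1, h2, h3, h4, Or.inl h, h6⟩)
        · exact Or.inl (Or.inl ⟨i, j, h1, h2, h3, h4, Or.inr (Or.inl h), h6⟩)
        · exact Or.inl (Or.inl ⟨i, j, h1, h2, h3, h4, Or.inr (Or.inr (Or.inl h)), h6⟩)
        · rw [S.φ_zero, S.φ_last] at h6
          exact Or.inr (Or.inl ⟨h6.1.symm, h6.2.symm⟩)
        · exact Or.inl (Or.inl ⟨i, j, h1, h2, h3, h4, Or.inr (Or.inr (Or.inr h)), h6⟩)
        · rw [S.φ_zero, S.φ_last] at h6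
          exact Or.inr (Or.inr ⟨h6.1.symm, h6.2.symm⟩)
        · exact Or.inl (Or.inr h) }

theorem pos_of_virt (S : Strip 𝒢 L X E u v) {i : ℕ} (h : S.virt i) : 1 ≤ i := by
  rcases Nat.eq_zero_or_pos i with rfl | hi
  · exact absurd h S.not_virt_zero
  · exact hi

theorem φ_mem (S : Strip 𝒢 L X E u v) {i : ℕ} (hi : i ≤ S.m) (h : ¬ S.virt i) : S.φ i ∈ X :=
  (S.mem_iff _).2 (Or.inl ⟨i, hi, h, rfl⟩)

theorem Y_subset (S : Strip 𝒢 L X E u v) {i : ℕ} (hi : i < S.m) (h : S.virt i) {x : V}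
    (hx : x ∈ S.Y i) : x ∈ X :=
  (S.mem_iff _).2 (Or.inr ⟨i, hi, h, hx⟩)

/-- Series composition of two strips. -/
theorem concat (S₁ : Strip 𝒢 L X₁ E₁ u c) (S₂ : Strip 𝒢 L X₂ E₂ c v)
    (hX : ∀ x, x ∈ X ↔ x ∈ X₁ ∨ x ∈ X₂) (hc : ∀ x ∈ X₁, x ∈ X₂ → x = c)
    (hE : ∀ a b, E a b ↔ E₁ a b ∨ E₂ a b) : Nonempty (Strip 𝒢 L X E u v) := by
  classical
  set m := S₁.m with hm
  have hm1 := S₁.one_le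
  have hm2 := S₂.one_le
  -- Position `m` belongs to both strips and is the common vertex `c`. The data of the two strips
  -- agree there, so each can be read off from either side.
  obtain ⟨virt, hv1, hv2⟩ : ∃ virt : ℕ → Prop, (∀ i ≤ m, virt i ↔ S₁.virt i) ∧
      ∀ i, virt (m + i) ↔ S₂.virt i := by
    refine ⟨fun i => if i ≤ m then S₁.virt i else S₂.virt (i - m), fun i hi => ?_, fun i => ?_⟩
    · simp only [if_pos hi]
    · rcases Nat.eq_zero_or_pos i with rfl | hi
      · simp only [add_zero, le_refl, if_true]
        exact iff_of_false S₁.not_virt_last S₂.not_virt_zero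
      · simp only [if_neg (show ¬ m + i ≤ m by omega), Nat.add_sub_cancel_left]
  obtain ⟨φ, hφ1, hφ2⟩ : ∃ φ : ℕ → V, (∀ i ≤ m, φ i = S₁.φ i) ∧ ∀ i, φ (m + i) = S₂.φ i := by
    refine ⟨fun i => if i ≤ m then S₁.φ i else S₂.φ (i - m), fun i hi => ?_, fun i => ?_⟩
    · simp only [if_pos hi]
    · rcases Nat.eq_zero_or_pos i with rfl | hi
      · simp only [add_zero, le_refl, if_true]
        rw [S₂.φ_zero, hm, S₁.φ_last]
      · simp only [if_neg (show ¬ m + i ≤ m by omega), Nat.add_sub_cancel_left]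
  obtain ⟨Y, hY1, hY2⟩ : ∃ Y : ℕ → Set V, (∀ i < m, Y i = S₁.Y i) ∧
      ∀ i, 1 ≤ i → Y (m + i) = S₂.Y i := by
    refine ⟨fun i => if i ≤ m then S₁.Y i else S₂.Y (i - m), fun i hi => ?_, fun i hi => ?_⟩
    · simp only [if_pos hi.le]
    · simp only [if_neg (show ¬ m + i ≤ m by omega), Nat.add_sub_cancel_left]
  obtain ⟨T, hT1, hT2⟩ : ∃ T : ℕ → V → V → Prop, (∀ i < m, T i = S₁.T i) ∧
      ∀ i, 1 ≤ i → T (m + i) = S₂.T i := by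
    refine ⟨fun i => if i ≤ m then S₁.T i else S₂.T (i - m), fun i hi => ?_, fun i hi => ?_⟩
    · simp only [if_pos hi.le]
    · simp only [if_neg (show ¬ m + i ≤ m by omega), Nat.add_sub_cancel_left]
  have hend : S₁.φ m = S₂.φ 0 := S₁.φ_last.trans S₂.φ_zero.symm
  -- positions in the first and in the second part
  have split : ∀ i, i ≤ m + S₂.m → i ≤ m ∨ ∃ i' ≤ S₂.m, i = m + i' := fun i hi => by
    by_cases h : i ≤ m
    · exact Or.inl h
    · exact Or.inr ⟨i - m, by omega, by omega⟩
  have splitv : ∀ i, i < m + S₂.m → virt i → (i < m ∧ S₁.virt i) ∨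
      ∃ i', 1 ≤ i' ∧ i' < S₂.m ∧ i = m + i' ∧ S₂.virt i' := fun i hi hv => by
    by_cases h : i ≤ m
    · have hv' := (hv1 i h).1 hv
      have : i ≠ m := fun h => S₁.not_virt_last (by rw [← hm, ← h]; exact hv')
      exact Or.inl ⟨by omega, hv'⟩
    · obtain ⟨i', rfl⟩ : ∃ i', i = m + i' := ⟨i - m, by omega⟩
      exact Or.inr ⟨i', by omega, by omega, rfl, (hv2 i').1 hv⟩
  have hcX : ∀ i ≤ m, ¬ S₁.virt i → S₁.φ i ∈ X₂ → i = m := fun i hi hv h =>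
    S₁.φ_inj hi le_rfl hv S₁.not_virt_last ((hc _ (S₁.φ_mem hi hv) h).trans S₁.φ_last.symm)
  have hcX' : ∀ i ≤ S₂.m, ¬ S₂.virt i → S₂.φ i ∈ X₁ → i = 0 := fun i hi hv h =>
    S₂.φ_inj hi (Nat.zero_le _) hv S₂.not_virt_zero
      ((hc _ h (S₂.φ_mem hi hv)).trans S₂.φ_zero.symm)
  -- Chords from different strips occupy intervals that meet at most in `m`, so they do not cross.
  refine ⟨⟨m + S₂.m, fun i j => S₁.R i j ∨ ∃ i' j', i = m + i' ∧ j = m + j' ∧ S₂.R i' j', virt, φ,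
    Y, T, by omega, ⟨?_, ?_, ?_⟩, ?_, ?_, ?_, ?_, ?_, ?_, ?_, ?_, ?_, ?_, ?_, ?_⟩⟩
  · rintro i j (h | ⟨i', j', rfl, rfl, h⟩)
    · have := S₁.chords.range h; omega
    · have := S₂.chords.range h; omega
  · rintro i j k l (h | ⟨i', j', rfl, rfl, h⟩) (h' | ⟨k', l', rfl, rfl, h'⟩) a1 a2 a3
    · exact S₁.chords.cross h h' a1 a2 a3
    · have := S₁.chords.range h; omega
    · have := S₁.chords.range h'; omega
    · have := S₂.chords.cross h h' (by omega) (by omega) (by omega)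
      omega
  · rintro i j (h | ⟨i', j', rfl, rfl, h⟩) (h' | ⟨k', l', e1, e2, h'⟩) (h3 | ⟨p, q, e3, e4, h3⟩)
    · exact S₁.chords.not_triple h h' h3
    · have := S₁.chords.range h'; omega
    · have := S₁.chords.range h3; have := S₁.chords.range h; omega
    · have := S₁.chords.range h; omega
    · have := S₁.chords.range h'; omega
    · have := S₁.chords.range h'; omega
    · have := S₁.chords.range h3; omega
    · obtain rfl : k' = i' + 1 := by omega
      obtain rfl : l' = j' + 1 := by omega
      obtain rfl : p = i' + 2 := by omega
      obtain rfl : q = j' + 2 := by omega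
      exact S₂.chords.not_triple h h' h3
  · rw [hv1 0 (Nat.zero_le _)]; exact S₁.not_virt_zero
  · rw [hv2]; exact S₂.not_virt_last
  · intro i h
    by_cases hi : i < m
    · rw [hv1 _ (by omega)] at h ⊢
      exact S₁.not_virt_succ h
    · obtain ⟨i', rfl⟩ : ∃ i', i = m + i' := ⟨i - m, by omega⟩
      rw [add_assoc, hv2]
      exact S₂.not_virt_succ ((hv2 i').1 h)
  · rintro i j (h | ⟨i', j', rfl, rfl, h⟩)
    · have := S₁.chords.range h
      rw [hv1 i (by omega), hv1 j (by omega)]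
      exact S₁.not_virt_of_R h
    · rw [hv2, hv2]
      exact S₂.not_virt_of_R h
  · rw [hφ1 0 (Nat.zero_le _), S₁.φ_zero]
  · rw [hφ2, S₂.φ_last]
  · intro i j hi hj hvi hvj h
    rcases split i hi with hi | ⟨i', hi', rfl⟩ <;> rcases split j hj with hj | ⟨j', hj', rfl⟩
    · rw [hφ1 i hi, hφ1 j hj] at h
      rw [hv1 i hi] at hvi
      rw [hv1 j hj] at hvj
      exact S₁.φ_inj hi hj hvi hvj h
    · rw [hφ1 i hi, hφ2] at h
      rw [hv1 i hi] at hvi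
      rw [hv2] at hvj
      have h1 := hcX i hi hvi (h ▸ S₂.φ_mem hj' hvj)
      have h2 := hcX' j' hj' hvj (h ▸ S₁.φ_mem hi hvi)
      omega
    · rw [hφ1 j hj, hφ2] at h
      rw [hv1 j hj] at hvj
      rw [hv2] at hvi
      have h1 := hcX j hj hvj (h ▸ S₂.φ_mem hi' hvi)
      have h2 := hcX' i' hi' hvi (h ▸ S₁.φ_mem hj hvj)
      omega
    · rw [hφ2, hφ2] at h
      rw [hv2] at hvi hvj
      rw [S₂.φ_inj hi' hj' hvi hvj h]
  · intro i hi hv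
    replace hv := splitv i hi hv
    clear hi
    rcases hv with ⟨hi, hv⟩ | ⟨i', h1, hi', rfl, hv⟩
    · rw [hY1 i hi, hT1 i hi, hφ1 _ (by omega), hφ1 _ (by omega)]
      exact S₁.fill hi hv
    · rw [hY2 i' h1, hT2 i' h1, Nat.add_sub_assoc h1, hφ2, add_assoc, hφ2]
      exact S₂.fill hi' hv
  · intro i j hi hv hj hvj h
    replace hv := splitv i hi hv
    clear hi
    rcases hv with ⟨hi, hv⟩ | ⟨i', h1, hi', rfl, hv⟩ <;>
      rcases split j hj with hj | ⟨j', hj', rfl⟩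
    · rw [hφ1 j hj, hY1 i hi] at h
      rw [hv1 j hj] at hvj
      exact S₁.attach hi hv hj hvj h
    · rw [hφ2, hY1 i hi] at h
      rw [hv2] at hvj
      have h0 := hcX' j' hj' hvj (S₁.Y_subset hi hv h)
      subst h0
      rw [← hend] at h
      exact S₁.attach hi hv le_rfl S₁.not_virt_last h
    · rw [hφ1 j hj, hY2 i' h1] at h
      rw [hv1 j hj] at hvj
      have h0 := hcX j hj hvj (S₂.Y_subset hi' hv h)
      subst h0
      rw [hend] at h
      have := S₂.attach hi' hv (Nat.zero_le _) S₂.not_virt_zero h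
      omega
    · rw [hφ2, hY2 i' h1] at h
      rw [hv2] at hvj
      have := S₂.attach hi' hv hj' hvj h
      omega
  · intro i j x hi hvi hj hvj hij hx hx'
    replace hvi := splitv i hi hvi
    replace hvj := splitv j hj hvj
    clear hi hj
    rcases hvi with ⟨hi, hvi⟩ | ⟨i', h1, hi', rfl, hvi⟩ <;>
      rcases hvj with ⟨hj, hvj⟩ | ⟨j', h2, hj', rfl, hvj⟩
    · rw [hY1 i hi] at hx
      rw [hY1 j hj] at hx'
      rw [hφ1 _ (by omega), hφ1 _ (by omega)]
      exact S₁.attach_virt hi hvi hj hvj hij hx hx'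
    · rw [hY1 i hi] at hx
      rw [hY2 j' h2] at hx'
      have hxc := hc x (S₁.Y_subset hi hvi hx) (S₂.Y_subset hj' hvj hx')
      obtain rfl : x = S₁.φ m := hxc.trans S₁.φ_last.symm
      have := S₁.attach hi hvi le_rfl S₁.not_virt_last hx
      rw [hφ1 _ (by omega), hφ1 _ (by omega)]
      rcases this with h | h
      · exact Or.inl (congrArg _ h)
      · exact Or.inr (congrArg _ h)
    · rw [hY2 i' h1] at hx
      rw [hY1 j hj] at hx'
      have hxc := hc x (S₁.Y_subset hj hvj hx') (S₂.Y_subset hi' hvi hx)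
      obtain rfl : x = S₂.φ 0 := hxc.trans S₂.φ_zero.symm
      have := S₂.attach hi' hvi (Nat.zero_le _) S₂.not_virt_zero hx
      rw [Nat.add_sub_assoc h1, hφ2, add_assoc, hφ2]
      rcases this with h | h
      · exact Or.inl (congrArg _ h)
      · exact Or.inr (congrArg _ h)
    · rw [hY2 i' h1] at hx
      rw [hY2 j' h2] at hx'
      rw [Nat.add_sub_assoc h1, hφ2, add_assoc, hφ2]
      exact S₂.attach_virt hi' hvi hj' hvj (by omega) hx hx'
  · intro x
    rw [hX, S₁.mem_iff, S₂.mem_iff]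
    constructor
    · rintro ((⟨i, hi, hv, rfl⟩ | ⟨i, hi, hv, hx⟩) | (⟨i, hi, hv, rfl⟩ | ⟨i, hi, hv, hx⟩))
      · exact Or.inl ⟨i, by omega, by rwa [hv1 i hi], hφ1 i hi⟩
      · exact Or.inr ⟨i, by omega, (hv1 i hi.le).2 hv, by rwa [hY1 i hi]⟩
      · exact Or.inl ⟨m + i, by omega, by rwa [hv2], hφ2 i⟩
      · exact Or.inr ⟨m + i, by omega, (hv2 i).2 hv, by rwa [hY2 i (S₂.pos_of_virt hv)]⟩
    · rintro (⟨i, hi, hv, rfl⟩ | ⟨i, hi, hv, hx⟩)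
      · rcases split i hi with hi | ⟨i', hi', rfl⟩
        · exact Or.inl (Or.inl ⟨i, hi, by rwa [← hv1 i hi], (hφ1 i hi).symm⟩)
        · exact Or.inr (Or.inl ⟨i', hi', by rwa [← hv2], (hφ2 i').symm⟩)
      · replace hv := splitv i hi hv
        clear hi
        rcases hv with ⟨hi, hv⟩ | ⟨i', h1, hi', rfl, hv⟩
        · exact Or.inl (Or.inr ⟨i, hi, hv, by rwa [← hY1 i hi]⟩)
        · exact Or.inr (Or.inr ⟨i', hi', hv, by rwa [← hY2 i' h1]⟩)
  · intro a b
    rw [hE, S₁.E_iff, S₂.E_iff]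
    constructor
    · rintro ((⟨i, j, hi, hj, hv, hw, h, rfl, rfl⟩ | ⟨i, hi, hv, hx⟩) |
        (⟨i, j, hi, hj, hv, hw, h, rfl, rfl⟩ | ⟨i, hi, hv, hx⟩))
      · refine Or.inl ⟨i, j, by omega, by omega, by rwa [hv1 i hi], by rwa [hv1 j hj], ?_,
          hφ1 i hi, hφ1 j hj⟩
        tauto
      · exact Or.inr ⟨i, by omega, (hv1 i hi.le).2 hv, by rwa [hT1 i hi]⟩
      · refine Or.inl ⟨m + i, m + j, by omega, by omega, by rwa [hv2], by rwa [hv2], ?_,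
          hφ2 i, hφ2 j⟩
        rcases h with h | h | h | h
        · left; omega
        · right; left; omega
        · exact Or.inr (Or.inr (Or.inl (Or.inr ⟨i, j, rfl, rfl, h⟩)))
        · exact Or.inr (Or.inr (Or.inr (Or.inr ⟨j, i, rfl, rfl, h⟩)))
      · exact Or.inr ⟨m + i, by omega, (hv2 i).2 hv, by rwa [hT2 i (S₂.pos_of_virt hv)]⟩
    · rintro (⟨i, j, hi, hj, hv, hw, h, rfl, rfl⟩ | ⟨i, hi, hv, hx⟩)
      · have main : (i ≤ m ∧ j ≤ m ∧ (j = i + 1 ∨ i = j + 1 ∨ S₁.R i j ∨ S₁.R j i)) ∨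
            ∃ i' j', i = m + i' ∧ j = m + j' ∧ (j' = i' + 1 ∨ i' = j' + 1 ∨ S₂.R i' j' ∨
              S₂.R j' i') := by
          have hstep : ∀ i j, i ≤ m + S₂.m → j = i + 1 → (i ≤ m ∧ j ≤ m) ∨ ∃ i' j', i = m + i' ∧
              j = m + j' ∧ j' = i' + 1 := by
            intro i j hi hj
            by_cases h : j ≤ m
            · left; omega
            · right; exact ⟨i - m, i - m + 1, by omega, by omega, rfl⟩
          rcases h with h | h | (h | ⟨i', j', e1, e2, h⟩) | (h | ⟨i', j', e1, e2, h⟩)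
          · rcases hstep i j hi h with ⟨a1, a2⟩ | ⟨i', j', a1, a2, a3⟩
            · exact Or.inl ⟨a1, a2, Or.inl h⟩
            · exact Or.inr ⟨i', j', a1, a2, Or.inl a3⟩
          · rcases hstep j i hj h with ⟨a1, a2⟩ | ⟨i', j', a1, a2, a3⟩
            · exact Or.inl ⟨a2, a1, Or.inr (Or.inl h)⟩
            · exact Or.inr ⟨j', i', a2, a1, Or.inr (Or.inl a3)⟩
          · have := S₁.chords.range h
            exact Or.inl ⟨by omega, by omega, Or.inr (Or.inr (Or.inl h))⟩
          · exact Or.inr ⟨i', j', e1, e2, Or.inr (Or.inr (Or.inl h))⟩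
          · have := S₁.chords.range h
            exact Or.inl ⟨by omega, by omega, Or.inr (Or.inr (Or.inr h))⟩
          · exact Or.inr ⟨j', i', e2, e1, Or.inr (Or.inr (Or.inr h))⟩
        clear h
        rcases main with ⟨hi', hj', h⟩ | ⟨i', j', rfl, rfl, h⟩
        · exact Or.inl (Or.inl ⟨i, j, hi', hj', by rwa [← hv1 i hi'], by rwa [← hv1 j hj'], h,
            (hφ1 i hi').symm, (hφ1 j hj').symm⟩)
        · exact Or.inr (Or.inl ⟨i', j', by omega, by omega, by rwa [← hv2], by rwa [← hv2], h,
            (hφ2 i').symm, (hφ2 j').symm⟩)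
      · replace hv := splitv i hi hv
        clear hi
        rcases hv with ⟨hi, hv⟩ | ⟨i', h1, hi', rfl, hv⟩
        · exact Or.inl (Or.inr ⟨i, hi, hv, by rwa [← hT1 i hi]⟩)
        · exact Or.inr (Or.inr ⟨i', hi', hv, by rwa [← hT2 i' h1]⟩)

/-- The piece obtained from a strip by adding two new ends, both adjacent to both old ends. -/
theorem cross {a b : V} (S : Strip 𝒢 L X₁ E₁ a b) (huv : u ≠ v) (hu : u ∉ X₁) (hv : v ∉ X₁)
    (hX : ∀ x, x ∈ X ↔ x = u ∨ x = v ∨ x ∈ X₁)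
    (hE : ∀ p q, E p q ↔ E₁ p q ∨ ((p = u ∨ p = v) ∧ (q = a ∨ q = b)) ∨
      ((p = a ∨ p = b) ∧ (q = u ∨ q = v))) : Nonempty (Strip 𝒢 L X E u v) := by
  classical
  have hm := S.one_le
  set m := S.m with hmdef
  obtain ⟨φ, hφ0, hφ1, hφ2⟩ : ∃ φ : ℕ → V, φ 0 = u ∧ (∀ i ≤ m, φ (i + 1) = S.φ i) ∧
      φ (m + 2) = v := by
    refine ⟨fun i => if i = 0 then u else if i ≤ m + 1 then S.φ (i - 1) else v, if_pos rfl,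
      fun i hi => ?_, ?_⟩
    · simp [hi]
    · simp
  let virt : ℕ → Prop := fun i => 1 ≤ i ∧ i ≤ m + 1 ∧ S.virt (i - 1)
  have hvirt : ∀ i ≤ m, virt (i + 1) ↔ S.virt i := fun i hi => by
    simp only [virt, Nat.add_sub_cancel]
    exact ⟨fun h => h.2.2, fun h => ⟨by omega, by omega, h⟩⟩
  have hv0 : ¬ virt 0 := fun h => by have := h.1; omega
  have hvl : ¬ virt (m + 2) := fun h => by have := h.2.1; omega
  have hφa : φ 1 = a := (hφ1 0 (by omega)).trans S.φ_zero
  have hφb : φ (m + 1) = b := (hφ1 m le_rfl).trans S.φ_last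
  have hv1 : ¬ virt 1 := fun h => S.not_virt_zero ((hvirt 0 (by omega)).1 h)
  have hvm : ¬ virt (m + 1) := fun h => S.not_virt_last ((hvirt m le_rfl).1 h)
  have split : ∀ i ≤ m + 2, i = 0 ∨ i = m + 2 ∨ ∃ i' ≤ m, i = i' + 1 := fun i hi => by
    by_cases h0 : i = 0
    · exact Or.inl h0
    · by_cases h1 : i = m + 2
      · exact Or.inr (Or.inl h1)
      · exact Or.inr (Or.inr ⟨i - 1, by omega, by omega⟩)
  have splitv : ∀ i, virt i → ∃ i', 1 ≤ i' ∧ i' < m ∧ i = i' + 1 ∧ S.virt i' := by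
    rintro i ⟨h1, h2, h3⟩
    have := S.pos_of_virt h3
    have h4 : i - 1 ≠ m := fun h => S.not_virt_last (by rw [← hmdef, ← h]; exact h3)
    exact ⟨i - 1, this, by omega, by omega, h3⟩
  -- The old strip is shifted by one between the new ends `0` and `m + 2`. The edges `ua` and `bv`
  -- prolong the path, while `ub` and `av` become the chords `(0, m + 1)` and `(1, m + 2)`, which
  -- cross each other and nothing else.
  let R : ℕ → ℕ → Prop := fun i j => (∃ i' j', i = i' + 1 ∧ j = j' + 1 ∧ S.R i' j') ∨
    (i = 0 ∧ j = m + 1) ∨ (i = 1 ∧ j = m + 2)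
  refine ⟨⟨m + 2, R, virt, φ, fun i => S.Y (i - 1), fun i => S.T (i - 1), by omega, ⟨?_, ?_, ?_⟩,
    hv0, hvl, ?_, ?_, hφ0, hφ2, ?_, ?_, ?_, ?_, ?_, ?_⟩⟩
  · rintro i j (⟨i', j', rfl, rfl, h⟩ | ⟨rfl, rfl⟩ | ⟨rfl, rfl⟩)
    · have := S.chords.range h; omega
    · omega
    · omega
  · rintro i j k l (⟨i', j', rfl, rfl, h⟩ | ⟨rfl, rfl⟩ | ⟨rfl, rfl⟩)
      (⟨k', l', rfl, rfl, h'⟩ | ⟨rfl, rfl⟩ | ⟨rfl, rfl⟩) a1 a2 a3 <;> first | omega | skip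
    · have := S.chords.cross h h' (by omega) (by omega) (by omega)
      omega
    · have := S.chords.range h'; omega
    · have := S.chords.range h'; omega
  · rintro i j (⟨i', j', rfl, rfl, h⟩ | ⟨rfl, rfl⟩ | ⟨rfl, rfl⟩)
      (⟨k', l', e1, e2, h'⟩ | ⟨e1, e2⟩ | ⟨e1, e2⟩)
      (⟨p, q, e3, e4, h3⟩ | ⟨e3, e4⟩ | ⟨e3, e4⟩) <;> first | omega | skip
    · obtain rfl : k' = i' + 1 := by omega
      obtain rfl : l' = j' + 1 := by omega
      obtain rfl : p = i' + 2 := by omega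
      obtain rfl : q = j' + 2 := by omega
      exact S.chords.not_triple h h' h3
    · have := S.chords.range h'; omega
    · have := S.chords.range h3; omega
    · have := S.chords.range h'; omega
  · intro i h h'
    obtain ⟨i', h1, h2, rfl, h3⟩ := splitv i h
    exact S.not_virt_succ h3 ((hvirt (i' + 1) (by omega)).1 h')
  · rintro i j (⟨i', j', rfl, rfl, h⟩ | ⟨rfl, rfl⟩ | ⟨rfl, rfl⟩)
    · have := S.chords.range h
      rw [hvirt _ (by omega), hvirt _ (by omega)]
      exact S.not_virt_of_R h
    · exact ⟨hv0, hvm⟩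
    · exact ⟨hv1, hvl⟩
  · have hmem : ∀ i ≤ m, ¬ virt (i + 1) → φ (i + 1) ∈ X₁ := fun i hi h => by
      rw [hφ1 i hi]
      exact S.φ_mem hi (fun h' => h ((hvirt i hi).2 h'))
    intro i j hi hj hvi hvj h
    rcases split i hi with rfl | rfl | ⟨i', hi', rfl⟩ <;>
      rcases split j hj with rfl | rfl | ⟨j', hj', rfl⟩
    · rfl
    · exact absurd (hφ0.symm.trans (h.trans hφ2)) huv
    · exact absurd (hmem j' hj' hvj) (by rw [← h, hφ0]; exact hu)
    · exact absurd (hφ0.symm.trans (h.symm.trans hφ2)) huv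
    · rfl
    · exact absurd (hmem j' hj' hvj) (by rw [← h, hφ2]; exact hv)
    · exact absurd (hmem i' hi' hvi) (by rw [h, hφ0]; exact hu)
    · exact absurd (hmem i' hi' hvi) (by rw [h, hφ2]; exact hv)
    · rw [hφ1 i' hi', hφ1 j' hj'] at h
      rw [hvirt i' hi'] at hvi
      rw [hvirt j' hj'] at hvj
      rw [S.φ_inj hi' hj' hvi hvj h]
  · intro i hi hvi
    obtain ⟨i', h1, h2, rfl, h3⟩ := splitv i hvi
    have e1 : φ (i' + 1 - 1) = S.φ (i' - 1) := by
      rw [← hφ1 (i' - 1) (by omega)]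
      congr 1
      omega
    rw [e1, hφ1 (i' + 1) (by omega)]
    exact S.fill h2 h3
  · intro i j hi hvi hj hvj h
    obtain ⟨i', h1, h2, rfl, h3⟩ := splitv i hvi
    change φ j ∈ S.Y i' at h
    have hX1 := S.Y_subset h2 h3 h
    rcases split j hj with rfl | rfl | ⟨j', hj', rfl⟩
    · exact absurd (hφ0 ▸ hX1) hu
    · exact absurd (hφ2 ▸ hX1) hv
    · rw [hφ1 j' hj'] at h
      rw [hvirt j' hj'] at hvj
      have := S.attach h2 h3 hj' hvj h
      omega
  · intro i j x hi hvi hj hvj hij hx hx'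
    obtain ⟨i', h1, h2, rfl, h3⟩ := splitv i hvi
    obtain ⟨j', h1', h2', rfl, h3'⟩ := splitv j hvj
    have e1 : φ (i' + 1 - 1) = S.φ (i' - 1) := by
      rw [← hφ1 (i' - 1) (by omega)]
      congr 1
      omega
    rw [e1, hφ1 (i' + 1) (by omega)]
    exact S.attach_virt h2 h3 h2' h3' (by omega) hx hx'
  · intro x
    rw [hX, S.mem_iff]
    constructor
    · rintro (rfl | rfl | ⟨i, hi, hvi, rfl⟩ | ⟨i, hi, hvi, hx⟩)
      · exact Or.inl ⟨0, by omega, hv0, hφ0⟩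
      · exact Or.inl ⟨m + 2, by omega, hvl, hφ2⟩
      · exact Or.inl ⟨i + 1, by omega, by rwa [hvirt i hi], hφ1 i hi⟩
      · exact Or.inr ⟨i + 1, by omega, (hvirt i hi.le).2 hvi, hx⟩
    · rintro (⟨i, hi, hvi, rfl⟩ | ⟨i, hi, hvi, hx⟩)
      · rcases split i hi with rfl | rfl | ⟨i', hi', rfl⟩
        · exact Or.inl hφ0
        · exact Or.inr (Or.inl hφ2)
        · exact Or.inr (Or.inr (Or.inl ⟨i', hi', by rwa [← hvirt i' hi'], (hφ1 i' hi').symm⟩))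
      · obtain ⟨i', h1, h2, rfl, h3⟩ := splitv i hvi
        exact Or.inr (Or.inr (Or.inr ⟨i', h2, h3, hx⟩))
  · intro p q
    rw [hE, S.E_iff]
    constructor
    · rintro ((⟨i, j, hi, hj, h1, h2, h, rfl, rfl⟩ | ⟨i, hi, hvi, hx⟩) |
        ⟨rfl | rfl, rfl | rfl⟩ | ⟨rfl | rfl, rfl | rfl⟩)
      · refine Or.inl ⟨i + 1, j + 1, by omega, by omega, by rwa [hvirt i hi], by rwa [hvirt j hj],
          ?_, hφ1 i hi, hφ1 j hj⟩
        rcases h with h | h | h | h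
        · left; omega
        · right; left; omega
        · exact Or.inr (Or.inr (Or.inl (Or.inl ⟨i, j, rfl, rfl, h⟩)))
        · exact Or.inr (Or.inr (Or.inr (Or.inl ⟨j, i, rfl, rfl, h⟩)))
      · exact Or.inr ⟨i + 1, by omega, (hvirt i hi.le).2 hvi, hx⟩
      · exact Or.inl ⟨0, 1, by omega, by omega, hv0, hv1, Or.inl rfl, hφ0, hφa⟩
      · exact Or.inl ⟨0, m + 1, by omega, by omega, hv0, hvm,
          Or.inr (Or.inr (Or.inl (Or.inr (Or.inl ⟨rfl, rfl⟩)))), hφ0, hφb⟩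
      · exact Or.inl ⟨m + 2, 1, by omega, by omega, hvl, hv1,
          Or.inr (Or.inr (Or.inr (Or.inr (Or.inr ⟨rfl, rfl⟩)))), hφ2, hφa⟩
      · exact Or.inl ⟨m + 2, m + 1, by omega, by omega, hvl, hvm, Or.inr (Or.inl rfl), hφ2, hφb⟩
      · exact Or.inl ⟨1, 0, by omega, by omega, hv1, hv0, Or.inr (Or.inl rfl), hφa, hφ0⟩
      · exact Or.inl ⟨1, m + 2, by omega, by omega, hv1, hvl,
          Or.inr (Or.inr (Or.inl (Or.inr (Or.inr ⟨rfl, rfl⟩)))), hφa, hφ2⟩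
      · exact Or.inl ⟨m + 1, 0, by omega, by omega, hvm, hv0,
          Or.inr (Or.inr (Or.inr (Or.inr (Or.inl ⟨rfl, rfl⟩)))), hφb, hφ0⟩
      · exact Or.inl ⟨m + 1, m + 2, by omega, by omega, hvm, hvl, Or.inl rfl, hφb, hφ2⟩
    · have key : ∀ i j, i ≤ m + 2 → j ≤ m + 2 → (j = i + 1 ∨ R i j) →
          (∃ i' ≤ m, ∃ j' ≤ m, i = i' + 1 ∧ j = j' + 1 ∧ (j' = i' + 1 ∨ S.R i' j')) ∨
          (φ i = u ∧ (φ j = a ∨ φ j = b)) ∨ (φ j = v ∧ (φ i = a ∨ φ i = b)) := by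
        rintro i j hi hj (rfl | ⟨i', j', rfl, rfl, h⟩ | ⟨rfl, rfl⟩ | ⟨rfl, rfl⟩)
        · rcases split i hi with rfl | rfl | ⟨i', hi', rfl⟩
          · exact Or.inr (Or.inl ⟨hφ0, Or.inl hφa⟩)
          · omega
          · by_cases him : i' = m
            · subst him
              exact Or.inr (Or.inr ⟨hφ2, Or.inr hφb⟩)
            · exact Or.inl ⟨i', hi', i' + 1, by omega, rfl, rfl, Or.inl rfl⟩
        · have := S.chords.range h
          exact Or.inl ⟨i', by omega, j', by omega, rfl, rfl, Or.inr h⟩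
        · exact Or.inr (Or.inl ⟨hφ0, Or.inr hφb⟩)
        · exact Or.inr (Or.inr ⟨hφ2, Or.inl hφa⟩)
      rintro (⟨i, j, hi, hj, h1, h2, h, rfl, rfl⟩ | ⟨i, hi, hvi, hx⟩)
      · have h' : (j = i + 1 ∨ R i j) ∨ (i = j + 1 ∨ R j i) := by
          rcases h with h | h | h | h
          exacts [Or.inl (Or.inl h), Or.inr (Or.inl h), Or.inl (Or.inr h), Or.inr (Or.inr h)]
        clear h
        rcases h' with h' | h'
        · replace h' := key i j hi hj h'
          rcases h' with ⟨i', hi', j', hj', rfl, rfl, h'⟩ | ⟨e1, e2⟩ | ⟨e1, e2⟩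
          · rw [hvirt i' hi'] at h1
            rw [hvirt j' hj'] at h2
            refine Or.inl (Or.inl ⟨i', j', hi', hj', h1, h2, ?_, (hφ1 i' hi').symm,
              (hφ1 j' hj').symm⟩)
            exact h'.elim Or.inl fun h => Or.inr (Or.inr (Or.inl h))
          · exact Or.inr (Or.inl ⟨Or.inl e1, e2⟩)
          · exact Or.inr (Or.inr ⟨e2, Or.inr e1⟩)
        · replace h' := key j i hj hi h'
          rcases h' with ⟨j', hj', i', hi', rfl, rfl, h'⟩ | ⟨e1, e2⟩ | ⟨e1, e2⟩
          · rw [hvirt i' hi'] at h1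
            rw [hvirt j' hj'] at h2
            refine Or.inl (Or.inl ⟨i', j', hi', hj', h1, h2, ?_, (hφ1 i' hi').symm,
              (hφ1 j' hj').symm⟩)
            exact h'.elim (fun h => Or.inr (Or.inl h)) fun h => Or.inr (Or.inr (Or.inr h))
          · exact Or.inr (Or.inr ⟨e2, Or.inl e1⟩)
          · exact Or.inr (Or.inl ⟨Or.inr e1, e2⟩)
      · obtain ⟨i', h1, h2, rfl, h3⟩ := splitv i hvi
        exact Or.inl (Or.inr ⟨i', h2, h3, hx⟩)

end Strip

/-! ### Regions of a 2-connected graph and their rooted minors. -/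

section Regions

variable {V : Type u} {G : SimpleGraph V} {C C₁ C₂ : Set V} {u v c : V}

/-- `C` is a nonempty set, with all neighbours in `C ∪ {u, v}`, that together with `u` and `v` does
not cover the graph. -/
structure Region (G : SimpleGraph V) (C : Set V) (u v : V) : Prop where
  nonempty : C.Nonempty
  ne : u ≠ v
  left_notMem : u ∉ C
  right_notMem : v ∉ C
  closed : ∀ x ∈ C, ∀ y, G.Adj x y → y ∈ C ∨ y = u ∨ y = v
  outside : ∃ o, o ∉ C ∧ o ≠ u ∧ o ≠ v

namespace Region

theorem swap (h : Region G C u v) : Region G C v u :=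
  ⟨h.nonempty, h.ne.symm, h.right_notMem, h.left_notMem,
    fun x hx y hxy => (h.closed x hx y hxy).imp id Or.symm,
    let ⟨o, h1, h2, h3⟩ := h.outside; ⟨o, h1, h3, h2⟩⟩

/-- The field `outside` makes the notion symmetric: the other side of a 2-separation is a region
with the same ends. -/
theorem compl (h : Region G C u v) : Region G {x | x ∉ C ∧ x ≠ u ∧ x ≠ v} u v := by
  refine ⟨h.outside, h.ne, fun h => h.2.1 rfl, fun h => h.2.2 rfl, ?_, ?_⟩
  · rintro x ⟨hx, hxu, hxv⟩ y hxy
    by_cases hyu : y = u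
    · exact Or.inr (Or.inl hyu)
    by_cases hyv : y = v
    · exact Or.inr (Or.inr hyv)
    refine Or.inl ⟨fun hy => ?_, hyu, hyv⟩
    rcases h.closed y hy x hxy.symm with h | h | h
    exacts [hx h, hxu h, hxv h]
  · obtain ⟨c, hc⟩ := h.nonempty
    exact ⟨c, fun h => h.1 hc, fun hcu => h.left_notMem (hcu ▸ hc),
      fun hcv => h.right_notMem (hcv ▸ hc)⟩

/-- In a 2-connected graph, every set that is closed in `C` has a neighbour of `u`. -/
theorem exists_adj_left (h : Region G C u v) (h1 : No1Sep G) {T : Set V} {x : V} (hxT : x ∈ T)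
    (hxC : x ∈ C) (hT : ∀ a ∈ T, a ∈ C → ∀ b ∈ C, G.Adj a b → b ∈ T) :
    ∃ a ∈ T, a ∈ C ∧ G.Adj a u := by
  obtain ⟨o, ho, -, hov⟩ := h.outside
  obtain ⟨a, ha, b, hb, hbv, hab⟩ := h1 (T ∩ C) v o ⟨x, hxT, hxC⟩ (fun h' => h.right_notMem h'.2)
    (fun h' => ho h'.2) hov
  rcases h.closed a ha.2 b hab with hbC | rfl | rfl
  · exact absurd ⟨hT a ha.1 ha.2 b hbC hab, hbC⟩ hb
  · exact ⟨a, ha.1, ha.2, hab⟩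
  · exact absurd rfl hbv

theorem exists_adj_right (h : Region G C u v) (h1 : No1Sep G) {T : Set V} {x : V} (hxT : x ∈ T)
    (hxC : x ∈ C) (hT : ∀ a ∈ T, a ∈ C → ∀ b ∈ C, G.Adj a b → b ∈ T) :
    ∃ a ∈ T, a ∈ C ∧ G.Adj a v := h.swap.exists_adj_left h1 hxT hxC hT

theorem adj_left (h : Region G C u v) (h1 : No1Sep G) : ∃ a ∈ C, G.Adj a u := by
  obtain ⟨x, hx⟩ := h.nonempty
  obtain ⟨a, -, h⟩ := h.exists_adj_left h1 (Set.mem_univ x) hx (fun _ _ _ _ _ _ => Set.mem_univ _)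
  exact ⟨a, h⟩

theorem adj_right (h : Region G C u v) (h1 : No1Sep G) : ∃ a ∈ C, G.Adj a v :=
  h.swap.adj_left h1

/-- A component of `C` has neighbours at both ends, since a single vertex does not cut it off. Such
a set plays the role of a virtual edge in all minor constructions. -/
theorem exists_conn (h : Region G C u v) (h1 : No1Sep G) : ∃ D ⊆ C, Conn G D ∧
    (∃ x ∈ D, G.Adj x u) ∧ ∃ x ∈ D, G.Adj x v := by
  obtain ⟨x, hx⟩ := h.nonempty
  obtain ⟨a, ha, -, hau⟩ := h.exists_adj_left h1 (T := comp G C x) (mem_comp_self hx) hx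
    (fun _ ha _ _ hb hab => comp_closed ha hb hab)
  obtain ⟨b, hb, -, hbv⟩ := h.exists_adj_right h1 (T := comp G C x) (mem_comp_self hx) hx
    (fun _ ha _ _ hb hab => comp_closed ha hb hab)
  exact ⟨comp G C x, comp_subset, conn_comp hx, ⟨a, ha, hau⟩, ⟨b, hb, hbv⟩⟩

end Region

/-- A `K_{2,ι}`-minor on the piece `C` whose two hubs contain `u` and `v`. -/
def RootedMinor (G : SimpleGraph V) (ι : Type) (C : Set V) (u v : V) : Prop :=
  ∃ (A B : Set V) (D : ι → Set V), A ⊆ insert u C ∧ B ⊆ insert v C ∧ u ∈ A ∧ v ∈ B ∧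
    Conn G A ∧ Conn G B ∧ Disjoint A B ∧
    (∀ i, D i ⊆ C ∧ Conn G (D i) ∧ Disjoint (D i) A ∧ Disjoint (D i) B ∧
      (∃ x ∈ D i, ∃ y ∈ A, G.Adj x y) ∧ ∃ x ∈ D i, ∃ y ∈ B, G.Adj x y) ∧
    ∀ i j, i ≠ j → Disjoint (D i) (D j)

namespace RootedMinor

variable {ι κ : Type}

theorem swap (h : RootedMinor G ι C u v) : RootedMinor G ι C v u := by
  obtain ⟨A, B, D, h1, h2, h3, h4, h5, h6, h7, h8, h9⟩ := h
  exact ⟨B, A, D, h2, h1, h4, h3, h6, h5, h7.symm, fun i =>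
    let ⟨a1, a2, a3, a4, a5, a6⟩ := h8 i; ⟨a1, a2, a4, a3, a6, a5⟩, h9⟩

theorem reindex (h : RootedMinor G ι C u v) (f : κ ↪ ι) : RootedMinor G κ C u v := by
  obtain ⟨A, B, D, h1, h2, h3, h4, h5, h6, h7, h8, h9⟩ := h
  exact ⟨A, B, fun k => D (f k), h1, h2, h3, h4, h5, h6, h7, fun i => h8 (f i),
    fun i j hij => h9 _ _ (fun h => hij (f.injective h))⟩

/-- Extending a rooted minor of a smaller piece `F` by disjoint connected sets at its ends. -/
theorem extend {F A' B' : Set V} {p q : V} (h : RootedMinor G ι F p q) (hF : F ⊆ C)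
    (hA' : A' ⊆ insert u C) (hB' : B' ⊆ insert v C) (hu : u ∈ A') (hp : p ∈ A') (hv : v ∈ B')
    (hq : q ∈ B') (cA' : Conn G A') (cB' : Conn G B') (hAB : Disjoint A' B')
    (hAF : Disjoint A' F) (hBF : Disjoint B' F) : RootedMinor G ι C u v := by
  obtain ⟨A, B, D, h1, h2, h3, h4, h5, h6, h7, h8, h9⟩ := h
  have hAB' : Disjoint A' B := Set.disjoint_left.2 fun x hx hx' => by
    rcases h2 hx' with rfl | h
    · exact Set.disjoint_left.1 hAB hx hq
    · exact Set.disjoint_left.1 hAF hx h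
  have hBA' : Disjoint A B' := Set.disjoint_left.2 fun x hx hx' => by
    rcases h1 hx with rfl | h
    · exact Set.disjoint_left.1 hAB hp hx'
    · exact Set.disjoint_left.1 hBF hx' h
  refine ⟨A' ∪ A, B' ∪ B, D, Set.union_subset hA' ?_, Set.union_subset hB' ?_, Or.inl hu,
    Or.inl hv, cA'.union h5 ⟨p, hp, h3⟩, cB'.union h6 ⟨q, hq, h4⟩, ?_, ?_, h9⟩
  · intro x hx
    rcases h1 hx with rfl | h
    · exact hA' hp
    · exact Or.inr (hF h)
  · intro x hx
    rcases h2 hx with rfl | h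
    · exact hB' hq
    · exact Or.inr (hF h)
  · rw [Set.disjoint_union_left, Set.disjoint_union_right, Set.disjoint_union_right]
    exact ⟨⟨hAB, hAB'⟩, ⟨hBA', h7⟩⟩
  · intro i
    obtain ⟨a1, a2, a3, a4, ⟨x, hx, y, hy, hxy⟩, ⟨x', hx', y', hy', hxy'⟩⟩ := h8 i
    exact ⟨a1.trans hF, a2, Set.disjoint_union_right.2 ⟨(hAF.mono_right a1).symm, a3⟩,
      Set.disjoint_union_right.2 ⟨(hBF.mono_right a1).symm, a4⟩, ⟨x, hx, y, Or.inr hy, hxy⟩,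
      ⟨x', hx', y', Or.inr hy', hxy'⟩⟩

/-- As `extend`, with one more set adjacent to both hubs. -/
theorem extend_option {F A' B' D' : Set V} {p q : V} (h : RootedMinor G ι F p q) (hF : F ⊆ C)
    (hA' : A' ⊆ insert u C) (hB' : B' ⊆ insert v C) (hu : u ∈ A') (hp : p ∈ A') (hv : v ∈ B')
    (hq : q ∈ B') (cA' : Conn G A') (cB' : Conn G B') (hAB : Disjoint A' B')
    (hAF : Disjoint A' F) (hBF : Disjoint B' F) (hD' : D' ⊆ C) (cD' : Conn G D')
    (hDA : Disjoint D' A') (hDB : Disjoint D' B') (hDF : Disjoint D' F)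
    (adjA : ∃ x ∈ D', ∃ y ∈ A', G.Adj x y) (adjB : ∃ x ∈ D', ∃ y ∈ B', G.Adj x y) :
    RootedMinor G (Option ι) C u v := by
  obtain ⟨A, B, D, h1, h2, h3, h4, h5, h6, h7, h8, h9⟩ := h
  have hAB' : Disjoint A' B := Set.disjoint_left.2 fun x hx hx' => by
    rcases h2 hx' with rfl | h
    · exact Set.disjoint_left.1 hAB hx hq
    · exact Set.disjoint_left.1 hAF hx h
  have hBA' : Disjoint A B' := Set.disjoint_left.2 fun x hx hx' => by
    rcases h1 hx with rfl | h
    · exact Set.disjoint_left.1 hAB hp hx'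
    · exact Set.disjoint_left.1 hBF hx' h
  refine ⟨A' ∪ A, B' ∪ B, fun o => o.elim D' D, Set.union_subset hA' ?_,
    Set.union_subset hB' ?_, Or.inl hu,
    Or.inl hv, cA'.union h5 ⟨p, hp, h3⟩, cB'.union h6 ⟨q, hq, h4⟩, ?_, ?_, ?_⟩
  · intro x hx
    rcases h1 hx with rfl | h
    · exact hA' hp
    · exact Or.inr (hF h)
  · intro x hx
    rcases h2 hx with rfl | h
    · exact hB' hq
    · exact Or.inr (hF h)
  · rw [Set.disjoint_union_left, Set.disjoint_union_right, Set.disjoint_union_right]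
    exact ⟨⟨hAB, hAB'⟩, ⟨hBA', h7⟩⟩
  · rintro (_ | i)
    · obtain ⟨x, hx, y, hy, hxy⟩ := adjA
      obtain ⟨x', hx', y', hy', hxy'⟩ := adjB
      refine ⟨hD', cD', Set.disjoint_union_right.2 ⟨hDA, ?_⟩,
        Set.disjoint_union_right.2 ⟨hDB, ?_⟩, ⟨x, hx, y, Or.inl hy, hxy⟩,
        ⟨x', hx', y', Or.inl hy', hxy'⟩⟩
      · refine Set.disjoint_left.2 fun x hx hx' => ?_
        rcases h1 hx' with rfl | h
        · exact Set.disjoint_left.1 hDA hx hp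
        · exact Set.disjoint_left.1 hDF hx h
      · refine Set.disjoint_left.2 fun x hx hx' => ?_
        rcases h2 hx' with rfl | h
        · exact Set.disjoint_left.1 hDB hx hq
        · exact Set.disjoint_left.1 hDF hx h
    · obtain ⟨a1, a2, a3, a4, ⟨x, hx, y, hy, hxy⟩, ⟨x', hx', y', hy', hxy'⟩⟩ := h8 i
      exact ⟨a1.trans hF, a2, Set.disjoint_union_right.2 ⟨(hAF.mono_right a1).symm, a3⟩,
        Set.disjoint_union_right.2 ⟨(hBF.mono_right a1).symm, a4⟩, ⟨x, hx, y, Or.inr hy, hxy⟩,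
        ⟨x', hx', y', Or.inr hy', hxy'⟩⟩
  · rintro (_ | i) (_ | j) hij
    · exact absurd rfl hij
    · exact hDF.mono_right (h8 j).1
    · exact (hDF.mono_right (h8 i).1).symm
    · exact h9 i j (fun h => hij (by rw [h]))

theorem of_region (h : Region G C u v) (h1 : No1Sep G) : RootedMinor G Unit C u v := by
  obtain ⟨D, hDC, cD, ⟨x, hx, hxu⟩, ⟨y, hy, hyv⟩⟩ := h.exists_conn h1
  refine ⟨{u}, {v}, fun _ => D, by simp, by simp, rfl, rfl, conn_singleton u, conn_singleton v,
    by simpa using h.ne, fun _ => ⟨hDC, cD, ?_, ?_, ⟨x, hx, u, rfl, hxu⟩, ⟨y, hy, v, rfl, hyv⟩⟩,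
    fun i j hij => absurd rfl hij⟩
  · exact Set.disjoint_singleton_right.2 fun h' => h.left_notMem (hDC h')
  · exact Set.disjoint_singleton_right.2 fun h' => h.right_notMem (hDC h')

/-- A connected set in `C₂` joining `u` to `v` is one further leaf. -/
theorem parallel (h : RootedMinor G ι C₁ u v) (hC₂ : Region G C₂ u v) (h1 : No1Sep G)
    (hu : u ∉ C₁) (hv : v ∉ C₁) (hdisj : Disjoint C₁ C₂) (hC1 : C₁ ⊆ C) (hC2 : C₂ ⊆ C) :
    RootedMinor G (Option ι) C u v := by
  obtain ⟨D, hDC, cD, ⟨x, hx, hxu⟩, ⟨y, hy, hyv⟩⟩ := hC₂.exists_conn h1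
  exact h.extend_option hC1 (A' := {u}) (B' := {v}) (by simp) (by simp) rfl rfl rfl rfl
    (conn_singleton u) (conn_singleton v) (by simpa using hC₂.ne)
    (Set.disjoint_singleton_left.2 hu) (Set.disjoint_singleton_left.2 hv) (hDC.trans hC2) cD
    (Set.disjoint_singleton_right.2 fun h' => hC₂.left_notMem (hDC h'))
    (Set.disjoint_singleton_right.2 fun h' => hC₂.right_notMem (hDC h'))
    (hdisj.mono_right hDC).symm ⟨x, hx, u, rfl, hxu⟩ ⟨y, hy, v, rfl, hyv⟩

/-- Rooted minors on disjoint pieces with common ends give a `K_{2,n}`-minor. -/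
theorem hasMinor {n : ℕ} (h : RootedMinor G ι C₁ u v) (h' : RootedMinor G κ C₂ u v)
    (hne : u ≠ v) (hu : u ∉ C₁ ∧ u ∉ C₂) (hv : v ∉ C₁ ∧ v ∉ C₂) (hdisj : Disjoint C₁ C₂)
    (f : Fin n ↪ ι ⊕ κ) : HasMinor G (completeBip 2 n) := by
  obtain ⟨A, B, D, h1, h2, h3, h4, h5, h6, h7, h8, h9⟩ := h
  obtain ⟨A', B', D', h1', h2', h3', h4', h5', h6', h7', h8', h9'⟩ := h'
  -- Branch sets from different sides can meet only in a common end, which happens just for the two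
  -- halves of a hub.
  have key : ∀ {a b : V} {S T : Set V}, S ⊆ insert a C₁ → T ⊆ insert b C₂ → a ∉ C₂ → b ∉ C₁ →
      (a = b → a ∉ S ∨ b ∉ T) → Disjoint S T := by
    intro a b S T hS hT ha hb hab
    refine Set.disjoint_left.2 fun x hx hx' => ?_
    rcases hS hx with rfl | h <;> rcases hT hx' with rfl | h'
    · exact (hab rfl).elim (fun h => h hx) (fun h => h hx')
    · exact ha h'
    · exact hb h
    · exact Set.disjoint_left.1 hdisj h h'
  let hub : Fin 2 → Set V := fun i => if i = 0 then A ∪ A' else B ∪ B'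
  let leaf : ι ⊕ κ → Set V := Sum.elim D D'
  have hleaf : ∀ j, Conn G (leaf j) ∧ Disjoint (leaf j) (A ∪ A') ∧ Disjoint (leaf j) (B ∪ B') ∧
      (∃ x ∈ leaf j, ∃ y ∈ A ∪ A', G.Adj x y) ∧ ∃ x ∈ leaf j, ∃ y ∈ B ∪ B', G.Adj x y := by
    rintro (j | j)
    · obtain ⟨a1, a2, a3, a4, ⟨x, hx, y, hy, hxy⟩, ⟨x', hx', y', hy', hxy'⟩⟩ := h8 j
      refine ⟨a2, Set.disjoint_union_right.2 ⟨a3, ?_⟩, Set.disjoint_union_right.2 ⟨a4, ?_⟩,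
        ⟨x, hx, y, Or.inl hy, hxy⟩, ⟨x', hx', y', Or.inl hy', hxy'⟩⟩
      · exact key (a1.trans (Set.subset_insert u _)) h1' hu.2 hu.1
          (fun _ => Or.inl fun h => hu.1 (a1 h))
      · exact key (a1.trans (Set.subset_insert v _)) h2' hv.2 hv.1
          (fun _ => Or.inl fun h => hv.1 (a1 h))
    · obtain ⟨a1, a2, a3, a4, ⟨x, hx, y, hy, hxy⟩, ⟨x', hx', y', hy', hxy'⟩⟩ := h8' j
      refine ⟨a2, Set.disjoint_union_right.2 ⟨?_, a3⟩, Set.disjoint_union_right.2 ⟨?_, a4⟩,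
        ⟨x, hx, y, Or.inr hy, hxy⟩, ⟨x', hx', y', Or.inr hy', hxy'⟩⟩
      · exact (key h1 (a1.trans (Set.subset_insert u _)) hu.2 hu.1
          (fun _ => Or.inr fun h => hu.2 (a1 h))).symm
      · exact (key h2 (a1.trans (Set.subset_insert v _)) hv.2 hv.1
          (fun _ => Or.inr fun h => hv.2 (a1 h))).symm
  have hhub : Disjoint (A ∪ A') (B ∪ B') := by
    rw [Set.disjoint_union_left, Set.disjoint_union_right, Set.disjoint_union_right]
    exact ⟨⟨h7, key h1 h2' hu.2 hv.1 fun h => absurd h hne⟩,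
      ⟨(key h2 h1' hv.2 hu.1 fun h => absurd h.symm hne).symm, h7'⟩⟩
  have hleaves : ∀ i j, i ≠ j → Disjoint (leaf i) (leaf j) := by
    rintro (i | i) (j | j) hij
    · exact h9 i j (fun h => hij (by rw [h]))
    · exact hdisj.mono (h8 i).1 (h8' j).1
    · exact (hdisj.mono (h8 j).1 (h8' i).1).symm
    · exact h9' i j (fun h => hij (by rw [h]))
  have hub_leaf : ∀ i j, Disjoint (leaf j) (hub i) ∧ ∃ x ∈ leaf j, ∃ y ∈ hub i, G.Adj x y := by
    intro i j
    obtain ⟨-, b1, b2, b3, b4⟩ := hleaf j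
    by_cases hi : i = 0
    · simp only [hub, if_pos hi]; exact ⟨b1, b3⟩
    · simp only [hub, if_neg hi]; exact ⟨b2, b4⟩
  refine ⟨Sum.elim hub (fun j => leaf (f j)), ?_, ?_, ?_⟩
  · rintro (i | j)
    · show Conn G (hub i)
      by_cases hi : i = 0
      · simp only [hub, if_pos hi]; exact h5.union h5' ⟨u, h3, h3'⟩
      · simp only [hub, if_neg hi]; exact h6.union h6' ⟨v, h4, h4'⟩
    · exact (hleaf (f j)).1
  · rintro (i | i) (j | j) hij
    · show Disjoint (hub i) (hub j)
      have hij' : i ≠ j := fun h => hij (by rw [h])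
      by_cases hi : i = 0
      · have hj : j ≠ 0 := fun h => hij' (hi.trans h.symm)
        simp only [hub, if_pos hi, if_neg hj]; exact hhub
      · have hj : j = 0 := by omega
        simp only [hub, if_pos hj, if_neg hi]; exact hhub.symm
    · exact (hub_leaf i (f j)).1.symm
    · exact (hub_leaf j (f i)).1
    · exact hleaves _ _ (fun h => hij (by rw [f.injective h]))
  · rintro (i | i) (j | j) hij
    · simp at hij
    · obtain ⟨x, hx, y, hy, hxy⟩ := (hub_leaf i (f j)).2
      exact ⟨y, hy, x, hx, hxy.symm⟩
    · exact (hub_leaf j (f i)).2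
    · simp at hij

end RootedMinor

/-- The edges of the piece `C` with ends `u` and `v`, including an edge `uv`. -/
def fullEdges (G : SimpleGraph V) (C : Set V) (u v a b : V) : Prop :=
  G.Adj a b ∧ a ∈ C ∪ {u, v} ∧ b ∈ C ∪ {u, v}

/-- The edges of the piece `C` with ends `u` and `v`, excluding an edge `uv`. -/
def pieceEdges (G : SimpleGraph V) (C : Set V) (u v a b : V) : Prop :=
  fullEdges G C u v a b ∧ ¬ (a = u ∧ b = v) ∧ ¬ (a = v ∧ b = u)

/-- The piece `C` has a strip decomposition. -/
def HasStrip (𝒢 : GraphClass.{u}) (L : ℕ) (G : SimpleGraph V) (C : Set V) (u v : V) : Prop :=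
  Nonempty (Strip 𝒢 L (C ∪ {u, v}) (pieceEdges G C u v) u v)

variable {𝒢 : GraphClass.{u}} {L : ℕ}

theorem fullEdges_iff {a b : V} : fullEdges G C u v a b ↔ pieceEdges G C u v a b ∨
    (G.Adj u v ∧ ((a = u ∧ b = v) ∨ (a = v ∧ b = u))) := by
  constructor
  · intro h
    by_cases h1 : (a = u ∧ b = v) ∨ (a = v ∧ b = u)
    · refine Or.inr ⟨?_, h1⟩
      rcases h1 with ⟨rfl, rfl⟩ | ⟨rfl, rfl⟩
      exacts [h.1, h.1.symm]
    · exact Or.inl ⟨h, fun h' => h1 (Or.inl h'), fun h' => h1 (Or.inr h')⟩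
  · rintro (h | ⟨h, ⟨rfl, rfl⟩ | ⟨rfl, rfl⟩⟩)
    · exact h.1
    · exact ⟨h, by simp, by simp⟩
    · exact ⟨h.symm, by simp, by simp⟩

/-- An edge `uv` is added as the outermost chord `(0, m)`, which crosses no other chord. -/
theorem HasStrip.full (h : HasStrip 𝒢 L G C u v) :
    Nonempty (Strip 𝒢 L (C ∪ {u, v}) (fullEdges G C u v) u v) := by
  obtain ⟨S⟩ := h
  by_cases huv : G.Adj u v
  · exact ⟨S.chord (fun h => h.2.1 ⟨rfl, rfl⟩) fun a b => by rw [fullEdges_iff]; simp [huv]⟩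
  · have : fullEdges G C u v = pieceEdges G C u v := by
      ext a b
      rw [fullEdges_iff]
      simp [huv]
    rw [this]
    exact ⟨S⟩

theorem HasStrip.fill (h : HasStrip 𝒢 L G C u v) (h𝒢 : ∀ W G, ClassP.{u} W G → 𝒢 W G) :
    Fill 𝒢 (L + 1) (C ∪ {u, v}) (pieceEdges G C u v) u v :=
  h.some.fill_succ h𝒢

theorem HasStrip.fill_full (h : HasStrip 𝒢 L G C u v) (h𝒢 : ∀ W G, ClassP.{u} W G → 𝒢 W G) :
    Fill 𝒢 (L + 1) (C ∪ {u, v}) (fullEdges G C u v) u v :=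
  h.full.some.fill_succ h𝒢

/-- The vertex `c` separates the ends `u` and `v` in the piece `C`. -/
structure SeriesSplit (G : SimpleGraph V) (C : Set V) (u v c : V) (C₁ C₂ : Set V) : Prop where
  mem_iff : ∀ x, x ∈ C ↔ x ∈ C₁ ∨ x = c ∨ x ∈ C₂
  left_notMem : c ∉ C₁
  right_notMem : c ∉ C₂
  disjoint : Disjoint C₁ C₂
  not_adj : ∀ x ∈ C₁, ∀ y ∈ C₂, ¬ G.Adj x y
  not_adj_left : ∀ x ∈ C₁, ¬ G.Adj x v
  not_adj_right : ∀ x ∈ C₂, ¬ G.Adj x u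

/-- The piece `C` is the disjoint union of two pieces. -/
structure ParallelSplit (G : SimpleGraph V) (C C₁ C₂ : Set V) : Prop where
  eq_union : C = C₁ ∪ C₂
  nonempty_left : C₁.Nonempty
  nonempty_right : C₂.Nonempty
  disjoint : Disjoint C₁ C₂
  not_adj : ∀ x ∈ C₁, ∀ y ∈ C₂, ¬ G.Adj x y

namespace SeriesSplit

theorem swap (h : SeriesSplit G C u v c C₁ C₂) : SeriesSplit G C v u c C₂ C₁ :=
  ⟨fun x => (h.mem_iff x).trans (by tauto), h.right_notMem, h.left_notMem, h.disjoint.symm,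
    fun x hx y hy hxy => h.not_adj y hy x hx hxy.symm, h.not_adj_right, h.not_adj_left⟩

theorem mem (h : SeriesSplit G C u v c C₁ C₂) : c ∈ C := (h.mem_iff c).2 (Or.inr (Or.inl rfl))

theorem left_subset (h : SeriesSplit G C u v c C₁ C₂) : C₁ ⊆ C :=
  fun x hx => (h.mem_iff x).2 (Or.inl hx)

theorem right_subset (h : SeriesSplit G C u v c C₁ C₂) : C₂ ⊆ C :=
  fun x hx => (h.mem_iff x).2 (Or.inr (Or.inr hx))

/-- A neighbour of `u` in `C` lies in `C₁` or is `c`. If `C₁` is empty, this part of the series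
composition is the edge `uc`. -/
theorem left (h : SeriesSplit G C u v c C₁ C₂) (hC : Region G C u v) (h1 : No1Sep G) :
    (C₁ = ∅ ∧ G.Adj u c) ∨ Region G C₁ u c := by
  rcases C₁.eq_empty_or_nonempty with h0 | h0
  · refine Or.inl ⟨h0, ?_⟩
    obtain ⟨a, ha, hau⟩ := hC.adj_left h1
    rcases (h.mem_iff a).1 ha with h' | rfl | h'
    · rw [h0] at h'; exact h'.elim
    · exact hau.symm
    · exact absurd hau (h.not_adj_right a h')
  · refine Or.inr ⟨h0, fun huc => hC.left_notMem (huc ▸ h.mem),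
      fun hu => hC.left_notMem (h.left_subset hu), h.left_notMem, ?_,
      ⟨v, fun hv => hC.right_notMem (h.left_subset hv), hC.ne.symm,
        fun hvc => hC.right_notMem (hvc ▸ h.mem)⟩⟩
    intro x hx y hxy
    rcases hC.closed x (h.left_subset hx) y hxy with hy | rfl | rfl
    · rcases (h.mem_iff y).1 hy with hy | hy | hy
      · exact Or.inl hy
      · exact Or.inr (Or.inr hy)
      · exact absurd hxy (h.not_adj x hx y hy)
    · exact Or.inr (Or.inl rfl)
    · exact absurd hxy (h.not_adj_left x hx)

theorem right (h : SeriesSplit G C u v c C₁ C₂) (hC : Region G C u v) (h1 : No1Sep G) :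
    (C₂ = ∅ ∧ G.Adj v c) ∨ Region G C₂ c v :=
  (h.swap.left hC.swap h1).imp id Region.swap

/-- The hub at `c` is prolonged to `v` through the other part. The number of leaves does not grow,
so series splits cost no level. -/
theorem rootedMinor_left {ι : Type} (h : SeriesSplit G C u v c C₁ C₂) (hC : Region G C u v)
    (h1 : No1Sep G) (hm : RootedMinor G ι C₁ u c) : RootedMinor G ι C u v := by
  have hB : ∃ B ⊆ insert v (insert c C₂), Conn G B ∧ c ∈ B ∧ v ∈ B := by
    rcases h.right hC h1 with ⟨-, hvc⟩ | hR
    · exact ⟨{v} ∪ {c}, by intro x hx; simp at hx ⊢; tauto,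
        (conn_singleton v).union_adj (conn_singleton c) rfl rfl hvc, Or.inr rfl, Or.inl rfl⟩
    · obtain ⟨D, hDC, cD, ⟨x, hx, hxc⟩, ⟨y, hy, hyv⟩⟩ := hR.exists_conn h1
      refine ⟨D ∪ {c} ∪ {v}, ?_, (cD.union_adj (conn_singleton c) hx rfl hxc).union_adj
        (conn_singleton v) (Or.inl hy) rfl hyv, Or.inl (Or.inr rfl), Or.inr rfl⟩
      rintro z ((hz | hz) | hz)
      · exact Or.inr (Or.inr (hDC hz))
      · exact Or.inr (Or.inl hz)
      · exact Or.inl hz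
  obtain ⟨B, hB, cB, hcB, hvB⟩ := hB
  refine hm.extend h.left_subset (A' := {u}) (B' := B) (by simp) ?_ rfl rfl hvB hcB
    (conn_singleton u) cB ?_ ?_ ?_
  · intro x hx
    rcases hB hx with rfl | rfl | hx
    · exact Or.inl rfl
    · exact Or.inr h.mem
    · exact Or.inr (h.right_subset hx)
  · rw [Set.disjoint_singleton_left]
    intro hu
    rcases hB hu with h' | h' | h'
    · exact hC.ne h'
    · exact hC.left_notMem (h' ▸ h.mem)
    · exact hC.left_notMem (h.right_subset h')
  · rw [Set.disjoint_singleton_left]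
    exact fun h' => hC.left_notMem (h.left_subset h')
  · refine Set.disjoint_left.2 fun x hx hx' => ?_
    rcases hB hx with rfl | rfl | hx
    · exact hC.right_notMem (h.left_subset hx')
    · exact h.left_notMem hx'
    · exact Set.disjoint_left.1 h.disjoint hx' hx

theorem rootedMinor_right {ι : Type} (h : SeriesSplit G C u v c C₁ C₂) (hC : Region G C u v)
    (h1 : No1Sep G) (hm : RootedMinor G ι C₂ c v) : RootedMinor G ι C u v :=
  (h.swap.rootedMinor_left hC.swap h1 hm.swap).swap

/-- Series composition of strip decompositions of the two parts. -/
theorem hasStrip (h : SeriesSplit G C u v c C₁ C₂) (hC : Region G C u v) (h1 : No1Sep G)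
    (hS₁ : Region G C₁ u c → HasStrip 𝒢 L G C₁ u c)
    (hS₂ : Region G C₂ c v → HasStrip 𝒢 L G C₂ c v) : HasStrip 𝒢 L G C u v := by
  have huc : u ≠ c := fun h' => hC.left_notMem (h' ▸ h.mem)
  have hcv : c ≠ v := fun h' => hC.right_notMem (h' ▸ h.mem)
  have single : ∀ {a b : V}, G.Adj a b →
      Nonempty (Strip 𝒢 L ((∅ : Set V) ∪ {a, b}) (fullEdges G ∅ a b) a b) := by
    intro a b hab
    refine ⟨Strip.edge hab.ne (fun x => by simp) fun p q => ?_⟩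
    simp only [fullEdges, Set.empty_union, Set.mem_insert_iff, Set.mem_singleton_iff]
    constructor
    · rintro ⟨hpq, rfl | rfl, rfl | rfl⟩
      exacts [absurd rfl hpq.ne, Or.inl ⟨rfl, rfl⟩, Or.inr ⟨rfl, rfl⟩, absurd rfl hpq.ne]
    · rintro (⟨rfl, rfl⟩ | ⟨rfl, rfl⟩)
      · exact ⟨hab, Or.inl rfl, Or.inr rfl⟩
      · exact ⟨hab.symm, Or.inr rfl, Or.inl rfl⟩
  have T₁ : Nonempty (Strip 𝒢 L (C₁ ∪ {u, c}) (fullEdges G C₁ u c) u c) := by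
    rcases h.left hC h1 with ⟨h0, h'⟩ | hR
    · rw [h0]; exact single h'
    · exact (hS₁ hR).full
  have T₂ : Nonempty (Strip 𝒢 L (C₂ ∪ {c, v}) (fullEdges G C₂ c v) c v) := by
    rcases h.right hC h1 with ⟨h0, h'⟩ | hR
    · rw [h0]; exact single h'.symm
    · exact (hS₂ hR).full
  refine T₁.some.concat T₂.some ?_ ?_ ?_
  · intro x
    simp only [Set.mem_union, Set.mem_insert_iff, Set.mem_singleton_iff, h.mem_iff]
    tauto
  · rintro x (hx | rfl | hx) (hx' | hx' | hx')
    · exact absurd hx' (Set.disjoint_left.1 h.disjoint hx)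
    · exact hx'
    · exact absurd (h.left_subset hx) (hx' ▸ hC.right_notMem)
    · exact absurd (h.right_subset hx') hC.left_notMem
    · exact hx'
    · exact absurd hx' hC.ne
    · exact hx
    · exact hx
    · exact hx
  · intro a b
    have two : ∀ a b, G.Adj a b → a ∈ C₁ → b ∈ C ∪ {u, v} → b ∈ C₁ ∪ {u, c} := by
      intro a b hab ha hb
      rcases hb with hb | rfl | rfl
      · rcases (h.mem_iff b).1 hb with hb | hb | hb
        · exact Or.inl hb
        · exact Or.inr (Or.inr hb)
        · exact absurd hab (h.not_adj a ha b hb)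
      · exact Or.inr (Or.inl rfl)
      · exact absurd hab (h.not_adj_left a ha)
    have two' : ∀ a b, G.Adj a b → a ∈ C₂ → b ∈ C ∪ {u, v} → b ∈ C₂ ∪ {c, v} := by
      intro a b hab ha hb
      rcases hb with hb | rfl | rfl
      · rcases (h.mem_iff b).1 hb with hb | hb | hb
        · exact absurd hab.symm (h.not_adj b hb a ha)
        · exact Or.inr (Or.inl hb)
        · exact Or.inl hb
      · exact absurd hab (h.not_adj_right a ha)
      · exact Or.inr (Or.inr rfl)
    constructor
    · rintro ⟨⟨hab, ha, hb⟩, hn1, hn2⟩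
      have cls : ∀ x, x ∈ C ∪ {u, v} → x ∈ C₁ ∨ x ∈ C₂ ∨ x = u ∨ x = c ∨ x = v := by
        intro x hx
        rcases hx with hx | rfl | rfl
        · rcases (h.mem_iff x).1 hx with hx | hx | hx <;> tauto
        · tauto
        · tauto
      rcases cls a ha with ha' | ha' | ha'
      · exact Or.inl ⟨hab, Or.inl ha', two a b hab ha' hb⟩
      · exact Or.inr ⟨hab, Or.inl ha', two' a b hab ha' hb⟩
      rcases cls b hb with hb' | hb' | hb'
      · exact Or.inl ⟨hab, two b a hab.symm hb' ha, Or.inl hb'⟩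
      · exact Or.inr ⟨hab, two' b a hab.symm hb' ha, Or.inl hb'⟩
      rcases ha' with rfl | rfl | rfl <;> rcases hb' with rfl | rfl | rfl <;>
        first | exact absurd rfl hab.ne | skip
      · exact Or.inl ⟨hab, by simp, by simp⟩
      · exact absurd ⟨rfl, rfl⟩ hn1
      · exact Or.inl ⟨hab, by simp, by simp⟩
      · exact Or.inr ⟨hab, by simp, by simp⟩
      · exact absurd ⟨rfl, rfl⟩ hn2
      · exact Or.inr ⟨hab, by simp, by simp⟩
    · rintro (⟨hab, ha, hb⟩ | ⟨hab, ha, hb⟩)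
      · have hsub : ∀ x ∈ C₁ ∪ {u, c}, x ∈ C ∪ {u, v} ∧ x ≠ v := by
          rintro x (hx | rfl | rfl)
          · exact ⟨Or.inl (h.left_subset hx), fun h' => hC.right_notMem (h' ▸ h.left_subset hx)⟩
          · exact ⟨by simp, hC.ne⟩
          · exact ⟨Or.inl h.mem, hcv⟩
        exact ⟨⟨hab, (hsub a ha).1, (hsub b hb).1⟩, fun h' => (hsub b hb).2 h'.2,
          fun h' => (hsub a ha).2 h'.1⟩
      · have hsub : ∀ x ∈ C₂ ∪ {c, v}, x ∈ C ∪ {u, v} ∧ x ≠ u := by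
          rintro x (hx | rfl | rfl)
          · exact ⟨Or.inl (h.right_subset hx), fun h' => hC.left_notMem (h' ▸ h.right_subset hx)⟩
          · exact ⟨Or.inl h.mem, huc.symm⟩
          · exact ⟨by simp, hC.ne.symm⟩
        exact ⟨⟨hab, (hsub a ha).1, (hsub b hb).1⟩, fun h' => (hsub a ha).2 h'.1,
          fun h' => (hsub b hb).2 h'.2⟩

end SeriesSplit

namespace ParallelSplit

theorem swap (h : ParallelSplit G C C₁ C₂) : ParallelSplit G C C₂ C₁ :=
  ⟨h.eq_union.trans (Set.union_comm _ _), h.nonempty_right, h.nonempty_left, h.disjoint.symm,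
    fun x hx y hy hxy => h.not_adj y hy x hx hxy.symm⟩

theorem left_subset (h : ParallelSplit G C C₁ C₂) : C₁ ⊆ C := h.eq_union ▸ Set.subset_union_left

theorem ssubset (h : ParallelSplit G C C₁ C₂) : C₁ ⊂ C := by
  refine ⟨h.left_subset, fun hsub => ?_⟩
  obtain ⟨x, hx⟩ := h.nonempty_right
  exact Set.disjoint_left.1 h.disjoint (hsub (h.swap.left_subset hx)) hx

theorem left (h : ParallelSplit G C C₁ C₂) (hC : Region G C u v) : Region G C₁ u v := by
  obtain ⟨o, h1, h2⟩ := hC.outside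
  refine ⟨h.nonempty_left, hC.ne, fun h' => hC.left_notMem (h.left_subset h'),
    fun h' => hC.right_notMem (h.left_subset h'), fun x hx y hxy => ?_,
    ⟨o, fun h' => h1 (h.left_subset h'), h2⟩⟩
  refine (hC.closed x (h.left_subset hx) y hxy).imp (fun hy => ?_) id
  rw [h.eq_union] at hy
  exact hy.resolve_right fun hy => h.not_adj x hx y hy hxy

theorem rootedMinor {ι : Type} (h : ParallelSplit G C C₁ C₂) (hC : Region G C u v)
    (h1 : No1Sep G) (hm : RootedMinor G ι C₁ u v) : RootedMinor G (Option ι) C u v :=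
  hm.parallel (h.swap.left hC) h1 (h.left hC).left_notMem (h.left hC).right_notMem h.disjoint
    h.left_subset h.swap.left_subset

end ParallelSplit

end Regions

/-! ### Minors through frames, and the base class. -/

/-- Transitivity of the minor relation: a branch set of `K` in `G` is the union of the sets `B w`
over its branch set in `N`. -/
theorem HasMinor.of_branch {V W U : Type*} {G : SimpleGraph V} {N : SimpleGraph W}
    {K : SimpleGraph U} (B : W → Set V) (hconn : ∀ a, Conn G (B a))
    (hdisj : ∀ a b, a ≠ b → Disjoint (B a) (B b))
    (hadj : ∀ a b, N.Adj a b → ∃ x ∈ B a, ∃ y ∈ B b, G.Adj x y) (h : HasMinor N K) :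
    HasMinor G K := by
  obtain ⟨S, hS, hSd, hSa⟩ := h
  refine ⟨fun k => ⋃ w ∈ S k, B w, fun k => ?_, fun k l hkl => ?_, fun k l hkl => ?_⟩
  · have hSk : Conn N (S k) := hS k
    obtain ⟨w, hw⟩ := hSk.nonempty
    obtain ⟨x, hx⟩ := (hconn w).nonempty
    refine conn_of_base (x := x) (Set.mem_biUnion hw hx) fun T hT hxT hc => ?_
    have hall : ∀ a ∈ S k, ∀ y ∈ T, y ∈ B a → B a ⊆ T := fun a ha y hyT hya =>
      (hconn a).subset' hya hyT fun p hp _ q hq hpq => hc p hp q (Set.mem_biUnion ha hq) hpq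
    have hsub : S k ⊆ {a | B a ⊆ T} := by
      refine hSk.subset' hw (hall w hw x hxT hx) fun a ha hak b hb hab => ?_
      obtain ⟨p, hp, q, hq, hpq⟩ := hadj a b hab
      exact hall b hb q (hc p (ha hp) q (Set.mem_biUnion hb hq) hpq) hq
    exact Set.iUnion₂_subset hsub
  · simp only [Set.disjoint_iUnion_left, Set.disjoint_iUnion_right]
    exact fun a ha b hb => hdisj _ _ fun hab => Set.disjoint_left.1 (hSd k l hkl) hb (hab ▸ ha)
  · obtain ⟨a, ha, b, hb, hab⟩ := hSa k l hkl
    obtain ⟨x, hx, y, hy, hxy⟩ := hadj a b hab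
    exact ⟨x, Set.mem_biUnion ha hx, y, Set.mem_biUnion hb hy, hxy⟩

/-- If the marked vertices of a frame correspond to regions of a 2-connected graph, then the graph
of the frame is a minor. -/
theorem Frame.hasMinor {V ι : Type u} {U : Type*} {G : SimpleGraph V} {K : SimpleGraph U}
    (F : Frame V ι) (h1 : No1Sep G) (R : ι → Set V)
    (hR : ∀ i, Region G (R i) (F.φ (F.s i)) (F.φ (F.t i)))
    (hdisj : ∀ i j, i ≠ j → Disjoint (R i) (R j)) (hverts : ∀ i, Disjoint (R i) F.verts)
    (hE : ∀ a b, F.edges a b → G.Adj a b) (h : HasMinor F.N K) : HasMinor G K := by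
  choose D hDR cD hDs hDt using fun i => (hR i).exists_conn h1
  have hB : ∀ a, ∃ B : Set V, (a ∉ Set.range F.z → B = {F.φ a}) ∧ ∀ i, a = F.z i → B = D i := by
    intro a
    by_cases ha : a ∈ Set.range F.z
    · obtain ⟨i, rfl⟩ := ha
      exact ⟨D i, fun h => absurd ⟨i, rfl⟩ h, fun j hj => by rw [F.z_injective hj]⟩
    · exact ⟨{F.φ a}, fun _ => rfl, fun i hi => absurd ⟨i, hi.symm⟩ ha⟩
  choose B hBr hBz using hB
  have hBz' : ∀ i, B (F.z i) = D i := fun i => hBz _ i rfl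
  have virt : ∀ i b, F.N.Adj (F.z i) b → ∃ x ∈ B (F.z i), ∃ y ∈ B b, G.Adj x y := by
    intro i b hib
    rcases Frame.adj_z_iff.1 hib with rfl | rfl
    · obtain ⟨x, hx, hxs⟩ := hDs i
      rw [hBz', hBr _ (Frame.s_notMem i)]
      exact ⟨x, hx, _, rfl, hxs⟩
    · obtain ⟨x, hx, hxt⟩ := hDt i
      rw [hBz', hBr _ (Frame.t_notMem i)]
      exact ⟨x, hx, _, rfl, hxt⟩
  refine HasMinor.of_branch (N := F.N) B (fun a => ?_) (fun a b hab => ?_) (fun a b hab => ?_) h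
  · by_cases ha : a ∈ Set.range F.z
    · obtain ⟨i, rfl⟩ := ha
      rw [hBz']
      exact cD i
    · rw [hBr a ha]
      exact conn_singleton _
  · have hmix : ∀ i b, b ∉ Set.range F.z → Disjoint (B (F.z i)) (B b) := fun i b hb => by
      rw [hBz', hBr b hb, Set.disjoint_singleton_right]
      exact fun h => Set.disjoint_left.1 (hverts i) (hDR i h) (Frame.mem_verts hb)
    by_cases ha : a ∈ Set.range F.z <;> by_cases hb : b ∈ Set.range F.z
    · obtain ⟨i, rfl⟩ := ha
      obtain ⟨j, rfl⟩ := hb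
      rw [hBz', hBz']
      exact (hdisj i j fun h => hab (by rw [h])).mono (hDR i) (hDR j)
    · obtain ⟨i, rfl⟩ := ha
      exact hmix i b hb
    · obtain ⟨i, rfl⟩ := hb
      exact (hmix i a ha).symm
    · rw [hBr a ha, hBr b hb, Set.disjoint_singleton]
      exact fun h => hab (F.φ_injOn ha hb h)
  · by_cases ha : a ∈ Set.range F.z
    · obtain ⟨i, rfl⟩ := ha
      exact virt i b hab
    · by_cases hb : b ∈ Set.range F.z
      · obtain ⟨i, rfl⟩ := hb
        obtain ⟨x, hx, y, hy, hxy⟩ := virt i a hab.symm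
        exact ⟨y, hy, x, hx, hxy.symm⟩
      · rw [hBr a ha, hBr b hb]
        exact ⟨_, rfl, _, rfl, hE _ _ ⟨a, ha, b, hb, hab, rfl, rfl⟩⟩

theorem isKConnected_two {V : Type*} {G : SimpleGraph V} (hcard : 2 < Nat.card V)
    (h1 : No1Sep G) : IsKConnected 2 G := by
  classical
  have hfin : Finite V := (Nat.card_pos_iff.1 (by omega)).2
  have hex : ∀ a b : V, ∃ c, c ≠ a ∧ c ≠ b := by
    intro a b
    by_contra! hcon
    have hsub : (Set.univ : Set V) ⊆ {a, b} := fun x _ => by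
      by_cases hx : x = a
      · exact Or.inl hx
      · exact Or.inr (hcon x hx)
    have h2 := Set.ncard_le_ncard hsub (Set.toFinite _)
    rw [Set.ncard_univ] at h2
    have := Set.ncard_insert_le a {b}
    rw [Set.ncard_singleton] at this
    omega
  refine ⟨hcard, fun S hS => ?_⟩
  have hS' : S.card = 0 ∨ S.card = 1 := by omega
  rcases hS' with h0 | h0
  · rw [Finset.card_eq_zero] at h0
    subst h0
    obtain ⟨x⟩ : Nonempty V := (Nat.card_pos_iff.1 (by omega)).1
    show Conn G _
    rw [Finset.coe_empty, Set.compl_empty]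
    refine conn_of_base (x := x) (Set.mem_univ x) fun T _ hxT hc => ?_
    by_contra hcon
    obtain ⟨o, -, ho⟩ := Set.not_subset.1 hcon
    -- With nothing deleted, a spare third vertex `y` serves as the cut vertex of `No1Sep`, on
    -- whichever side of `T` it lies.
    obtain ⟨y, hyx, hyo⟩ := hex x o
    by_cases hy : y ∈ T
    · obtain ⟨a, ha, b, hb, -, hab⟩ := h1 Tᶜ y x ⟨o, ho⟩ (fun h => h hy) (fun h => h hxT) hyx.symm
      exact ha (hc b (not_not.1 hb) a (Set.mem_univ _) hab.symm)
    · obtain ⟨a, ha, b, hb, -, hab⟩ := h1 T y o ⟨x, hxT⟩ hy ho hyo.symm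
      exact hb (hc a ha b (Set.mem_univ _) hab)
  · rw [Finset.card_eq_one] at h0
    obtain ⟨p, rfl⟩ := h0
    obtain ⟨x, hx, -⟩ := hex p p
    show Conn G _
    rw [Finset.coe_singleton]
    refine conn_of_base (x := x) hx fun T hT hxT hc => ?_
    by_contra hcon
    obtain ⟨o, ho, hoT⟩ := Set.not_subset.1 hcon
    obtain ⟨a, ha, b, hb, hbp, hab⟩ := h1 T p o ⟨x, hxT⟩ (fun h => hT h rfl) hoT ho
    exact hb (hc a ha b hbp hab)

theorem ClassP.iso {V V' : Type u} {G : SimpleGraph V} {G' : SimpleGraph V'} (h : ClassP V G)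
    (i : G ≃g G') : ClassP V' G' := by
  obtain ⟨m, e, h1, h2, h3, h4⟩ := h
  refine ⟨m, e.trans i.toEquiv, ?_⟩
  have key : ∀ a b, G'.Adj ((e.trans i.toEquiv) a) ((e.trans i.toEquiv) b) ↔
      G.Adj (e a) (e b) := fun a b => i.map_adj_iff
  simp only [key]
  exact ⟨h1, h2, h3, h4⟩

theorem classP_of_iso_cycleGraph {V : Type u} {G : SimpleGraph V} {m : ℕ} (hm : 3 ≤ m)
    (i : G ≃g SimpleGraph.cycleGraph m) : ClassP V G := by
  have key : ∀ a b, G.Adj (i.toEquiv.symm a) (i.toEquiv.symm b) ↔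
      (SimpleGraph.cycleGraph m).Adj a b := fun a b => i.symm.map_adj_iff
  refine ⟨m, i.toEquiv.symm, hm, fun a b h => (key a b).2 h, ?_, ?_⟩
  · intro a b c d c' d' h1
    exact absurd ((key a b).1 h1.1) h1.2
  · intro a b c d h1
    exact absurd ((key a b).1 h1.1) h1.2

theorem chordGraph_adj {m : ℕ} {R : ℕ → ℕ → Prop} {a b : Fin (m + 2)} :
    (chordGraph.{u} m R).Adj ⟨a⟩ ⟨b⟩ ↔ a ≠ b ∧ ((b.val = a.val + 1 ∨
    (a.val = 0 ∧ b.val = m + 1) ∨ R a.val b.val) ∨ (a.val = b.val + 1 ∨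
    (b.val = 0 ∧ a.val = m + 1) ∨ R b.val a.val)) := by
  rw [chordGraph, SimpleGraph.fromRel_adj, Ne, ULift.ext_iff]

/-- A 4-cycle with the chord `(0, 2)`; the missing edge is sent to the pair `1`, `3`. -/
theorem classP_of_iso_K4MinusEdge {V : Type u} {G : SimpleGraph V} (i : G ≃g K4MinusEdge) :
    ClassP V G := by
  let e : Fin 4 ≃ Fin 4 := ⟨![1, 3, 0, 2], ![2, 0, 3, 1], by decide, by decide⟩
  let j : K4MinusEdge ≃g chordGraph.{u} 2 (fun i j => i = 0 ∧ j = 2) :=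
    { toEquiv := e.trans Equiv.ulift.symm
      map_rel_iff' := by
        intro a b
        refine Iff.trans (chordGraph_adj (a := e a) (b := e b)) ?_
        rw [K4MinusEdge, SimpleGraph.deleteEdges_adj]
        fin_cases a <;> fin_cases b <;> simp [e] }
  refine (classP_chordGraph (by omega) ⟨?_, ?_, ?_⟩).iso (i.trans j).symm
  all_goals intros; omega

/-- A hexagon with the crossing long diagonals `(0, 3)` and `(1, 4)`; the third diagonal, `2` to
`5`, is the missing edge. -/
theorem classP_of_iso_K33MinusEdge {V : Type u} {G : SimpleGraph V} (i : G ≃g K33MinusEdge) :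
    ClassP V G := by
  let e : Fin 3 ⊕ Fin 3 ≃ Fin 6 := ⟨Sum.elim ![5, 1, 3] ![2, 0, 4],
    ![Sum.inr 1, Sum.inl 1, Sum.inr 0, Sum.inl 2, Sum.inr 2, Sum.inl 0], by decide, by decide⟩
  let j : K33MinusEdge ≃g
      chordGraph.{u} 4 (fun i j => (i = 0 ∧ j = 3) ∨ (i = 1 ∧ j = 4)) :=
    { toEquiv := e.trans Equiv.ulift.symm
      map_rel_iff' := by
        intro a b
        refine Iff.trans (chordGraph_adj (a := e a) (b := e b)) ?_
        rw [K33MinusEdge, SimpleGraph.deleteEdges_adj]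
        rcases a with a | a <;> rcases b with b | b <;> fin_cases a <;> fin_cases b <;>
          simp [e] }
  refine (classP_chordGraph (by omega) ⟨?_, ?_, ?_⟩).iso (i.trans j).symm
  all_goals intros; omega

theorem ClassC1.classP {V : Type u} {G : SimpleGraph V} (h : ClassC1 V G) : ClassP V G := by
  rcases h with ⟨⟨i⟩⟩ | ⟨⟨i⟩⟩ | ⟨⟨i⟩⟩ | ⟨⟨i⟩⟩ | ⟨⟨i⟩⟩ | ⟨⟨i⟩⟩
  · exact classP_of_iso_cycleGraph (by omega) i
  · exact classP_of_iso_cycleGraph (by omega) i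
  · exact classP_of_iso_cycleGraph (by omega) i
  · exact classP_of_iso_cycleGraph (by omega) i
  · exact classP_of_iso_K4MinusEdge i
  · exact classP_of_iso_K33MinusEdge i

/-- The base class of the decomposition. -/
abbrev BaseClass (n : ℕ) : GraphClass.{u} := unionClass ClassP (ClassD' n)

/-- The members of `ClassC1` are type-I graphs, so the exclusion in `ClassC2` loses nothing. -/
theorem baseClass_of_classC {n : ℕ} {V : Type u} {G : SimpleGraph V} (hC : ClassC V G)
    (h2 : IsKConnected 2 G) (hm : ¬ HasMinor G (completeBip 2 n)) : BaseClass n V G := by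
  by_cases h : ClassC1 V G
  · exact Or.inl h.classP
  · exact Or.inr ⟨⟨h2, hm⟩, hC, h⟩

/-! ### Parallel nodes. -/

section Parallel

variable {n : ℕ} {V : Type u} {G : SimpleGraph V} {C C₁ C₂ : Set V} {u v : V} {L : ℕ}

theorem no1Sep_completeBipartiteGraph {α β : Type*} (hα : ∃ a b : α, a ≠ b)
    (hβ : ∃ a b : β, a ≠ b) : No1Sep (completeBipartiteGraph α β) := by
  intro K p o hK hp ho hop
  by_contra! hcon
  have exα : ∀ q : α ⊕ β, ∃ a : α, Sum.inl a ≠ q := fun q => by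
    obtain ⟨a, b, hab⟩ := hα
    by_cases h : Sum.inl a = q
    · exact ⟨b, fun h' => hab (Sum.inl_injective (h.trans h'.symm))⟩
    · exact ⟨a, h⟩
  have exβ : ∀ q : α ⊕ β, ∃ a : β, Sum.inr a ≠ q := fun q => by
    obtain ⟨a, b, hab⟩ := hβ
    by_cases h : Sum.inr a = q
    · exact ⟨b, fun h' => hab (Sum.inr_injective (h.trans h'.symm))⟩
    · exact ⟨a, h⟩
  have step1 : ∀ a b, Sum.inl a ∈ K → Sum.inr b ≠ p → Sum.inr b ∈ K := fun a b ha hb =>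
    by_contra fun h => hcon _ ha _ h hb (by simp)
  have step2 : ∀ a b, Sum.inr b ∈ K → Sum.inl a ≠ p → Sum.inl a ∈ K := fun a b ha hb =>
    by_contra fun h => hcon _ ha _ h hb (by simp)
  obtain ⟨a, ha⟩ := exα p
  obtain ⟨b, hb⟩ := exβ p
  have haK : ∃ a', Sum.inl a' ∈ K := by
    obtain ⟨x | x, hx⟩ := hK
    · exact ⟨x, hx⟩
    · exact ⟨a, step2 _ _ hx ha⟩
  obtain ⟨a', ha'⟩ := haK
  have hbK := step1 _ _ ha' hb
  rcases o with o | o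
  · exact ho (step2 _ _ hbK hop)
  · exact ho (step1 _ _ ha' hop)

/-- The node is `K_{2,3}` with hubs `u` and `v`; its three other vertices are marked, for the
outside and for the two parts. Contracting in these three regions shows that it is a minor of `G`.
No part carries an edge `uv`, which is excluded from `pieceEdges`. -/
theorem ParallelSplit.fill (h : ParallelSplit G C C₁ C₂) (hC : Region G C u v)
    (hG : ClassD n V G) (hF₁ : Fill (BaseClass n) L (C₁ ∪ {u, v}) (pieceEdges G C₁ u v) u v)
    (hF₂ : Fill (BaseClass n) L (C₂ ∪ {u, v}) (pieceEdges G C₂ u v) u v) :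
    Fill (BaseClass n) (L + 1) (C ∪ {u, v}) (pieceEdges G C u v) u v := by
  have h1 := hG.1.no1Sep
  let κ : Type u := ULift.{u} Bool
  have hR₁ := h.left hC
  have hR₂ := h.swap.left hC
  have hrange : (Set.range (Sum.inr : Option κ → ULift.{u} (Fin 2) ⊕ Option κ))ᶜ =
      Set.range Sum.inl := by simp
  let φ : ULift.{u} (Fin 2) ⊕ Option κ → V :=
    Sum.elim (fun i => if i.down = 0 then u else v) fun _ => u
  have hφ : ∀ i, φ (Sum.inl i) = if i.down = 0 then u else v := fun i => rfl
  let F : Frame V (Option κ) :=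
    { W := ULift.{u} (Fin 2) ⊕ Option κ
      N := completeBipartiteGraph _ _
      φ := φ
      z := Sum.inr
      s := fun _ => Sum.inl ⟨0⟩
      t := fun _ => Sum.inl ⟨1⟩
      z_injective := Sum.inr_injective
      z_not_adj := fun i j h => by simp at h
      s_ne_t := fun _ h => by simp at h
      neighborSet_z := fun i => by
        ext (⟨a⟩ | a)
        · fin_cases a <;> simp
        · simp
      φ_injOn := by
        rw [hrange]
        rintro _ ⟨⟨a⟩, rfl⟩ _ ⟨⟨b⟩, rfl⟩ hab
        have := hC.ne
        rw [hφ, hφ] at hab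
        fin_cases a <;> fin_cases b <;> simp_all }
  have hverts : F.verts = {u, v} := by
    show φ '' (Set.range Sum.inr)ᶜ = {u, v}
    rw [hrange, ← Set.range_comp]
    ext x
    constructor
    · rintro ⟨⟨a⟩, rfl⟩
      fin_cases a
      · exact Or.inl rfl
      · exact Or.inr rfl
    · rintro (rfl | rfl)
      · exact ⟨⟨0⟩, rfl⟩
      · exact ⟨⟨1⟩, rfl⟩
  have hedges : ∀ a b, ¬ F.edges a b := by
    rintro a b ⟨p, hp, q, hq, hpq, -⟩
    rcases p with p | p
    · rcases q with q | q
      · have : ¬ (completeBipartiteGraph (ULift.{u} (Fin 2)) (Option κ)).Adj (Sum.inl p)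
          (Sum.inl q) := by simp
        exact this hpq
      · exact hq ⟨q, rfl⟩
    · exact hp ⟨p, rfl⟩
  let R : Option κ → Set V := fun o => match o with
    | none => {x | x ∉ C ∧ x ≠ u ∧ x ≠ v}
    | some ⟨true⟩ => C₁
    | some ⟨false⟩ => C₂
  have hR : ∀ i, Region G (R i) u v := by
    rintro (_ | ⟨_ | _⟩)
    exacts [hC.compl, hR₂, hR₁]
  have hmem : BaseClass n F.W F.N := by
    refine baseClass_of_classC ?_ ?_ fun hm => hG.2 (F.hasMinor h1 R hR ?_ ?_ ?_ hm)
    · refine Or.inr (Or.inr (Or.inr (Or.inr (Or.inr (Or.inl ⟨?_⟩)))))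
      exact SimpleGraph.completeBipartiteGraphCongr Equiv.ulift (Fintype.equivFinOfCardEq (by simp [κ]))
    · refine isKConnected_two ?_ (no1Sep_completeBipartiteGraph ⟨⟨0⟩, ⟨1⟩, by simp⟩
        ⟨none, some ⟨true⟩, by simp⟩)
      show 2 < Nat.card (ULift.{u} (Fin 2) ⊕ Option κ)
      simp [κ]
    · have hd1 : Disjoint (R none) C := Set.disjoint_left.2 fun x hx hx' => hx.1 hx'
      have hd2 : Disjoint (R none) C₁ := hd1.mono_right h.left_subset
      have hd3 : Disjoint (R none) C₂ := hd1.mono_right h.swap.left_subset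
      rintro (_ | ⟨_ | _⟩) (_ | ⟨_ | _⟩) hij
      exacts [absurd rfl hij, hd3, hd2, hd3.symm, absurd rfl hij, h.disjoint.symm, hd2.symm,
        h.disjoint, absurd rfl hij]
    · intro i
      rw [hverts, Set.disjoint_insert_right, Set.disjoint_singleton_right]
      exact ⟨(hR i).left_notMem, (hR i).right_notMem⟩
    · exact fun a b h => absurd h (hedges a b)
  have hends : ∀ i, F.ends i = {u, v} := fun i => rfl
  have hex : ∀ P : κ → Prop, (∃ i, P i) ↔ P ⟨false⟩ ∨ P ⟨true⟩ := by
    intro P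
    constructor
    · rintro ⟨⟨_ | _⟩, h⟩
      exacts [Or.inl h, Or.inr h]
    · rintro (h | h)
      exacts [⟨_, h⟩, ⟨_, h⟩]
  refine ⟨κ, inferInstance, F, fun i => R (some i) ∪ {u, v}, fun i => pieceEdges G (R (some i)) u v,
    hmem, rfl, rfl, ?_, ?_, ?_, ?_, ?_⟩
  · rintro ⟨_ | _⟩
    exacts [hF₂, hF₁]
  · intro i
    rw [hends, hverts]
    exact Set.inter_subset_right
  · intro i j hij
    have hd : Disjoint (R (some i)) (R (some j)) := by
      rcases i with ⟨_ | _⟩ <;> rcases j with ⟨_ | _⟩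
      exacts [absurd rfl hij, h.disjoint.symm, h.disjoint, absurd rfl hij]
    rw [hends]
    rintro x ⟨hx | hx, hx' | hx'⟩
    · exact absurd hx' (Set.disjoint_left.1 hd hx)
    · exact hx'
    · exact hx
    · exact hx
  · rw [hverts]
    ext x
    change x ∈ C ∪ {u, v} ↔ x ∈ ({u, v} : Set V) ∨ x ∈ ⋃ i : κ, R (some i) ∪ {u, v}
    rw [Set.mem_iUnion, hex, h.eq_union]
    change _ ↔ (x ∈ ({u, v} : Set V) ∨ x ∈ C₂ ∪ {u, v} ∨ x ∈ C₁ ∪ {u, v})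
    simp only [Set.mem_union]
    tauto
  · intro a b
    have hnone : ¬ F.edges a b := hedges a b
    rw [hex]
    change _ ↔ F.edges a b ∨ pieceEdges G C₂ u v a b ∨ pieceEdges G C₁ u v a b
    simp only [hnone, false_or, pieceEdges, fullEdges]
    constructor
    · rintro ⟨⟨hab, ha, hb⟩, h2, h3⟩
      have hcase : (a ∈ C₁ ∪ {u, v} ∧ b ∈ C₁ ∪ {u, v}) ∨ (a ∈ C₂ ∪ {u, v} ∧ b ∈ C₂ ∪ {u, v}) := by
        rw [h.eq_union] at ha hb
        rcases ha with (ha | ha) | ha <;> rcases hb with (hb | hb) | hb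
        · exact Or.inl ⟨Or.inl ha, Or.inl hb⟩
        · exact absurd hab (h.not_adj a ha b hb)
        · exact Or.inl ⟨Or.inl ha, Or.inr hb⟩
        · exact absurd hab.symm (h.not_adj b hb a ha)
        · exact Or.inr ⟨Or.inl ha, Or.inl hb⟩
        · exact Or.inr ⟨Or.inl ha, Or.inr hb⟩
        · exact Or.inl ⟨Or.inr ha, Or.inl hb⟩
        · exact Or.inr ⟨Or.inr ha, Or.inl hb⟩
        · exact Or.inl ⟨Or.inr ha, Or.inr hb⟩
      rcases hcase with hc | hc
      · exact Or.inr ⟨⟨hab, hc⟩, h2, h3⟩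
      · exact Or.inl ⟨⟨hab, hc⟩, h2, h3⟩
    · have hs1 : C₁ ∪ {u, v} ⊆ C ∪ {u, v} := Set.union_subset_union_left _ h.left_subset
      have hs2 : C₂ ∪ {u, v} ⊆ C ∪ {u, v} := Set.union_subset_union_left _ h.swap.left_subset
      rintro (⟨⟨hab, ha, hb⟩, h2⟩ | ⟨⟨hab, ha, hb⟩, h2⟩)
      · exact ⟨⟨hab, hs2 ha, hs2 hb⟩, h2⟩
      · exact ⟨⟨hab, hs1 ha, hs1 hb⟩, h2⟩

end Parallel

theorem isKConnected_three {V : Type*} {G : SimpleGraph V} (hcard : 3 < Nat.card V)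
    (h2 : No2Sep G) : IsKConnected 3 G := by
  refine ⟨hcard, fun S hS => ?_⟩
  by_cases hS2 : S.card < 2
  · exact (isKConnected_two (by omega) h2.no1Sep).2 S hS2
  · classical
    obtain ⟨p, q, -, rfl⟩ := Finset.card_eq_two.1 (show S.card = 2 by omega)
    obtain ⟨x, hx⟩ : ∃ x, x ∉ ({p, q} : Finset V) := by
      by_contra! hcon
      have hfin : Fintype V := ⟨_, hcon⟩
      have hle : Nat.card V ≤ ({p, q} : Finset V).card := by
        rw [Nat.card_eq_fintype_card, ← Finset.card_univ]
        exact Finset.card_le_card fun x _ => hcon x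
      omega
    show Conn G _
    refine conn_of_base (x := x) (by simpa using hx) fun T hT hxT hc => ?_
    by_contra hcon
    obtain ⟨o, ho, hoT⟩ := Set.not_subset.1 hcon
    have hmem : ∀ y, y ∈ ((({p, q} : Finset V) : Set V)ᶜ) ↔ y ≠ p ∧ y ≠ q := fun y => by simp
    rw [hmem] at ho
    obtain ⟨a, ha, b, hb, hbp, hbq, hab⟩ := h2 T p q o ⟨x, hxT⟩
      (fun h => ((hmem _).1 (hT h)).1 rfl) (fun h => ((hmem _).1 (hT h)).2 rfl) hoT ho.1 ho.2
    exact hb (hc a ha b ((hmem b).2 ⟨hbp, hbq⟩) hab)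

theorem exists_ne_ne {V : Type*} (hcard : 2 < Nat.card V) (a b : V) : ∃ c, c ≠ a ∧ c ≠ b := by
  have hfin : Finite V := (Nat.card_pos_iff.1 (by omega)).2
  by_contra! hcon
  have hsub : (Set.univ : Set V) ⊆ {a, b} := fun x _ => by
    by_cases hx : x = a
    · exact Or.inl hx
    · exact Or.inr (hcon x hx)
  have h2 := Set.ncard_le_ncard hsub (Set.toFinite _)
  rw [Set.ncard_univ] at h2
  have := Set.ncard_insert_le a {b}
  rw [Set.ncard_singleton] at this
  omega

theorem exists_ne_ne_ne {V : Type*} (hcard : 3 < Nat.card V) (a b c : V) :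
    ∃ d, d ≠ a ∧ d ≠ b ∧ d ≠ c := by
  have hfin : Finite V := (Nat.card_pos_iff.1 (by omega)).2
  by_contra! hcon
  have hsub : (Set.univ : Set V) ⊆ {a, b, c} := fun x _ => by
    by_cases hx : x = a
    · exact Or.inl hx
    · by_cases hx' : x = b
      · exact Or.inr (Or.inl hx')
      · exact Or.inr (Or.inr (hcon x hx hx'))
  have h2 := Set.ncard_le_ncard hsub (Set.toFinite _)
  rw [Set.ncard_univ] at h2
  have h3 := Set.ncard_insert_le a {b, c}
  have h4 := Set.ncard_insert_le b {c}
  rw [Set.ncard_singleton] at h4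
  omega

/-- Let `L` be the original vertices in `K`. A cut at an original vertex would give a cut vertex of
`H`. A cut at a subdividing vertex would make the subdivided edge the only edge of `H` leaving `L`,
and then one of its ends would separate `H`. -/
theorem no1Sep_subdivide {W : Type*} {H : SimpleGraph W} {S : Set (Sym2 W)}
    (h3 : IsKConnected 3 H) (hS : S ⊆ H.edgeSet) : No1Sep (subdivide H S) := by
  have h2 := h3.no2Sep
  intro K p o hK hp ho hop
  by_contra! hcon
  let L : Set W := {w | Sum.inl w ∈ K}
  have toEdge : ∀ x ∈ L, ∀ e : S, x ∈ e.1 → Sum.inr e ∈ K ∨ p = Sum.inr e := by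
    intro x hx e hxe
    by_contra! h
    exact hcon _ hx _ h.1 h.2.symm hxe
  have ofEdge : ∀ e : S, Sum.inr e ∈ K → ∀ x, x ∈ e.1 → x ∈ L ∨ p = Sum.inl x := by
    intro e he x hxe
    by_contra! h
    exact hcon _ he _ h.1 h.2.symm hxe
  have step : ∀ x ∈ L, ∀ y, H.Adj x y →
      y ∈ L ∨ p = Sum.inl y ∨ ∃ h : s(x, y) ∈ S, p = Sum.inr ⟨s(x, y), h⟩ := by
    intro x hx y hxy
    by_cases he : s(x, y) ∈ S
    · rcases toEdge x hx ⟨_, he⟩ (by simp) with h | h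
      · exact (ofEdge _ h y (by simp)).imp id Or.inl
      · exact Or.inr (Or.inr ⟨he, h⟩)
    · by_contra! h
      exact hcon _ hx (Sum.inl y) h.1 h.2.1.symm ⟨hxy, he⟩
  have edge : ∀ e : S, ∃ a b, a ≠ b ∧ a ∈ e.1 ∧ b ∈ e.1 := by
    rintro ⟨e, he⟩
    induction e with
    | _ a b => exact ⟨a, b, (hS he).ne, by simp, by simp⟩
  rcases p with p | e₀
  · have step' : ∀ x ∈ L, ∀ y, y ≠ p → H.Adj x y → y ∈ L := by
      intro x hx y hyp hxy
      rcases step x hx y hxy with h | h | ⟨_, h⟩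
      exacts [h, absurd (Sum.inl_injective h).symm hyp, by cases h]
    have hL : L.Nonempty := by
      obtain ⟨x | e, hx⟩ := hK
      · exact ⟨x, hx⟩
      · obtain ⟨a, b, hab, ha, hb⟩ := edge e
        rcases ofEdge e hx a ha with h | h
        · exact ⟨a, h⟩
        · rcases ofEdge e hx b hb with h' | h'
          · exact ⟨b, h'⟩
          · exact absurd (Sum.inl_injective (h.symm.trans h')) hab
    have hall : ∀ w, w ≠ p → w ∈ L := by
      intro w hw
      by_contra hwL
      obtain ⟨x, hx, y, hy, hyp, hxy⟩ := h2.no1Sep L p w hL hp hwL hw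
      exact hy (step' x hx y hyp hxy)
    rcases o with o | e
    · exact ho (hall o fun h => hop (by rw [h]))
    · obtain ⟨a, b, hab, ha, hb⟩ := edge e
      have : ∃ x ∈ L, x ∈ e.1 := by
        by_cases hap : a = p
        · exact ⟨b, hall b fun h => hab (hap.trans h.symm), hb⟩
        · exact ⟨a, hall a hap, ha⟩
      obtain ⟨x, hx, hxe⟩ := this
      rcases toEdge x hx e hxe with h | h
      · exact ho h
      · cases h
  · have hL : L.Nonempty := by
      obtain ⟨x | e, hx⟩ := hK
      · exact ⟨x, hx⟩
      · obtain ⟨a, b, hab, ha, hb⟩ := edge e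
        rcases ofEdge e hx a ha with h | h
        · exact ⟨a, h⟩
        · cases h
    have step' : ∀ x ∈ L, ∀ y, H.Adj x y → y ∈ L ∨ s(x, y) = e₀.1 := by
      intro x hx y hxy
      rcases step x hx y hxy with h | h | ⟨h1, h⟩
      · exact Or.inl h
      · cases h
      · refine Or.inr ?_
        rw [Sum.inr_injective h]
    have ho' : ∃ w, w ∉ L := by
      by_contra! hall
      rcases o with o | e
      · exact ho (hall o)
      · obtain ⟨a, b, -, ha, -⟩ := edge e
        rcases toEdge a (hall a) e ha with h | h
        · exact ho h
        · exact hop h.symm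
    obtain ⟨w, hw⟩ := ho'
    obtain ⟨x, hx⟩ := hL
    have hxw : x ≠ w := fun h => hw (h ▸ hx)
    obtain ⟨r, hrx, hrw⟩ := exists_ne_ne (by have := h3.1; omega) x w
    have hab : ∃ a ∈ L, ∃ b, b ∉ L ∧ s(a, b) = e₀.1 := by
      by_cases hr : r ∈ L
      · obtain ⟨a, ha, b, hb, -, hab⟩ := h2.no1Sep Lᶜ r x ⟨w, hw⟩ (not_not.2 hr) (not_not.2 hx)
          hrx.symm
        have hb' : b ∈ L := not_not.1 hb
        exact ⟨b, hb', a, ha, (step' b hb' a hab.symm).resolve_left ha⟩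
      · obtain ⟨a, ha, b, hb, -, hab⟩ := h2.no1Sep L r w ⟨x, hx⟩ hr hw hrw.symm
        exact ⟨a, ha, b, hb, (step' a ha b hab).resolve_left hb⟩
    obtain ⟨a, ha, b, hb, hab⟩ := hab
    have huniq : ∀ c ∈ L, ∀ d, d ∉ L → H.Adj c d → c = a ∧ d = b := by
      intro c hc d hd hcd
      have h := ((step' c hc d hcd).resolve_left hd).trans hab.symm
      rw [Sym2.eq_iff] at h
      rcases h with h | ⟨h, h'⟩
      · exact h
      · exact absurd (h ▸ hc) hb
    -- If `b` is not the only vertex outside `L`, it separates the others from `L`; otherwise `a` is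
    -- the only neighbour of `b`.
    by_cases hlast : ∃ w, w ∉ L ∧ w ≠ b
    · obtain ⟨w, hw, hwb⟩ := hlast
      obtain ⟨c, hc, d, hd, hdb, hcd⟩ := h2.no1Sep L b w ⟨a, ha⟩ hb hw hwb
      exact hdb (huniq c hc d hd hcd).2
    · push Not at hlast
      obtain ⟨y, hya, hyb⟩ := exists_ne_ne (by have := h3.1; omega) a b
      have hab' : a ≠ b := fun h => hb (h ▸ ha)
      obtain ⟨c, rfl, d, hd, hda, hcd⟩ := h2.no1Sep {b} a y ⟨b, rfl⟩ hab' hyb hya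
      have hdL : d ∈ L := by
        by_contra h
        exact hd (hlast d h)
      exact hda (huniq d hdL _ hb hcd.symm).1

/-! ### Torsos. -/

/-- A family of pairwise disjoint, pairwise nonadjacent regions with distinct pairs of ends. -/
structure Torso {V : Type u} (G : SimpleGraph V) (ι : Type u) where
  R : ι → Set V
  s : ι → V
  t : ι → V
  region : ∀ i, Region G (R i) (s i) (t i)
  disjoint : ∀ i j, i ≠ j → Disjoint (R i) (R j)
  s_notMem : ∀ i j, s i ∉ R j
  t_notMem : ∀ i j, t i ∉ R j
  not_adj : ∀ i j, i ≠ j → ∀ x ∈ R i, ∀ y ∈ R j, ¬ G.Adj x y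
  inj : ∀ i j, s(s i, t i) = s(s j, t j) → i = j

namespace Torso

variable {V ι : Type u} {G : SimpleGraph V} (T : Torso G ι)

/-- The vertices outside the regions. -/
def Vert : Type u := {x : V // ∀ i, x ∉ T.R i}

def left (i : ι) : T.Vert := ⟨T.s i, T.s_notMem i⟩

def right (i : ι) : T.Vert := ⟨T.t i, T.t_notMem i⟩

theorem left_ne_right (i : ι) : T.left i ≠ T.right i := fun h =>
  (T.region i).ne (congrArg Subtype.val h)

/-- The graph on the vertices outside the regions, in which the ends of every region are joined. -/
def graph : SimpleGraph T.Vert where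
  Adj x y := x ≠ y ∧ (G.Adj x.1 y.1 ∨ ∃ i, s(x, y) = s(T.left i, T.right i))
  symm := ⟨fun _ _ h => ⟨h.1.symm, h.2.imp (fun h => h.symm)
    fun ⟨i, hi⟩ => ⟨i, Sym2.eq_swap.trans hi⟩⟩⟩
  loopless := ⟨fun _ h => h.1 rfl⟩

variable {T}

theorem adj_of_adj {x y : T.Vert} (h : G.Adj x.1 y.1) : T.graph.Adj x y :=
  ⟨fun h' => h.ne (congrArg Subtype.val h'), Or.inl h⟩

theorem adj_left_right (i : ι) : T.graph.Adj (T.left i) (T.right i) :=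
  ⟨T.left_ne_right i, Or.inr ⟨i, rfl⟩⟩

variable (T)

/-- The edges of the torso that come from regions. -/
def virtual : Set (Sym2 T.Vert) := Set.range fun i => s(T.left i, T.right i)

variable {T}

theorem virtual_subset : T.virtual ⊆ T.graph.edgeSet := by
  rintro _ ⟨i, rfl⟩
  exact adj_left_right i

theorem pair_injective {i j : ι} (h : s(T.left i, T.right i) = s(T.left j, T.right j)) :
    i = j := by
  refine T.inj i j ?_
  have := congrArg (Sym2.map Subtype.val) h
  exact this

variable (T)

/-- The frame in which the edges of the torso that come from regions are subdivided. -/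
noncomputable def frame : Frame V ι where
  W := T.Vert ⊕ T.virtual
  N := subdivide T.graph T.virtual
  -- The value at a subdividing vertex is immaterial: all of these are marked.
  φ := Sum.elim Subtype.val fun e => T.s e.2.choose
  z i := Sum.inr ⟨_, i, rfl⟩
  s i := Sum.inl (T.left i)
  t i := Sum.inl (T.right i)
  z_injective i j h := pair_injective (congrArg Subtype.val (Sum.inr_injective h))
  z_not_adj _ _ h := h
  s_ne_t i h := T.left_ne_right i (Sum.inl_injective h)
  neighborSet_z i := by
    ext (x | e)
    · rw [SimpleGraph.mem_neighborSet]
      change x ∈ s(T.left i, T.right i) ↔ _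
      simp
    · rw [SimpleGraph.mem_neighborSet]
      change False ↔ _
      simp
  φ_injOn := by
    rintro (_ | ⟨_, i, rfl⟩) hx (_ | ⟨_, j, rfl⟩) hy h
    · exact congrArg Sum.inl (Subtype.ext h)
    · exact absurd ⟨j, rfl⟩ hy
    · exact absurd ⟨i, rfl⟩ hx
    · exact absurd ⟨j, rfl⟩ hy

variable {T}

theorem frame_verts : T.frame.verts = {x | ∀ i, x ∉ T.R i} := by
  ext x
  constructor
  · rintro ⟨y | ⟨_, i, rfl⟩, hy, rfl⟩
    · exact y.2
    · exact absurd ⟨i, rfl⟩ hy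
  · exact fun hx => ⟨Sum.inl ⟨x, hx⟩, (by rintro ⟨i, hi⟩; cases hi), rfl⟩

theorem frame_edges {a b : V} : T.frame.edges a b ↔ (∀ i, a ∉ T.R i) ∧ (∀ i, b ∉ T.R i) ∧
    G.Adj a b ∧ ∀ i, s(a, b) ≠ s(T.s i, T.t i) := by
  constructor
  · rintro ⟨x | ⟨_, i, rfl⟩, hx, y | ⟨_, j, rfl⟩, hy, hxy, rfl, rfl⟩
    · obtain ⟨⟨-, h⟩, h'⟩ : T.graph.Adj x y ∧ s(x, y) ∉ T.virtual := hxy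
      rcases h with h | ⟨i, hi⟩
      · refine ⟨x.2, y.2, h, fun i hi => h' ⟨i, ?_⟩⟩
        have hinj : Function.Injective (Sym2.map (Subtype.val : T.Vert → V)) :=
          Sym2.map.injective Subtype.val_injective
        exact (hinj (a₁ := s(x, y)) (a₂ := s(T.left i, T.right i)) hi).symm
      · exact absurd ⟨i, hi.symm⟩ h'
    · exact absurd ⟨j, rfl⟩ hy
    · exact absurd ⟨i, rfl⟩ hx
    · exact absurd ⟨j, rfl⟩ hy
  · rintro ⟨ha, hb, hab, h⟩
    refine ⟨Sum.inl ⟨a, ha⟩, (by rintro ⟨i, hi⟩; cases hi), Sum.inl ⟨b, hb⟩,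
      (by rintro ⟨i, hi⟩; cases hi), ⟨adj_of_adj hab, ?_⟩, rfl, rfl⟩
    rintro ⟨i, hi⟩
    exact h i (congrArg (Sym2.map Subtype.val) hi).symm

/-- Subdividing the virtual edges of a 3-connected torso gives an internally 3-connected graph, and
it is a minor of `G` because each subdividing vertex can be replaced by a connected set of its
region. -/
theorem baseClass {n : ℕ} (hG : ClassD n V G) (h3 : IsKConnected 3 T.graph) :
    BaseClass n T.frame.W T.frame.N := by
  have h1 := hG.1.no1Sep
  have hfin : Finite V := hG.1.finite
  have : Finite T.Vert := Subtype.finite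
  refine baseClass_of_classC ?_ ?_ fun hm => hG.2 (T.frame.hasMinor h1 T.R T.region T.disjoint
    ?_ ?_ hm)
  · exact Or.inr (Or.inr (Or.inr (Or.inr (Or.inr (Or.inr
      ⟨_, T.graph, T.virtual, h3, virtual_subset, ⟨SimpleGraph.Iso.refl⟩⟩)))))
  · refine isKConnected_two ?_ (no1Sep_subdivide h3 virtual_subset)
    change 2 < Nat.card (T.Vert ⊕ T.virtual)
    have : Finite T.virtual := Subtype.finite
    rw [Nat.card_sum]
    have := h3.1
    omega
  · intro i
    rw [frame_verts]
    exact Set.disjoint_left.2 fun x hx h => h i hx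
  · exact fun a b h => (frame_edges.1 h).2.2.1

/-- A separation of the torso of order at most two extends to a separation of `G`. -/
theorem no2Sep
    (h : ∀ F a b, Region G F a b → (∃ x ∈ F, ∀ i, x ∉ T.R i) →
      (∃ o, o ∉ F ∧ o ≠ a ∧ o ≠ b ∧ ∀ i, o ∉ T.R i) → (∀ i, a ∉ T.R i) → (∀ i, b ∉ T.R i) →
      (∀ i, T.R i ⊆ F ∨ Disjoint (T.R i) F) → False)
    (hcard : 3 < Nat.card T.Vert) : No2Sep T.graph := by
  have hne : ∀ (K : Set T.Vert) (a b o : T.Vert), a ≠ b → K.Nonempty → a ∉ K → b ∉ K → o ∉ K →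
      o ≠ a → o ≠ b → ∃ x ∈ K, ∃ y, y ∉ K ∧ y ≠ a ∧ y ≠ b ∧ T.graph.Adj x y := by
    intro K a b o hab hK ha hb ho hoa hob
    by_contra! hcon
    -- Every region with an end in `K` is put on the side of `K`; its other end then lies in `K` or
    -- is `a` or `b`.
    let P : ι → Prop := fun i => T.left i ∈ K ∨ T.right i ∈ K
    let F : Set V := Subtype.val '' K ∪ ⋃ i ∈ {i | P i}, T.R i
    have hFv : ∀ x : T.Vert, x.1 ∈ F ↔ x ∈ K := by
      intro x
      constructor
      · rintro (⟨y, hy, hyx⟩ | hx)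
        · rwa [← Subtype.ext hyx]
        · obtain ⟨i, -, hx⟩ := Set.mem_iUnion₂.1 hx
          exact absurd hx (x.2 i)
      · exact fun hx => Or.inl ⟨x, hx, rfl⟩
    have hFR : ∀ i, P i → T.R i ⊆ F := fun i hi x hx => Or.inr (Set.mem_biUnion hi hx)
    have step : ∀ x ∈ K, ∀ y, T.graph.Adj x y → y ∈ K ∨ y = a ∨ y = b := by
      intro x hx y hxy
      by_contra! h'
      exact hcon x hx y h'.1 h'.2.1 h'.2.2 hxy
    have hends : ∀ i, P i → ∀ y : T.Vert, y = T.left i ∨ y = T.right i →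
        y.1 ∈ F ∨ y.1 = a.1 ∨ y.1 = b.1 := by
      have key : ∀ x ∈ K, ∀ y, T.graph.Adj x y → y.1 ∈ F ∨ y.1 = a.1 ∨ y.1 = b.1 := by
        intro x hx y hxy
        exact (step x hx y hxy).imp (hFv y).2
          (Or.imp (congrArg Subtype.val) (congrArg Subtype.val))
      rintro i (hi | hi) y (rfl | rfl)
      · exact Or.inl ((hFv _).2 hi)
      · exact key _ hi _ (adj_left_right i)
      · exact key _ hi _ (adj_left_right i).symm
      · exact Or.inl ((hFv _).2 hi)
    obtain ⟨k, hk⟩ := hK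
    refine h F a.1 b.1 ⟨⟨k.1, (hFv k).2 hk⟩, fun h' => hab (Subtype.ext h'),
      fun h' => ha ((hFv a).1 h'), fun h' => hb ((hFv b).1 h'), ?_, ⟨o.1, fun h' => ho ((hFv o).1 h'),
      fun h' => hoa (Subtype.ext h'), fun h' => hob (Subtype.ext h')⟩⟩ ⟨k.1, (hFv k).2 hk, k.2⟩
      ⟨o.1, fun h' => ho ((hFv o).1 h'),
      fun h' => hoa (Subtype.ext h'), fun h' => hob (Subtype.ext h'), o.2⟩ a.2 b.2 ?_
    · rintro x (⟨x, hx, rfl⟩ | hx) y hxy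
      · by_cases hy : ∀ i, y ∉ T.R i
        · exact (step x hx ⟨y, hy⟩ (adj_of_adj hxy)).imp (hFv ⟨y, hy⟩).2
            (Or.imp (congrArg Subtype.val) (congrArg Subtype.val))
        · push Not at hy
          obtain ⟨i, hi⟩ := hy
          refine Or.inl (hFR i ?_ hi)
          rcases (T.region i).closed y hi x.1 hxy.symm with h' | h' | h'
          · exact absurd h' (x.2 i)
          · exact Or.inl ((Subtype.ext h' : x = T.left i) ▸ hx)
          · exact Or.inr ((Subtype.ext h' : x = T.right i) ▸ hx)
      · obtain ⟨i, hi, hx⟩ := Set.mem_iUnion₂.1 hx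
        rcases (T.region i).closed x hx y hxy with h' | h' | h'
        · exact Or.inl (hFR i hi h')
        · exact hends i hi (T.left i) (Or.inl rfl) |>.imp (fun h => h' ▸ h)
            (Or.imp (fun h => h'.trans h) fun h => h'.trans h)
        · exact hends i hi (T.right i) (Or.inr rfl) |>.imp (fun h => h' ▸ h)
            (Or.imp (fun h => h'.trans h) fun h => h'.trans h)
    · intro i
      by_cases hi : P i
      · exact Or.inl (hFR i hi)
      · refine Or.inr (Set.disjoint_left.2 fun x hx hx' => ?_)
        rcases hx' with ⟨y, -, rfl⟩ | hx'
        · exact y.2 i hx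
        · obtain ⟨j, hj, hx'⟩ := Set.mem_iUnion₂.1 hx'
          have hij : i ≠ j := fun h => hi (h ▸ hj)
          exact Set.disjoint_left.1 (T.disjoint i j hij) hx hx'
  intro K a b o hK ha hb ho hoa hob
  by_cases hab : a = b
  · subst hab
    -- A single cut vertex is completed to a pair by a vertex `r` outside `K`. If there is none,
    -- only `o` lies beyond `a`, and `{o}` is used as the separated set instead.
    by_cases hr : ∃ r, r ∉ K ∧ r ≠ a ∧ r ≠ o
    · obtain ⟨r, hr, hra, hro⟩ := hr
      obtain ⟨x, hx, y, hy, hya, -, hxy⟩ := hne K a r o hra.symm hK ha hr ho hoa hro.symm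
      exact ⟨x, hx, y, hy, hya, hya, hxy⟩
    · push Not at hr
      obtain ⟨r, hra, hro⟩ := exists_ne_ne (by omega) a o
      obtain ⟨r', hra', hro', hrr'⟩ := exists_ne_ne_ne hcard a o r
      obtain ⟨x, rfl, y, hyx, hya, -, hxy⟩ := hne {o} a r r' hra.symm ⟨o, rfl⟩ hoa.symm hro hro'
        hra' hrr'
      refine ⟨y, ?_, x, ho, hoa, hoa, hxy.symm⟩
      by_contra h'
      exact hyx (hr y h' hya)
  · exact hne K a b o hab hK ha hb ho hoa hob

end Torso

/-- Otherwise the other two vertices `c` and `d` would separate `x` from `y`. -/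
theorem adj_of_four {W : Type*} {H : SimpleGraph W} (h2 : No2Sep H) {x y c d : W}
    (hall : ∀ w, w = x ∨ w = y ∨ w = c ∨ w = d) (hxy : x ≠ y) (hxc : x ≠ c) (hxd : x ≠ d)
    (hyc : y ≠ c) (hyd : y ≠ d) : H.Adj x y := by
  obtain ⟨a, rfl, b, hba, hbc, hbd, hab⟩ := h2 {x} c d y ⟨x, rfl⟩ hxc.symm hxd.symm hxy.symm hyc hyd
  rcases hall b with rfl | rfl | rfl | rfl
  exacts [absurd rfl hba, hab, absurd rfl hbc, absurd rfl hbd]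

/-! ### Carrying rooted minors from a child region to its parent. -/

namespace Torso

section Lift

variable {V ι : Type u} {G : SimpleGraph V} (T : Torso G ι)

/-- A choice of a connected set in every region that joins the ends of the region. -/
def IsCore (D : ι → Set V) : Prop := ∀ i, D i ⊆ T.R i ∧ Conn G (D i) ∧
  (∃ x ∈ D i, G.Adj x (T.s i)) ∧ ∃ x ∈ D i, G.Adj x (T.t i)

theorem exists_isCore (h1 : No1Sep G) : ∃ D, T.IsCore D := by
  choose D hD using fun i => (T.region i).exists_conn h1
  exact ⟨D, hD⟩

/-- The set of vertices of `G` given by a set of vertices of the torso and a set of regions. -/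
def lift (D : ι → Set V) (P : Set ι) (A : Set T.Vert) : Set V := Subtype.val '' A ∪ ⋃ i ∈ P, D i

variable {T} {D : ι → Set V} {P Q : Set ι} {A B : Set T.Vert}

theorem mem_lift {x : T.Vert} (hx : x ∈ A) : x.1 ∈ T.lift D P A := Or.inl ⟨x, hx, rfl⟩

theorem subset_lift {i : ι} (hi : i ∈ P) : D i ⊆ T.lift D P A :=
  fun _ hx => Or.inr (Set.mem_biUnion hi hx)

/-- A virtual edge inside `A` need not be an edge of `G`, so the core of its region has to be
included (`hP'`); each included core is attached to `A` at one of its ends (`hP`). -/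
theorem IsCore.conn_lift (hD : T.IsCore D) (hA : Conn T.graph A)
    (hP : ∀ i ∈ P, T.left i ∈ A ∨ T.right i ∈ A)
    (hP' : ∀ i, T.left i ∈ A → T.right i ∈ A → i ∈ P) : Conn G (T.lift D P A) := by
  obtain ⟨a, ha⟩ := hA.nonempty
  refine conn_of_base (x := a.1) (mem_lift ha) fun U hU haU hc => ?_
  have absorb : ∀ i ∈ P, (T.s i ∈ U ∨ T.t i ∈ U) → D i ⊆ U := by
    rintro i hi (h | h)
    · obtain ⟨x, hx, hxs⟩ := (hD i).2.2.1
      exact (hD i).2.1.subset' hx (hc _ h x (subset_lift hi hx) hxs.symm)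
        fun p hp _ q hq hpq => hc p hp q (subset_lift hi hq) hpq
    · obtain ⟨x, hx, hxs⟩ := (hD i).2.2.2
      exact (hD i).2.1.subset' hx (hc _ h x (subset_lift hi hx) hxs.symm)
        fun p hp _ q hq hpq => hc p hp q (subset_lift hi hq) hpq
  have hAU : A ⊆ {x | x.1 ∈ U} := by
    refine hA.subset' ha haU fun x hx hxA y hy hxy => ?_
    rcases hxy.2 with h | ⟨i, hi⟩
    · exact hc x.1 hx y.1 (mem_lift hy) h
    · rw [Sym2.eq_iff] at hi
      rcases hi with ⟨rfl, rfl⟩ | ⟨rfl, rfl⟩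
      · have hiP := hP' i hxA hy
        obtain ⟨z, hz, hzt⟩ := (hD i).2.2.2
        exact hc z (absorb i hiP (Or.inl hx) hz) _ (mem_lift hy) hzt
      · have hiP := hP' i hy hxA
        obtain ⟨z, hz, hzt⟩ := (hD i).2.2.1
        exact hc z (absorb i hiP (Or.inr hx) hz) _ (mem_lift hy) hzt
  rintro x (⟨y, hy, rfl⟩ | hx)
  · exact hAU hy
  · obtain ⟨i, hi, hx⟩ := Set.mem_iUnion₂.1 hx
    refine absorb i hi ?_ hx
    exact (hP i hi).imp (fun h => hAU h) fun h => hAU h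

theorem IsCore.disjoint_lift (hD : T.IsCore D) (hAB : Disjoint A B) (hPQ : Disjoint P Q) :
    Disjoint (T.lift D P A) (T.lift D Q B) := by
  refine Set.disjoint_left.2 ?_
  rintro x (⟨y, hy, rfl⟩ | hx) (⟨z, hz, hzx⟩ | hx')
  · exact Set.disjoint_left.1 hAB hy (Subtype.ext hzx ▸ hz)
  · obtain ⟨i, hi, hx'⟩ := Set.mem_iUnion₂.1 hx'
    exact y.2 i ((hD i).1 hx')
  · obtain ⟨i, hi, hx⟩ := Set.mem_iUnion₂.1 hx
    exact z.2 i (hzx ▸ (hD i).1 hx)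
  · obtain ⟨i, hi, hx⟩ := Set.mem_iUnion₂.1 hx
    obtain ⟨j, hj, hx'⟩ := Set.mem_iUnion₂.1 hx'
    have hij : i ≠ j := fun h => Set.disjoint_left.1 hPQ hi (h ▸ hj)
    exact Set.disjoint_left.1 (T.disjoint i j hij) ((hD i).1 hx) ((hD j).1 hx')

theorem IsCore.disjoint_region (hD : T.IsCore D) {i : ι} (hi : i ∉ P) :
    Disjoint (T.lift D P A) (T.R i) := by
  refine Set.disjoint_left.2 ?_
  rintro x (⟨y, hy, rfl⟩ | hx) hxi
  · exact y.2 i hxi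
  · obtain ⟨j, hj, hx⟩ := Set.mem_iUnion₂.1 hx
    have hij : i ≠ j := fun h => hi (h ▸ hj)
    exact Set.disjoint_left.1 (T.disjoint i j hij) hxi ((hD j).1 hx)

theorem IsCore.adj_lift (hD : T.IsCore D) (hP : ∀ i, T.left i ∈ A ∨ T.right i ∈ A → i ∈ P)
    (h : ∃ x ∈ A, ∃ y ∈ B, T.graph.Adj x y) :
    ∃ x ∈ T.lift D P A, ∃ y ∈ T.lift D Q B, G.Adj x y := by
  obtain ⟨x, hx, y, hy, hxy⟩ := h
  rcases hxy.2 with h | ⟨i, hi⟩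
  · exact ⟨x.1, mem_lift hx, y.1, mem_lift hy, h⟩
  · rw [Sym2.eq_iff] at hi
    rcases hi with ⟨rfl, rfl⟩ | ⟨rfl, rfl⟩
    · obtain ⟨z, hz, hzt⟩ := (hD i).2.2.2
      exact ⟨z, subset_lift (hP i (Or.inl hx)) hz, _, mem_lift hy, hzt⟩
    · obtain ⟨z, hz, hzt⟩ := (hD i).2.2.1
      exact ⟨z, subset_lift (hP i (Or.inr hx)) hz, _, mem_lift hy, hzt⟩

end Lift

section Rooted

variable {V κ : Type u} {G : SimpleGraph V} {T : Torso G (Option κ)} {C : Set V}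

theorem region_subset (hR : T.R none = {x | x ∉ C ∧ x ≠ T.s none ∧ x ≠ T.t none}) (i : κ) :
    T.R (some i) ⊆ C := by
  intro x hx
  by_contra hxC
  refine Set.disjoint_left.1 (T.disjoint (some i) none (by simp)) hx ?_
  rw [hR]
  exact ⟨hxC, fun h => T.s_notMem none (some i) (h ▸ hx),
    fun h => T.t_notMem none (some i) (h ▸ hx)⟩

theorem vert_mem (hR : T.R none = {x | x ∉ C ∧ x ≠ T.s none ∧ x ≠ T.t none}) (x : T.Vert) :
    x.1 ∈ C ∨ x = T.left none ∨ x = T.right none := by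
  by_contra! h
  refine x.2 none ?_
  rw [hR]
  exact ⟨h.1, fun h' => h.2.1 (Subtype.ext h'), fun h' => h.2.2 (Subtype.ext h')⟩

/-- The regions with both ends in `A`. -/
def inner (T : Torso G (Option κ)) (A : Set T.Vert) : Set (Option κ) :=
  {j | T.left j ∈ A ∧ T.right j ∈ A}

theorem notMem_inner {A B : Set T.Vert} (hAB : Disjoint A B) {p q : T.Vert} {i : Option κ}
    (hpq : s(p, q) = s(T.left i, T.right i)) (hp : p ∈ A) (hq : q ∈ B) :
    i ∉ T.inner A ∧ i ∉ T.inner B := by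
  rw [Sym2.eq_iff] at hpq
  rcases hpq with ⟨rfl, rfl⟩ | ⟨rfl, rfl⟩
  · exact ⟨fun h => Set.disjoint_left.1 hAB h.2 hq, fun h => Set.disjoint_left.1 hAB hp h.1⟩
  · exact ⟨fun h => Set.disjoint_left.1 hAB h.1 hq, fun h => Set.disjoint_left.1 hAB hp h.2⟩

theorem disjoint_inner {A B : Set T.Vert} (hAB : Disjoint A B) :
    Disjoint (T.inner A) (T.inner B) :=
  Set.disjoint_left.2 fun _ h h' => Set.disjoint_left.1 hAB h.1 h'.1

theorem IsCore.conn_inner {D : Option κ → Set V} (hD : T.IsCore D) {A : Set T.Vert}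
    (hA : Conn T.graph A) : Conn G (T.lift D (T.inner A) A) :=
  hD.conn_lift hA (fun _ h => Or.inl h.1) fun _ h h' => ⟨h, h'⟩

theorem IsCore.lift_subset {D : Option κ → Set V} (hD : T.IsCore D)
    (hR : T.R none = {x | x ∉ C ∧ x ≠ T.s none ∧ x ≠ T.t none}) {A : Set T.Vert}
    {P : Set (Option κ)} (hP : none ∉ P) {X : Set V} (hX : ∀ x ∈ A, x.1 ∈ X) (hCX : C ⊆ X) :
    T.lift D P A ⊆ X := by
  rintro x (⟨y, hy, rfl⟩ | hx)
  · exact hX y hy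
  · obtain ⟨_ | i, hi, hx⟩ := Set.mem_iUnion₂.1 hx
    · exact absurd hi hP
    · exact hCX (region_subset hR i ((hD _).1 hx))

variable {A B : Set T.Vert} {i : κ} {p q : T.Vert}

/-- Rooted minors of a region extend along disjoint connected sets of the torso. -/
theorem rootedMinor (h1 : No1Sep G) (hR : T.R none = {x | x ∉ C ∧ x ≠ T.s none ∧ x ≠ T.t none})
    (hpq : s(p, q) = s(T.left (some i), T.right (some i))) (cA : Conn T.graph A)
    (cB : Conn T.graph B) (hAB : Disjoint A B) (hu : T.left none ∈ A) (hp : p ∈ A)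
    (hv : T.right none ∈ B) (hq : q ∈ B) {ι : Type} (hm : RootedMinor G ι (T.R (some i)) p.1 q.1) :
    RootedMinor G ι C (T.s none) (T.t none) := by
  obtain ⟨D, hD⟩ := T.exists_isCore h1
  obtain ⟨hiA, hiB⟩ := notMem_inner hAB hpq hp hq
  obtain ⟨hnA, hnB⟩ := notMem_inner hAB (i := none) rfl hu hv
  refine hm.extend (region_subset hR i) (A' := T.lift D (T.inner A) A)
    (B' := T.lift D (T.inner B) B) (hD.lift_subset hR hnA (fun x hx => ?_) (Set.subset_insert _ _))
    (hD.lift_subset hR hnB (fun x hx => ?_) (Set.subset_insert _ _)) (mem_lift hu) (mem_lift hp)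
    (mem_lift hv) (mem_lift hq) (hD.conn_inner cA) (hD.conn_inner cB)
    (hD.disjoint_lift hAB (disjoint_inner hAB)) (hD.disjoint_region hiA) (hD.disjoint_region hiB)
  · rcases vert_mem hR x with h | rfl | rfl
    exacts [Or.inr h, Or.inl rfl, absurd hv (Set.disjoint_left.1 hAB hx)]
  · rcases vert_mem hR x with h | rfl | rfl
    exacts [Or.inr h, absurd hx (Set.disjoint_left.1 hAB hu), Or.inl rfl]

/-- As `rootedMinor`, with a further set joining the two hubs. -/
theorem rootedMinor_option (h1 : No1Sep G)
    (hR : T.R none = {x | x ∉ C ∧ x ≠ T.s none ∧ x ≠ T.t none})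
    (hpq : s(p, q) = s(T.left (some i), T.right (some i))) (cA : Conn T.graph A)
    (cB : Conn T.graph B) (hAB : Disjoint A B) (hu : T.left none ∈ A) (hp : p ∈ A)
    (hv : T.right none ∈ B) (hq : q ∈ B)
    (hX : (∃ X, Conn T.graph X ∧ Disjoint A X ∧ Disjoint B X ∧
      (∃ x ∈ X, ∃ y ∈ A, T.graph.Adj x y) ∧ ∃ x ∈ X, ∃ y ∈ B, T.graph.Adj x y) ∨
      ∃ j, j ≠ i ∧ ∃ a ∈ A, ∃ b ∈ B, s(a, b) = s(T.left (some j), T.right (some j)))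
    {ι : Type} (hm : RootedMinor G ι (T.R (some i)) p.1 q.1) :
    RootedMinor G (Option ι) C (T.s none) (T.t none) := by
  obtain ⟨D, hD⟩ := T.exists_isCore h1
  obtain ⟨hiA, hiB⟩ := notMem_inner hAB hpq hp hq
  obtain ⟨hnA, hnB⟩ := notMem_inner hAB (i := none) rfl hu hv
  obtain ⟨Y, hYC, cY, hYA, hYB, hYR, hYA', hYB'⟩ : ∃ Y ⊆ C, Conn G Y ∧
      Disjoint Y (T.lift D (T.inner A) A) ∧ Disjoint Y (T.lift D (T.inner B) B) ∧
      Disjoint Y (T.R (some i)) ∧ (∃ x ∈ Y, ∃ y ∈ T.lift D (T.inner A) A, G.Adj x y) ∧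
      ∃ x ∈ Y, ∃ y ∈ T.lift D (T.inner B) B, G.Adj x y := by
    rcases hX with ⟨X, cX, hAX, hBX, hXA, hXB⟩ | ⟨j, hji, a, ha, b, hb, hab⟩
    -- The extra leaf takes every region with an end in `X`, so that it touches the hubs even where
    -- the torso edge is virtual. The hubs take only the regions with both ends inside them.
    · let P : Set (Option κ) := {j | T.left j ∈ X ∨ T.right j ∈ X}
      have hP : ∀ {p q : T.Vert} {i : Option κ}, s(p, q) = s(T.left i, T.right i) → p ∈ A → q ∈ B →
          i ∉ P := by
        intro p q i hpq hp hq h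
        have hp' := Set.disjoint_left.1 hAX hp
        have hq' := Set.disjoint_left.1 hBX hq
        rw [Sym2.eq_iff] at hpq
        rcases hpq with ⟨rfl, rfl⟩ | ⟨rfl, rfl⟩
        · exact h.elim hp' hq'
        · exact h.elim hq' hp'
      have hPin : ∀ {A : Set T.Vert}, Disjoint A X → Disjoint P (T.inner A) := fun hA =>
        Set.disjoint_left.2 fun j hj hj' => hj.elim (Set.disjoint_left.1 hA hj'.1)
          (Set.disjoint_left.1 hA hj'.2)
      refine ⟨T.lift D P X, hD.lift_subset hR (hP (i := none) rfl hu hv) (fun x hx => ?_) subset_rfl,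
        hD.conn_lift cX (fun _ h => h) (fun _ h _ => Or.inl h),
        hD.disjoint_lift hAX.symm (hPin hAX), hD.disjoint_lift hBX.symm (hPin hBX),
        hD.disjoint_region (hP hpq hp hq), hD.adj_lift (fun _ h => h) hXA,
        hD.adj_lift (fun _ h => h) hXB⟩
      rcases vert_mem hR x with h | rfl | rfl
      exacts [h, absurd hx (Set.disjoint_left.1 hAX hu), absurd hx (Set.disjoint_left.1 hBX hv)]
    -- A second child region running between the two hubs supplies the extra leaf by its own core.
    · obtain ⟨hjA, hjB⟩ := notMem_inner hAB hab ha hb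
      have hadj : ∀ {A : Set T.Vert} {x : T.Vert}, x ∈ A →
          x = T.left (some j) ∨ x = T.right (some j) →
          ∃ x ∈ D (some j), ∃ y ∈ T.lift D (T.inner A) A, G.Adj x y := by
        rintro A x hx (rfl | rfl)
        · obtain ⟨z, hz, hzx⟩ := (hD (some j)).2.2.1
          exact ⟨z, hz, _, mem_lift hx, hzx⟩
        · obtain ⟨z, hz, hzx⟩ := (hD (some j)).2.2.2
          exact ⟨z, hz, _, mem_lift hx, hzx⟩
      have hab' := Sym2.eq_iff.1 hab
      refine ⟨D (some j), (hD _).1.trans (region_subset hR j), (hD _).2.1,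
        ((hD.disjoint_region hjA).mono_right (hD _).1).symm,
        ((hD.disjoint_region hjB).mono_right (hD _).1).symm,
        (T.disjoint _ _ fun h => hji (Option.some_injective _ h)).mono_left (hD _).1,
        hadj ha (by tauto), hadj hb (by tauto)⟩
  refine hm.extend_option (region_subset hR i) (A' := T.lift D (T.inner A) A)
    (B' := T.lift D (T.inner B) B) (hD.lift_subset hR hnA (fun x hx => ?_) (Set.subset_insert _ _))
    (hD.lift_subset hR hnB (fun x hx => ?_) (Set.subset_insert _ _)) (mem_lift hu) (mem_lift hp)
    (mem_lift hv) (mem_lift hq) (hD.conn_inner cA) (hD.conn_inner cB)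
    (hD.disjoint_lift hAB (disjoint_inner hAB)) (hD.disjoint_region hiA) (hD.disjoint_region hiB)
    hYC cY hYA hYB hYR hYA' hYB'
  · rcases vert_mem hR x with h | rfl | rfl
    exacts [Or.inr h, Or.inl rfl, absurd hv (Set.disjoint_left.1 hAB hx)]
  · rcases vert_mem hR x with h | rfl | rfl
    exacts [Or.inr h, absurd hx (Set.disjoint_left.1 hAB hu), Or.inl rfl]

/-- Apply `exists_triple` to the virtual edges of the parent and of the child `i`: a `Triple`
extends the hubs to the ends of `C` and adds a leaf. Otherwise the torso is `K_4` with these two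
edges opposite. Hubs that are edges of `K_4` still preserve the number of leaves, and any further
virtual edge supplies the missing one. -/
theorem rootedMinor_dichotomy (h1 : No1Sep G) (h3 : IsKConnected 3 T.graph)
    (hR : T.R none = {x | x ∉ C ∧ x ≠ T.s none ∧ x ≠ T.t none}) (i : κ) :
    (∀ ι : Type, RootedMinor G ι (T.R (some i)) (T.s (some i)) (T.t (some i)) →
      RootedMinor G (Option ι) C (T.s none) (T.t none)) ∨
    ((∀ ι : Type, RootedMinor G ι (T.R (some i)) (T.s (some i)) (T.t (some i)) →
      RootedMinor G ι C (T.s none) (T.t none)) ∧ (∀ j, j = i) ∧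
      (T.left none ≠ T.left (some i) ∧ T.left none ≠ T.right (some i) ∧
        T.right none ≠ T.left (some i) ∧ T.right none ≠ T.right (some i)) ∧
      ∀ x, x = T.left none ∨ x = T.right none ∨ x = T.left (some i) ∨ x = T.right (some i)) := by
  have h2 := h3.no2Sep
  rcases exists_triple h3 (adj_left_right none) (adj_left_right (some i)) with h | h | h
  · obtain ⟨A, B, X, cA, cB, cX, hAB, hAX, hBX, hu, hp, hv, hq, hXA, hXB⟩ := h
    exact Or.inl fun ι hm => rootedMinor_option h1 hR rfl cA cB hAB hu hp hv hq
      (Or.inl ⟨X, cX, hAX, hBX, hXA, hXB⟩) hm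
  · obtain ⟨A, B, X, cA, cB, cX, hAB, hAX, hBX, hu, hp, hv, hq, hXA, hXB⟩ := h
    exact Or.inl fun ι hm => rootedMinor_option h1 hR Sym2.eq_swap cA cB hAB hu hp hv hq
      (Or.inl ⟨X, cX, hAX, hBX, hXA, hXB⟩) hm.swap
  · obtain ⟨hup, huq, hvp, hvq, hall⟩ := h
    have huv := T.left_ne_right none
    have hpq := T.left_ne_right (some i)
    have aup := adj_of_four h2 (x := T.left none) (y := T.left (some i)) (c := T.right none)
      (d := T.right (some i)) (fun w => by have := hall w; tauto) hup huv huq hvp.symm hpq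
    have auq := adj_of_four h2 (x := T.left none) (y := T.right (some i)) (c := T.right none)
      (d := T.left (some i)) (fun w => by have := hall w; tauto) huq huv hup hvq.symm hpq.symm
    have avp := adj_of_four h2 (x := T.right none) (y := T.left (some i)) (c := T.left none)
      (d := T.right (some i)) (fun w => by have := hall w; tauto) hvp huv.symm hvq hup.symm hpq
    have avq := adj_of_four h2 (x := T.right none) (y := T.right (some i)) (c := T.left none)
      (d := T.left (some i)) (fun w => by have := hall w; tauto) hvq huv.symm hvp huq.symm hpq.symm
    have pair : ∀ {x y : T.Vert}, T.graph.Adj x y → Conn T.graph {x, y} := fun h =>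
      (conn_singleton _).insert_adj rfl h
    have disj₁ : Disjoint ({T.left none, T.left (some i)} : Set T.Vert)
        {T.right none, T.right (some i)} := by
      simp only [Set.disjoint_insert_left, Set.disjoint_singleton_left, Set.mem_insert_iff,
        Set.mem_singleton_iff]
      exact ⟨by tauto, by tauto⟩
    have disj₂ : Disjoint ({T.left none, T.right (some i)} : Set T.Vert)
        {T.right none, T.left (some i)} := by
      simp only [Set.disjoint_insert_left, Set.disjoint_singleton_left, Set.mem_insert_iff,
        Set.mem_singleton_iff]
      exact ⟨by tauto, by tauto⟩
    by_cases hj : ∃ j, j ≠ i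
    · refine Or.inl fun ι hm => ?_
      obtain ⟨j, hji⟩ := hj
      -- A third virtual edge of `K_4` joins a parent end to an end of the child `i`, hence runs
      -- between the hubs for one of the two ways of pairing these ends.
      have key : (∃ a ∈ ({T.left none, T.left (some i)} : Set T.Vert),
          ∃ b ∈ ({T.right none, T.right (some i)} : Set T.Vert),
            s(a, b) = s(T.left (some j), T.right (some j))) ∨
          (∃ a ∈ ({T.left none, T.right (some i)} : Set T.Vert),
          ∃ b ∈ ({T.right none, T.left (some i)} : Set T.Vert),
            s(a, b) = s(T.left (some j), T.right (some j))) := by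
        have hne := T.left_ne_right (some j)
        have hn1 : s(T.left (some j), T.right (some j)) ≠ s(T.left none, T.right none) := fun h => by
          have := pair_injective h
          simp at this
        have hn2 : s(T.left (some j), T.right (some j)) ≠ s(T.left (some i), T.right (some i)) :=
          fun h => hji (Option.some_injective _ (pair_injective h))
        rw [Ne, Sym2.eq_iff] at hn1 hn2
        simp only [Set.mem_insert_iff, Set.mem_singleton_iff, exists_eq_or_imp, exists_eq_left,
          Sym2.eq_iff]
        rcases hall (T.left (some j)) with h | h | h | h <;>
          rcases hall (T.right (some j)) with h' | h' | h' | h' <;> rw [h, h'] at hne hn1 hn2 ⊢ <;>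
          simp_all
      rcases key with key | key
      · obtain ⟨a, ha, b, hb, hab⟩ := key
        exact rootedMinor_option h1 hR rfl (pair aup) (pair avq) disj₁ (by simp) (by simp) (by simp)
          (by simp) (Or.inr ⟨j, hji, a, ha, b, hb, hab⟩) hm
      · obtain ⟨a, ha, b, hb, hab⟩ := key
        exact rootedMinor_option h1 hR Sym2.eq_swap (pair auq) (pair avp) disj₂ (by simp) (by simp)
          (by simp) (by simp) (Or.inr ⟨j, hji, a, ha, b, hb, hab⟩) hm.swap
    · push Not at hj
      exact Or.inr ⟨fun ι hm => rootedMinor h1 hR rfl (pair aup) (pair avq) disj₁ (by simp) (by simp)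
        (by simp) (by simp) hm, hj, ⟨hup, huq, hvp, hvq⟩, hall⟩

end Rooted

end Torso

theorem mem_pairs_of_ne {V : Type*} {a b u v p q : V} (ha : a = u ∨ a = v ∨ a = p ∨ a = q)
    (hb : b = u ∨ b = v ∨ b = p ∨ b = q) (hab : a ≠ b) (huv : s(a, b) ≠ s(u, v))
    (hpq : s(a, b) ≠ s(p, q)) :
    ((a = u ∨ a = v) ∧ (b = p ∨ b = q)) ∨ ((a = p ∨ a = q) ∧ (b = u ∨ b = v)) := by
  rw [Ne, Sym2.eq_iff] at huv hpq
  push Not at huv hpq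
  rcases ha with h1 | h1 | h1 | h1 <;> rcases hb with h2 | h2 | h2 | h2
  · exact absurd (h1.trans h2.symm) hab
  · exact absurd h2 (huv.1 h1)
  · exact Or.inl ⟨Or.inl h1, Or.inl h2⟩
  · exact Or.inl ⟨Or.inl h1, Or.inr h2⟩
  · exact absurd h2 (huv.2 h1)
  · exact absurd (h1.trans h2.symm) hab
  · exact Or.inl ⟨Or.inr h1, Or.inl h2⟩
  · exact Or.inl ⟨Or.inr h1, Or.inr h2⟩
  · exact Or.inr ⟨Or.inl h1, Or.inl h2⟩
  · exact Or.inr ⟨Or.inl h1, Or.inr h2⟩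
  · exact absurd (h1.trans h2.symm) hab
  · exact absurd h2 (hpq.1 h1)
  · exact Or.inr ⟨Or.inr h1, Or.inl h2⟩
  · exact Or.inr ⟨Or.inr h1, Or.inr h2⟩
  · exact absurd h2 (hpq.2 h1)
  · exact absurd (h1.trans h2.symm) hab

/-! ### The node of a rigid region. -/

namespace Torso

section Node

variable {V κ : Type u} {G : SimpleGraph V} {T : Torso G (Option κ)} {C : Set V} {n L : ℕ}

theorem vertices_eq
    (hR : T.R none = {x | x ∉ C ∧ x ≠ T.s none ∧ x ≠ T.t none}) :
    C ∪ {T.s none, T.t none} = T.frame.verts ∪ ⋃ i, (T.R (some i) ∪ {T.s (some i), T.t (some i)}) := by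
  have hmem : ∀ x, x ∉ T.R none → x ∈ C ∪ {T.s none, T.t none} := by
    intro x hx
    by_contra h
    simp only [Set.mem_union, Set.mem_insert_iff, Set.mem_singleton_iff, not_or] at h
    exact hx (hR ▸ h)
  rw [frame_verts]
  ext x
  constructor
  · intro hx
    by_cases h : ∃ i, x ∈ T.R (some i)
    · obtain ⟨i, hi⟩ := h
      exact Or.inr (Set.mem_iUnion.2 ⟨i, Or.inl hi⟩)
    · push Not at h
      refine Or.inl ?_
      rintro (_ | i)
      · rw [hR]
        rintro ⟨h1, h2, h3⟩
        rcases hx with hx | hx | hx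
        exacts [h1 hx, h2 hx, h3 hx]
      · exact h i
  · rintro (hx | hx)
    · exact hmem x (hx none)
    · obtain ⟨i, hx | rfl | rfl⟩ := Set.mem_iUnion.1 hx
      · exact Or.inl (region_subset hR i hx)
      · exact hmem _ (T.s_notMem _ _)
      · exact hmem _ (T.t_notMem _ _)

/-- An edge of `G` joining the ends of a child is assigned to that child, because in the frame this
pair is subdivided. Hence children carry `fullEdges` although the piece itself carries `pieceEdges`.
-/
theorem pieceEdges_iff
    (hR : T.R none = {x | x ∉ C ∧ x ≠ T.s none ∧ x ≠ T.t none}) (a b : V) :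
    pieceEdges G C (T.s none) (T.t none) a b ↔ T.frame.edges a b ∨
      ∃ i, fullEdges G (T.R (some i)) (T.s (some i)) (T.t (some i)) a b := by
  have hV := vertices_eq hR
  constructor
  · rintro ⟨⟨hab, ha, hb⟩, h1, h2⟩
    have hnone : ∀ x ∈ C ∪ {T.s none, T.t none}, x ∉ T.R none := by
      rw [hR]
      rintro x hx ⟨h1, h2, h3⟩
      rcases hx with hx | hx | hx
      exacts [h1 hx, h2 hx, h3 hx]
    by_cases hai : ∃ i, a ∈ T.R (some i)
    · obtain ⟨i, hi⟩ := hai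
      exact Or.inr ⟨i, hab, Or.inl hi, (T.region _).closed a hi b hab⟩
    by_cases hbi : ∃ i, b ∈ T.R (some i)
    · obtain ⟨i, hi⟩ := hbi
      exact Or.inr ⟨i, hab, (T.region _).closed b hi a hab.symm, Or.inl hi⟩
    push Not at hai hbi
    by_cases hp : ∃ i, s(a, b) = s(T.s (some i), T.t (some i))
    · obtain ⟨i, hi⟩ := hp
      rw [Sym2.eq_iff] at hi
      refine Or.inr ⟨i, hab, Or.inr ?_, Or.inr ?_⟩ <;>
        rcases hi with ⟨rfl, rfl⟩ | ⟨rfl, rfl⟩ <;> simp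
    · push Not at hp
      refine Or.inl (frame_edges.2 ⟨?_, ?_, hab, ?_⟩)
      · rintro (_ | i)
        exacts [hnone a ha, hai i]
      · rintro (_ | i)
        exacts [hnone b hb, hbi i]
      · rintro (_ | i)
        · rw [Ne, Sym2.eq_iff]
          exact fun h => h.elim h1 h2
        · exact hp i
  · rintro (h | ⟨i, hab, ha, hb⟩)
    · obtain ⟨ha, hb⟩ := Frame.edges_mem h
      obtain ⟨-, -, hab, hp⟩ := frame_edges.1 h
      refine ⟨⟨hab, hV ▸ Or.inl ha, hV ▸ Or.inl hb⟩, ?_, ?_⟩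
      · rintro ⟨rfl, rfl⟩
        exact hp none rfl
      · rintro ⟨rfl, rfl⟩
        exact hp none Sym2.eq_swap
    · have hsub : T.R (some i) ∪ {T.s (some i), T.t (some i)} ⊆ C ∪ {T.s none, T.t none} := by
        rw [hV]
        exact fun x hx => Or.inr (Set.mem_iUnion.2 ⟨i, hx⟩)
      have key : ¬ (T.s none ∈ T.R (some i) ∪ {T.s (some i), T.t (some i)} ∧
          T.t none ∈ T.R (some i) ∪ {T.s (some i), T.t (some i)}) := by
        rintro ⟨h1 | h1, h2 | h2⟩
        · exact T.s_notMem _ _ h1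
        · exact T.s_notMem _ _ h1
        · exact T.t_notMem _ _ h2
        · have hne := (T.region none).ne
          have : s(T.s none, T.t none) = s(T.s (some i), T.t (some i)) := by
            rw [Sym2.eq_iff]
            rcases h1 with h1 | h1 <;> rcases h2 with h2 | h2
            · exact absurd (h1.trans h2.symm) hne
            · exact Or.inl ⟨h1, h2⟩
            · exact Or.inr ⟨h1, h2⟩
            · exact absurd (h1.trans h2.symm) hne
          simpa using T.inj _ _ this
      refine ⟨⟨hab, hsub ha, hsub hb⟩, ?_, ?_⟩
      · rintro ⟨rfl, rfl⟩
        exact key ⟨ha, hb⟩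
      · rintro ⟨rfl, rfl⟩
        exact key ⟨hb, ha⟩

theorem inter_verts_subset (i : Option κ) :
    (T.R i ∪ {T.s i, T.t i}) ∩ T.frame.verts ⊆ T.frame.ends i := by
  rw [frame_verts]
  rintro x ⟨hx | hx, hx'⟩
  · exact absurd hx (hx' i)
  · exact hx

theorem inter_subset {i j : Option κ} (hij : i ≠ j) :
    (T.R i ∪ {T.s i, T.t i}) ∩ (T.R j ∪ {T.s j, T.t j}) ⊆ T.frame.ends i := by
  rintro x ⟨hx | hx, hx' | hx'⟩
  · exact absurd hx' (Set.disjoint_left.1 (T.disjoint i j hij) hx)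
  · rcases hx' with rfl | rfl
    · exact absurd hx (T.s_notMem _ _)
    · exact absurd hx (T.t_notMem _ _)
  · exact hx
  · exact hx

theorem fill [Finite κ] (hG : ClassD n V G) (h3 : IsKConnected 3 T.graph)
    (hR : T.R none = {x | x ∉ C ∧ x ≠ T.s none ∧ x ≠ T.t none})
    (hF : ∀ i, Fill (BaseClass n) L (T.R (some i) ∪ {T.s (some i), T.t (some i)})
      (fullEdges G (T.R (some i)) (T.s (some i)) (T.t (some i))) (T.s (some i)) (T.t (some i))) :
    Fill (BaseClass n) (L + 1) (C ∪ {T.s none, T.t none})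
      (pieceEdges G C (T.s none) (T.t none)) (T.s none) (T.t none) :=
  ⟨κ, inferInstance, T.frame, _, _, T.baseClass hG h3, rfl, rfl, hF,
    fun i => inter_verts_subset (some i), fun _ _ hij =>
      inter_subset (fun h => hij (Option.some_injective _ h)), vertices_eq hR,
    pieceEdges_iff hR⟩

/-- In the exceptional case the torso is `K_4` with just two virtual edges, opposite to each other.
The four remaining edges are edges of `G`, so `Strip.cross` extends the strip of the only child
without adding a level. -/
theorem hasStrip {𝒢 : GraphClass.{u}} (h3 : IsKConnected 3 T.graph)
    (hC : Region G C (T.s none) (T.t none))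
    (hR : T.R none = {x | x ∉ C ∧ x ≠ T.s none ∧ x ≠ T.t none}) (i : κ) (huniq : ∀ j, j = i)
    (hne : T.left none ≠ T.left (some i) ∧ T.left none ≠ T.right (some i) ∧
      T.right none ≠ T.left (some i) ∧ T.right none ≠ T.right (some i))
    (hall : ∀ x, x = T.left none ∨ x = T.right none ∨ x = T.left (some i) ∨ x = T.right (some i))
    (S : Strip 𝒢 L (T.R (some i) ∪ {T.s (some i), T.t (some i)})
      (fullEdges G (T.R (some i)) (T.s (some i)) (T.t (some i))) (T.s (some i)) (T.t (some i))) :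
    HasStrip 𝒢 L G C (T.s none) (T.t none) := by
  have h2 := h3.no2Sep
  obtain ⟨hup, huq, hvp, hvq⟩ := hne
  have huv := T.left_ne_right none
  have hpq := T.left_ne_right (some i)
  have hval : ∀ {x y : T.Vert}, x ≠ y → x.1 ≠ y.1 := fun h h' => h (Subtype.ext h')
  have hadj : ∀ x y : T.Vert, x = T.left none ∨ x = T.right none →
      y = T.left (some i) ∨ y = T.right (some i) → T.frame.edges x.1 y.1 := by
    intro x y hx hy
    have hH : T.graph.Adj x y := by
      rcases hx with rfl | rfl <;> rcases hy with rfl | rfl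
      · exact adj_of_four h2 (c := T.right none) (d := T.right (some i))
          (fun w => by have := hall w; tauto) hup huv huq hvp.symm hpq
      · exact adj_of_four h2 (c := T.right none) (d := T.left (some i))
          (fun w => by have := hall w; tauto) huq huv hup hvq.symm hpq.symm
      · exact adj_of_four h2 (c := T.left none) (d := T.right (some i))
          (fun w => by have := hall w; tauto) hvp huv.symm hvq hup.symm hpq
      · exact adj_of_four h2 (c := T.left none) (d := T.left (some i))
          (fun w => by have := hall w; tauto) hvq huv.symm hvp huq.symm hpq.symm
    have hnot : ∀ j, s(x, y) ≠ s(T.left j, T.right j) := by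
      rintro (_ | j) h
      · rw [Sym2.eq_iff] at h
        rcases hx with rfl | rfl <;> rcases hy with rfl | rfl <;> tauto
      · obtain rfl := huniq j
        rw [Sym2.eq_iff] at h
        rcases hx with rfl | rfl <;> rcases hy with rfl | rfl <;> tauto
    refine frame_edges.2 ⟨x.2, y.2, hH.2.resolve_right fun ⟨j, hj⟩ => hnot j hj, fun j hj => ?_⟩
    refine hnot j ?_
    have hinj : Function.Injective (Sym2.map (Subtype.val : T.Vert → V)) :=
      Sym2.map.injective Subtype.val_injective
    exact hinj (a₁ := s(x, y)) (a₂ := s(T.left j, T.right j)) hj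
  refine S.cross (hC.ne) ?_ ?_ ?_ ?_
  · rintro (h | h | h)
    exacts [T.s_notMem _ _ h, hval hup h, hval huq h]
  · rintro (h | h | h)
    exacts [T.t_notMem _ _ h, hval hvp h, hval hvq h]
  · intro x
    rw [vertices_eq hR, frame_verts]
    constructor
    · rintro (hx | hx)
      · rcases hall ⟨x, hx⟩ with h | h | h | h
        · exact Or.inl (congrArg Subtype.val h)
        · exact Or.inr (Or.inl (congrArg Subtype.val h))
        · exact Or.inr (Or.inr (Or.inr (Or.inl (congrArg Subtype.val h))))
        · exact Or.inr (Or.inr (Or.inr (Or.inr (congrArg Subtype.val h))))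
      · obtain ⟨j, hx⟩ := Set.mem_iUnion.1 hx
        obtain rfl := huniq j
        exact Or.inr (Or.inr hx)
    · rintro (rfl | rfl | hx)
      · exact Or.inl (T.left none).2
      · exact Or.inl (T.right none).2
      · exact Or.inr (Set.mem_iUnion.2 ⟨i, hx⟩)
  · intro a b
    rw [pieceEdges_iff hR]
    have hex : (∃ j, fullEdges G (T.R (some j)) (T.s (some j)) (T.t (some j)) a b) ↔
        fullEdges G (T.R (some i)) (T.s (some i)) (T.t (some i)) a b :=
      ⟨fun ⟨j, hj⟩ => huniq j ▸ hj, fun h => ⟨i, h⟩⟩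
    rw [hex]
    constructor
    · rintro (h | h)
      · obtain ⟨ha, hb, hab, hp⟩ := frame_edges.1 h
        have h0 := hp none
        have hi := hp (some i)
        have hval' : ∀ x : V, (∀ j, x ∉ T.R j) → x = T.s none ∨ x = T.t none ∨
            x = T.s (some i) ∨ x = T.t (some i) := fun x hx =>
          (hall ⟨x, hx⟩).imp (congrArg Subtype.val) (Or.imp (congrArg Subtype.val)
            (Or.imp (congrArg Subtype.val) (congrArg Subtype.val)))
        have ha' := hval' a ha
        have hb' := hval' b hb
        exact Or.inr (mem_pairs_of_ne ha' hb' hab.ne h0 hi)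
      · exact Or.inl h
    · rintro (h | ⟨h, h'⟩ | ⟨h, h'⟩)
      · exact Or.inr h
      · refine Or.inl ?_
        rcases h with rfl | rfl <;> rcases h' with rfl | rfl
        · exact hadj _ _ (Or.inl rfl) (Or.inl rfl)
        · exact hadj _ _ (Or.inl rfl) (Or.inr rfl)
        · exact hadj _ _ (Or.inr rfl) (Or.inl rfl)
        · exact hadj _ _ (Or.inr rfl) (Or.inr rfl)
      · refine Or.inl (Frame.edges_symm ?_)
        rcases h with rfl | rfl <;> rcases h' with rfl | rfl
        · exact hadj _ _ (Or.inl rfl) (Or.inl rfl)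
        · exact hadj _ _ (Or.inr rfl) (Or.inl rfl)
        · exact hadj _ _ (Or.inl rfl) (Or.inr rfl)
        · exact hadj _ _ (Or.inr rfl) (Or.inr rfl)

end Node

end Torso

/-! ### Maximal fragments of rigid regions. -/

section Fragments

variable {V : Type u} {G : SimpleGraph V} {C F : Set V} {u v : V}

/-- The vertices outside `F` with a neighbour in `F`. -/
def nbhd (G : SimpleGraph V) (F : Set V) : Set V := {y | y ∉ F ∧ ∃ x ∈ F, G.Adj x y}

/-- Submodularity: a vertex counted on the left is a neighbour of `A` or of `B`, and one counted
twice on the left is a neighbour of both. -/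
theorem ncard_nbhd_inter_add_union [Finite V] (A B : Set V) :
    (nbhd G (A ∩ B)).ncard + (nbhd G (A ∪ B)).ncard ≤ (nbhd G A).ncard + (nbhd G B).ncard := by
  rw [← Set.ncard_union_add_ncard_inter (nbhd G (A ∩ B)) _ (Set.toFinite _) (Set.toFinite _),
    ← Set.ncard_union_add_ncard_inter (nbhd G A) _ (Set.toFinite _) (Set.toFinite _)]
  refine Nat.add_le_add (Set.ncard_le_ncard ?_ (Set.toFinite _))
    (Set.ncard_le_ncard ?_ (Set.toFinite _))
  · rintro y (⟨hy, x, hx, hxy⟩ | ⟨hy, x, hx, hxy⟩)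
    · by_cases hyA : y ∈ A
      · exact Or.inr ⟨fun h => hy ⟨hyA, h⟩, x, hx.2, hxy⟩
      · exact Or.inl ⟨hyA, x, hx.1, hxy⟩
    · exact hx.imp (fun h => ⟨fun h' => hy (Or.inl h'), x, h, hxy⟩)
        fun h => ⟨fun h' => hy (Or.inr h'), x, h, hxy⟩
  · rintro y ⟨⟨-, x, hx, hxy⟩, hy, -⟩
    exact ⟨⟨fun h => hy (Or.inl h), x, hx.1, hxy⟩, ⟨fun h => hy (Or.inr h), x, hx.2, hxy⟩⟩

theorem Region.nbhd_eq (h : Region G C u v) (h1 : No1Sep G) : nbhd G C = {u, v} := by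
  ext y
  constructor
  · rintro ⟨hy, x, hx, hxy⟩
    exact (h.closed x hx y hxy).resolve_left hy
  · rintro (rfl | rfl)
    · exact ⟨h.left_notMem, h.adj_left h1⟩
    · exact ⟨h.right_notMem, h.adj_right h1⟩

theorem two_le_ncard_nbhd [Finite V] (h1 : No1Sep G) (hF : F.Nonempty) (huv : u ≠ v) (hu : u ∉ F)
    (hv : v ∉ F) : 2 ≤ (nbhd G F).ncard := by
  obtain ⟨x, hx, y, hy, hyu, hxy⟩ := h1 F u v hF hu hv huv.symm
  have hne : ∃ o, o ∉ F ∧ o ≠ y := by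
    by_cases h : u = y
    · exact ⟨v, hv, fun h' => huv (h.trans h'.symm)⟩
    · exact ⟨u, hu, h⟩
  obtain ⟨o, ho, hoy⟩ := hne
  obtain ⟨x', hx', y', hy', hyy', hxy'⟩ := h1 F y o hF hy ho hoy
  rw [← Set.ncard_pair hyy'.symm]
  refine Set.ncard_le_ncard ?_ (Set.toFinite _)
  rintro z (rfl | rfl)
  · exact ⟨hy, x, hx, hxy⟩
  · exact ⟨hy', x', hx', hxy'⟩

/-- A proper part of the piece `C` with at most two neighbours. -/
structure IsFragment (G : SimpleGraph V) (C F : Set V) : Prop where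
  nonempty : F.Nonempty
  ssubset : F ⊂ C
  ncard_le : (nbhd G F).ncard ≤ 2

theorem Region.isFragment (h : Region G F u v) (h1 : No1Sep G) (hF : F ⊂ C) :
    IsFragment G C F :=
  ⟨h.nonempty, hF, by rw [h.nbhd_eq h1, Set.ncard_pair h.ne]⟩

theorem Region.nbhd_subset (hC : Region G C u v) (hF : F ⊆ C) : nbhd G F ⊆ C ∪ {u, v} := by
  rintro y ⟨-, x, hx, hxy⟩
  exact hC.closed x (hF hx) y hxy

theorem IsFragment.exists_region [Finite V] (h : IsFragment G C F) (h1 : No1Sep G)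
    (hC : Region G C u v) : ∃ p q, Region G F p q := by
  have hcard : (nbhd G F).ncard = 2 := le_antisymm h.ncard_le
    (two_le_ncard_nbhd h1 h.nonempty hC.ne (fun h' => hC.left_notMem (h.ssubset.1 h'))
      fun h' => hC.right_notMem (h.ssubset.1 h'))
  obtain ⟨p, q, hpq, hn⟩ := Set.ncard_eq_two.1 hcard
  have hp : p ∈ nbhd G F := hn ▸ Or.inl rfl
  have hq : q ∈ nbhd G F := hn ▸ Or.inr rfl
  obtain ⟨o, ho, hou, hov⟩ := hC.outside
  have hne : ∀ y ∈ nbhd G F, o ≠ y := by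
    rintro y hy rfl
    rcases hC.nbhd_subset h.ssubset.1 hy with h | h | h
    exacts [ho h, hou h, hov h]
  refine ⟨p, q, h.nonempty, hpq, hp.1, hq.1, fun x hx y hxy => ?_,
    ⟨o, fun h' => ho (h.ssubset.1 h'), hne p hp, hne q hq⟩⟩
  by_cases hy : y ∈ F
  · exact Or.inl hy
  · have : y ∈ nbhd G F := ⟨hy, x, hx, hxy⟩
    rw [hn] at this
    exact Or.inr this

/-- A piece without series or parallel splits. -/
structure IsRigid (G : SimpleGraph V) (C : Set V) (u v : V) : Prop where
  no_series : ∀ c C₁ C₂, ¬ SeriesSplit G C u v c C₁ C₂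
  no_parallel : ∀ C₁ C₂, ¬ ParallelSplit G C C₁ C₂

theorem IsRigid.nbhd_ne (h : IsRigid G C u v) (hF : F.Nonempty) (hFC : F ⊂ C)
    (hu : u ∉ C) (hv : v ∉ C) : nbhd G F ≠ {u, v} := by
  intro hn
  refine h.no_parallel F (C \ F) ⟨(Set.union_sdiff_cancel hFC.1).symm, hF,
    Set.nonempty_of_ssubset hFC, Set.disjoint_sdiff_right, fun x hx y hy hxy => ?_⟩
  have hy' : y ∈ nbhd G F := ⟨hy.2, x, hx, hxy⟩
  rw [hn] at hy'
  rcases hy' with rfl | rfl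
  exacts [hu hy.1, hv hy.1]

/-- If `F₁ ∪ F₂ = C`, let `q` be the neighbour of `F₂` other than `v`. It lies in `F₁` and separates
`F₂` from the rest of `F₁`, giving a series split at `q`. -/
theorem IsRigid.union_ne_of_mem [Finite V] {F₁ F₂ : Set V} (h : IsRigid G C u v)
    (h1 : No1Sep G) (hC : Region G C u v)
    (hF₁ : IsFragment G C F₁) (hF₂ : IsFragment G C F₂) (hu : u ∈ nbhd G F₁)
    (hv : v ∈ nbhd G F₂) : F₁ ∪ F₂ ≠ C := by
  intro hun
  obtain ⟨a, b, hR₁⟩ := hF₁.exists_region h1 hC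
  obtain ⟨c, d, hR₂⟩ := hF₂.exists_region h1 hC
  have key : ∀ {F : Set V} {a b x : V}, Region G F a b → x ∈ nbhd G F →
      ∃ y, Region G F x y := by
    intro F a b x hR hx
    rw [hR.nbhd_eq h1] at hx
    rcases hx with rfl | rfl
    exacts [⟨_, hR⟩, ⟨_, hR.swap⟩]
  obtain ⟨p, hR₁⟩ := key hR₁ hu
  obtain ⟨q, hR₂⟩ := key hR₂ hv
  have hn₁ := h.nbhd_ne hF₁.nonempty hF₁.ssubset hC.left_notMem hC.right_notMem
  have hn₂ := h.nbhd_ne hF₂.nonempty hF₂.ssubset hC.left_notMem hC.right_notMem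
  rw [hR₁.nbhd_eq h1] at hn₁
  rw [hR₂.nbhd_eq h1] at hn₂
  have hpv : p ≠ v := fun h => hn₁ (by rw [h])
  have hqu : q ≠ u := fun h => hn₂ (by rw [h, Set.pair_comm])
  have hq : q ∈ F₁ := by
    have : q ∈ nbhd G F₂ := by rw [hR₂.nbhd_eq h1]; simp
    rcases hC.nbhd_subset hF₂.ssubset.1 this with h' | h' | h'
    · rw [← hun] at h'
      exact h'.resolve_right this.1
    · exact absurd h' hqu
    · exact absurd h'.symm hR₂.ne
  refine h.no_series q ((F₁ \ F₂) \ {q}) F₂ ⟨fun x => ?_, fun h => h.2 rfl, hR₂.right_notMem,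
    Set.disjoint_left.2 fun x hx hx' => hx.1.2 hx', fun x hx y hy hxy => ?_, fun x hx hxv => ?_,
    fun x hx hxu => ?_⟩
  · rw [← hun]
    constructor
    · intro hx
      by_cases hxq : x = q
      · exact Or.inr (Or.inl hxq)
      by_cases hx2 : x ∈ F₂
      · exact Or.inr (Or.inr hx2)
      · exact Or.inl ⟨⟨hx.resolve_right hx2, hx2⟩, hxq⟩
    · rintro (hx | rfl | hx)
      exacts [Or.inl hx.1.1, Or.inl hq, Or.inr hx]
  · rcases hR₂.closed y hy x hxy.symm with h' | h' | h'
    · exact hx.1.2 h'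
    · exact hC.right_notMem (h' ▸ hF₁.ssubset.1 hx.1.1)
    · exact hx.2 h'
  · rcases hR₁.closed x hx.1.1 v hxv with h' | h' | h'
    · exact hC.right_notMem (hF₁.ssubset.1 h')
    · exact hC.ne h'.symm
    · exact hpv h'.symm
  · rcases hR₂.closed x hx u hxu with h' | h' | h'
    · exact hC.left_notMem (hF₂.ssubset.1 h')
    · exact hC.ne h'
    · exact hqu h'.symm

/-- Each end of `C` is a neighbour of one of the fragments. By rigidity no fragment has exactly the
neighbours `u` and `v`, so the ends are divided between the two. -/
theorem IsRigid.union_ne [Finite V] {F₁ F₂ : Set V} (h : IsRigid G C u v)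
    (h1 : No1Sep G) (hC : Region G C u v)
    (hF₁ : IsFragment G C F₁) (hF₂ : IsFragment G C F₂) : F₁ ∪ F₂ ≠ C := by
  intro hun
  have hmem : ∀ y ∈ nbhd G C, y ∈ nbhd G F₁ ∨ y ∈ nbhd G F₂ := by
    rintro y ⟨hy, x, hx, hxy⟩
    rw [← hun] at hx
    exact hx.imp (fun hx => ⟨fun h => hy (hF₁.ssubset.1 h), x, hx, hxy⟩)
      fun hx => ⟨fun h => hy (hF₂.ssubset.1 h), x, hx, hxy⟩
  rw [hC.nbhd_eq h1] at hmem
  have heq : ∀ {F}, IsFragment G C F → u ∈ nbhd G F → v ∈ nbhd G F → False := by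
    intro F hF hu hv
    refine h.nbhd_ne hF.nonempty hF.ssubset hC.left_notMem hC.right_notMem ?_
    refine (Set.eq_of_subset_of_ncard_le (Set.insert_subset hu (Set.singleton_subset_iff.2 hv)) ?_
      (Set.toFinite _)).symm
    rw [Set.ncard_pair hC.ne]
    exact hF.ncard_le
  rcases hmem u (Or.inl rfl) with hu | hu <;> rcases hmem v (Or.inr rfl) with hv | hv
  · exact heq hF₁ hu hv
  · exact h.union_ne_of_mem h1 hC hF₁ hF₂ hu hv hun
  · exact h.union_ne_of_mem h1 hC hF₂ hF₁ hu hv (Set.union_comm _ _ ▸ hun)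
  · exact heq hF₂ hu hv

section Maximal

variable [Finite V] {F₁ F₂ : Set V}

/-- Otherwise the union would be a larger fragment, being a proper part of `C` by
`IsRigid.union_ne`. Disjointness, nonadjacency and distinctness of neighbourhoods all follow by
counting against this bound. -/
theorem three_le_ncard_nbhd_union (h : IsRigid G C u v) (h1 : No1Sep G) (hC : Region G C u v)
    (hF₁ : Maximal (IsFragment G C) F₁) (hF₂ : Maximal (IsFragment G C) F₂) (hne : F₁ ≠ F₂) :
    3 ≤ (nbhd G (F₁ ∪ F₂)).ncard := by
  by_contra hcon
  have hun : F₁ ∪ F₂ ⊂ C := (Set.union_subset hF₁.prop.ssubset.1 hF₂.prop.ssubset.1).ssubset_of_ne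
    (h.union_ne h1 hC hF₁.prop hF₂.prop)
  have hfr : IsFragment G C (F₁ ∪ F₂) :=
    ⟨hF₁.prop.nonempty.mono Set.subset_union_left, hun, by omega⟩
  have e1 := hF₁.eq_of_subset hfr Set.subset_union_left
  have e2 := hF₂.eq_of_subset hfr Set.subset_union_right
  exact hne (e1.trans e2.symm)

theorem disjoint_of_maximal (h : IsRigid G C u v) (h1 : No1Sep G) (hC : Region G C u v)
    (hF₁ : Maximal (IsFragment G C) F₁) (hF₂ : Maximal (IsFragment G C) F₂) (hne : F₁ ≠ F₂) :
    Disjoint F₁ F₂ := by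
  rw [Set.disjoint_iff_inter_eq_empty]
  by_contra hcon
  have h3 := three_le_ncard_nbhd_union h h1 hC hF₁ hF₂ hne
  have h2 := two_le_ncard_nbhd h1 (Set.nonempty_iff_ne_empty.2 hcon) hC.ne
    (fun h => hC.left_notMem (hF₁.prop.ssubset.1 h.1))
    (fun h => hC.right_notMem (hF₁.prop.ssubset.1 h.1))
  have := ncard_nbhd_inter_add_union (G := G) F₁ F₂
  have := hF₁.prop.ncard_le
  have := hF₂.prop.ncard_le
  omega

/-- For an edge `xy` between the fragments, `y` and `x` drop out of the two neighbourhoods when the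
union is formed, leaving at most two neighbours. -/
theorem not_adj_of_maximal (h : IsRigid G C u v) (h1 : No1Sep G) (hC : Region G C u v)
    (hF₁ : Maximal (IsFragment G C) F₁) (hF₂ : Maximal (IsFragment G C) F₂) (hne : F₁ ≠ F₂) :
    ∀ x ∈ F₁, ∀ y ∈ F₂, ¬ G.Adj x y := by
  intro x hx y hy hxy
  have hd := disjoint_of_maximal h h1 hC hF₁ hF₂ hne
  have hyn : y ∈ nbhd G F₁ := ⟨fun h => Set.disjoint_left.1 hd h hy, x, hx, hxy⟩
  have hxn : x ∈ nbhd G F₂ := ⟨Set.disjoint_left.1 hd hx, y, hy, hxy.symm⟩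
  have h3 := three_le_ncard_nbhd_union h h1 hC hF₁ hF₂ hne
  have hsub : nbhd G (F₁ ∪ F₂) ⊆ (nbhd G F₁ \ {y}) ∪ (nbhd G F₂ \ {x}) := by
    rintro z ⟨hz, w, hw, hwz⟩
    refine hw.imp (fun hw => ⟨⟨fun h => hz (Or.inl h), w, hw, hwz⟩, ?_⟩)
      fun hw => ⟨⟨fun h => hz (Or.inr h), w, hw, hwz⟩, ?_⟩
    · rintro rfl
      exact hz (Or.inr hy)
    · rintro rfl
      exact hz (Or.inl hx)
  have c1 := Set.ncard_sdiff_singleton_add_one hyn (Set.toFinite _)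
  have c2 := Set.ncard_sdiff_singleton_add_one hxn (Set.toFinite _)
  have c3 := Set.ncard_le_ncard hsub (Set.toFinite _)
  have c4 := Set.ncard_union_le (nbhd G F₁ \ {y}) (nbhd G F₂ \ {x})
  have := hF₁.prop.ncard_le
  have := hF₂.prop.ncard_le
  omega

theorem nbhd_ne_of_maximal (h : IsRigid G C u v) (h1 : No1Sep G) (hC : Region G C u v)
    (hF₁ : Maximal (IsFragment G C) F₁) (hF₂ : Maximal (IsFragment G C) F₂) (hne : F₁ ≠ F₂) :
    nbhd G F₁ ≠ nbhd G F₂ := by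
  intro heq
  have h3 := three_le_ncard_nbhd_union h h1 hC hF₁ hF₂ hne
  have hsub : nbhd G (F₁ ∪ F₂) ⊆ nbhd G F₁ := by
    rintro z ⟨hz, w, hw | hw, hwz⟩
    · exact ⟨fun h => hz (Or.inl h), w, hw, hwz⟩
    · rw [heq]
      exact ⟨fun h => hz (Or.inr h), w, hw, hwz⟩
  have c3 := Set.ncard_le_ncard hsub (Set.toFinite _)
  have := hF₁.prop.ncard_le
  omega

end Maximal

/-- Pairwise disjoint and nonadjacent regions with distinct neighbourhoods form a torso. -/
def Torso.ofRegions {ι : Type u} (h1 : No1Sep G) (R : ι → Set V) (s t : ι → V)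
    (region : ∀ i, Region G (R i) (s i) (t i)) (disjoint : ∀ i j, i ≠ j → Disjoint (R i) (R j))
    (not_adj : ∀ i j, i ≠ j → ∀ x ∈ R i, ∀ y ∈ R j, ¬ G.Adj x y)
    (inj : ∀ i j, i ≠ j → nbhd G (R i) ≠ nbhd G (R j)) : Torso G ι where
  R := R
  s := s
  t := t
  region := region
  disjoint := disjoint
  s_notMem i j h := by
    by_cases hij : i = j
    · exact (region i).left_notMem (hij ▸ h)
    · obtain ⟨x, hx, hxs⟩ := (region i).adj_left h1
      exact not_adj i j hij x hx _ h hxs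
  t_notMem i j h := by
    by_cases hij : i = j
    · exact (region i).right_notMem (hij ▸ h)
    · obtain ⟨x, hx, hxs⟩ := (region i).adj_right h1
      exact not_adj i j hij x hx _ h hxs
  not_adj := not_adj
  inj i j h := by
    by_contra hij
    refine inj i j hij ?_
    rw [(region i).nbhd_eq h1, (region j).nbhd_eq h1]
    rw [Sym2.eq_iff] at h
    rcases h with ⟨h, h'⟩ | ⟨h, h'⟩
    · rw [h, h']
    · rw [h, h', Set.pair_comm]

end Fragments

/-! ### The torso of a rigid region is 3-connected. -/

namespace Torso

variable {V κ : Type u} {G : SimpleGraph V} {T : Torso G (Option κ)} {C : Set V}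

/-- Besides the two ends there are two torso vertices in `C`. With none, a child would have the same
ends as the outside. With only one, it would be the cut vertex of a series split, the children being
sorted by whether they attach at the right end. -/
theorem three_lt_card [Finite V] (hC : Region G C (T.s none) (T.t none))
    (hR : T.R none = {x | x ∉ C ∧ x ≠ T.s none ∧ x ≠ T.t none})
    (h : IsRigid G C (T.s none) (T.t none)) : 3 < Nat.card T.Vert := by
  have hcases : ∀ x ∈ C, (∃ i, x ∈ T.R (some i)) ∨ ∀ i, x ∉ T.R i := by
    intro x hx
    by_cases hi : ∃ i, x ∈ T.R (some i)
    · exact Or.inl hi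
    · push Not at hi
      refine Or.inr ?_
      rintro (_ | i)
      · rw [hR]
        exact fun h => h.1 hx
      · exact hi i
  have hpair : ∀ i : κ, ¬ ((T.left none = T.left (some i) ∨ T.left none = T.right (some i)) ∧
      (T.right none = T.left (some i) ∨ T.right none = T.right (some i))) := by
    intro i hi
    have hne := T.left_ne_right none
    have : s(T.left none, T.right none) = s(T.left (some i), T.right (some i)) := by
      rw [Sym2.eq_iff]
      rcases hi with ⟨h1 | h1, h2 | h2⟩
      · exact absurd (h1.trans h2.symm) hne
      · exact Or.inl ⟨h1, h2⟩
      · exact Or.inr ⟨h1, h2⟩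
      · exact absurd (h1.trans h2.symm) hne
    simpa using pair_injective this
  obtain ⟨c, hc⟩ : ∃ c : T.Vert, c.1 ∈ C := by
    by_contra! hcon
    obtain ⟨x, hx⟩ := hC.nonempty
    have hv := fun y => (vert_mem hR y).resolve_left (hcon y)
    rcases hcases x hx with ⟨i, -⟩ | hx'
    · have h1 := hv (T.left (some i))
      have h2 := hv (T.right (some i))
      have h3 := T.left_ne_right (some i)
      refine hpair i ?_
      rcases h1 with h1 | h1 <;> rcases h2 with h2 | h2
      · exact absurd (h1.trans h2.symm) h3
      · exact ⟨Or.inl h1.symm, Or.inr h2.symm⟩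
      · exact ⟨Or.inr h2.symm, Or.inl h1.symm⟩
      · exact absurd (h1.trans h2.symm) h3
    · exact hcon ⟨x, hx'⟩ hx
  obtain ⟨d, hd, hdc⟩ : ∃ d : T.Vert, d.1 ∈ C ∧ d ≠ c := by
    by_contra! hcon
    let Q : κ → Prop := fun i => T.right none = T.left (some i) ∨ T.right none = T.right (some i)
    have huniq : ∀ {x i j}, x ∈ T.R i → x ∈ T.R j → i = j := fun hi hj =>
      by_contra fun h => Set.disjoint_left.1 (T.disjoint _ _ h) hi hj
    refine h.no_series c.1 {x | ∃ i, ¬ Q i ∧ x ∈ T.R (some i)} {x | ∃ i, Q i ∧ x ∈ T.R (some i)}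
      ⟨fun x => ⟨fun hx => ?_, ?_⟩, ?_, ?_, ?_, ?_, ?_, ?_⟩
    · rcases hcases x hx with ⟨i, hi⟩ | hx'
      · by_cases hq : Q i
        · exact Or.inr (Or.inr ⟨i, hq, hi⟩)
        · exact Or.inl ⟨i, hq, hi⟩
      · exact Or.inr (Or.inl (congrArg Subtype.val (hcon ⟨x, hx'⟩ hx)))
    · rintro (⟨i, -, hi⟩ | rfl | ⟨i, -, hi⟩)
      exacts [region_subset hR i hi, hc, region_subset hR i hi]
    · rintro ⟨i, -, hi⟩
      exact c.2 _ hi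
    · rintro ⟨i, -, hi⟩
      exact c.2 _ hi
    · refine Set.disjoint_left.2 ?_
      rintro x ⟨i, hq, hi⟩ ⟨j, hq', hj⟩
      exact hq (Option.some_injective _ (huniq hi hj) ▸ hq')
    · rintro x ⟨i, hq, hi⟩ y ⟨j, hq', hj⟩
      exact T.not_adj _ _ (fun h => hq (by rwa [Option.some_injective _ h])) x hi y hj
    · rintro x ⟨i, hq, hi⟩ hxv
      rcases (T.region (some i)).closed x hi _ hxv with h' | h' | h'
      · exact T.t_notMem _ _ h'
      · exact hq (Or.inl (Subtype.ext h'))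
      · exact hq (Or.inr (Subtype.ext h'))
    · rintro x ⟨i, hq, hi⟩ hxu
      rcases (T.region (some i)).closed x hi _ hxu with h' | h' | h'
      · exact T.s_notMem _ _ h'
      · exact hpair i ⟨Or.inl (Subtype.ext h'), hq⟩
      · exact hpair i ⟨Or.inr (Subtype.ext h'), hq⟩
  classical
  have : Finite T.Vert := Subtype.finite
  have := Fintype.ofFinite T.Vert
  have hc1 : c ≠ T.left none := fun h => hC.left_notMem (h ▸ hc :)
  have hc2 : c ≠ T.right none := fun h => hC.right_notMem (h ▸ hc :)
  have hd1 : d ≠ T.left none := fun h => hC.left_notMem (h ▸ hd :)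
  have hd2 : d ≠ T.right none := fun h => hC.right_notMem (h ▸ hd :)
  have hcard : ({d, c, T.left none, T.right none} : Finset T.Vert).card = 4 := by
    rw [Finset.card_insert_of_notMem (by simp [hdc, hd1, hd2]),
      Finset.card_insert_of_notMem (by simp [hc1, hc2]),
      Finset.card_pair (T.left_ne_right none)]
  have hle := Finset.card_le_univ ({d, c, T.left none, T.right none} : Finset T.Vert)
  rw [Nat.card_eq_fintype_card]
  omega

/-- A separation of the torso lifts to a region `F` of `G`. After passing to the complement if
necessary, `F ⊆ C`. If `F = C`, no torso vertex lies beyond its ends; if `F` is a proper part, it is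
swallowed by a child region and contains no torso vertex. -/
theorem isKConnected_three [Finite V] (h1 : No1Sep G) (hC : Region G C (T.s none) (T.t none))
    (hR : T.R none = {x | x ∉ C ∧ x ≠ T.s none ∧ x ≠ T.t none})
    (h : IsRigid G C (T.s none) (T.t none))
    (hmax : ∀ F a b, Region G F a b → F ⊂ C → ∃ i, F ⊆ T.R (some i)) :
    IsKConnected 3 T.graph := by
  have hcard := three_lt_card hC hR h
  have aux : ∀ F a b, Region G F a b → (∃ x ∈ F, ∀ i, x ∉ T.R i) →
      (∃ o, o ∉ F ∧ o ≠ a ∧ o ≠ b ∧ ∀ i, o ∉ T.R i) → F ⊆ C → False := by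
    rintro F a b hF ⟨x, hx, hxT⟩ ⟨o, ho, hoa, hob, hoT⟩ hFC
    by_cases hne : F = C
    · subst hne
      have hn : ({a, b} : Set V) = {T.s none, T.t none} := by rw [← hF.nbhd_eq h1, hC.nbhd_eq h1]
      have hmem : o ∈ ({a, b} : Set V) := by
        rw [hn]
        exact ((vert_mem hR ⟨o, hoT⟩).resolve_left ho).imp (congrArg Subtype.val)
          (congrArg Subtype.val)
      rcases hmem with h | h
      exacts [hoa h, hob h]
    · obtain ⟨i, hi⟩ := hmax F a b hF (hFC.ssubset_of_ne hne)
      exact hxT _ (hi hx)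
  refine TwoSumDecomp.isKConnected_three hcard (no2Sep ?_ hcard)
  intro F a b hF hx ho ha hb hsep
  obtain ⟨y, hy, hyu⟩ := (T.region none).adj_left h1
  obtain ⟨z, hz, hzv⟩ := (T.region none).adj_right h1
  have hsubC : ∀ F', (∀ x ∈ F', x ∉ T.R none) → T.s none ∉ F' → T.t none ∉ F' → F' ⊆ C := by
    intro F' h1 h2 h3 x hx
    by_contra hxC
    refine h1 x hx ?_
    rw [hR]
    exact ⟨hxC, fun h => h2 (h ▸ hx), fun h => h3 (h ▸ hx)⟩
  rcases hsep none with hnone | hnone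
  · obtain ⟨x, hx, hxT⟩ := hx
    obtain ⟨o, ho, hoa, hob, hoT⟩ := ho
    refine aux _ a b hF.compl ⟨o, ⟨ho, hoa, hob⟩, hoT⟩ ⟨x, fun h => h.1 hx,
      fun h => hF.left_notMem (h ▸ hx), fun h => hF.right_notMem (h ▸ hx), hxT⟩
      (hsubC _ (fun x hx hx' => hx.1 (hnone hx')) ?_ ?_)
    · rintro ⟨h1, h2, h3⟩
      rcases hF.closed y (hnone hy) _ hyu with h | h | h
      exacts [h1 h, h2 h, h3 h]
    · rintro ⟨h1, h2, h3⟩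
      rcases hF.closed z (hnone hz) _ hzv with h | h | h
      exacts [h1 h, h2 h, h3 h]
  · refine aux F a b hF hx ho (hsubC F (fun x hx hx' => Set.disjoint_left.1 hnone hx' hx) ?_ ?_)
    · intro hs
      rcases hF.closed _ hs y hyu.symm with h | rfl | rfl
      exacts [Set.disjoint_left.1 hnone hy h, ha none hy, hb none hy]
    · intro hs
      rcases hF.closed _ hs z hzv.symm with h | rfl | rfl
      exacts [Set.disjoint_left.1 hnone hz h, ha none hz, hb none hz]

end Torso

/-- A piece without series and parallel splits gives rise to a 3-connected torso. -/
theorem IsRigid.exists_torso {V : Type u} [Finite V] {G : SimpleGraph V} {C : Set V} {u v : V}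
    (h : IsRigid G C u v) (h1 : No1Sep G) (hC : Region G C u v) :
    ∃ (κ : Type u) (_ : Finite κ) (T : Torso G (Option κ)), T.s none = u ∧ T.t none = v ∧
      T.R none = {x | x ∉ C ∧ x ≠ u ∧ x ≠ v} ∧ IsKConnected 3 T.graph ∧
      ∀ i, T.R (some i) ⊂ C := by
  let κ : Type u := {F : Set V // Maximal (IsFragment G C) F}
  choose p q hpq using fun i : κ => i.2.prop.exists_region h1 hC
  have hne : ∀ {i j : κ}, some i ≠ some j → i.1 ≠ j.1 := fun hij h => hij (by rw [Subtype.ext h])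
  let T : Torso G (Option κ) := Torso.ofRegions h1
    (fun o => o.elim {x | x ∉ C ∧ x ≠ u ∧ x ≠ v} fun i => i.1) (fun o => o.elim u p)
    (fun o => o.elim v q) (by
      rintro (_ | i)
      exacts [hC.compl, hpq i]) (by
      rintro (_ | i) (_ | j) hij
      · exact absurd rfl hij
      · exact Set.disjoint_left.2 fun x hx hx' => hx.1 (j.2.prop.ssubset.1 hx')
      · exact Set.disjoint_left.2 fun x hx' hx => hx.1 (i.2.prop.ssubset.1 hx')
      · exact disjoint_of_maximal h h1 hC i.2 j.2 (hne hij)) (by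
      have key : ∀ x, x ∉ C ∧ x ≠ u ∧ x ≠ v → ∀ j : κ, ∀ y ∈ j.1, ¬ G.Adj x y := by
        rintro x ⟨hx, hxu, hxv⟩ j y hy hxy
        rcases hC.closed y (j.2.prop.ssubset.1 hy) x hxy.symm with h | h | h
        exacts [hx h, hxu h, hxv h]
      rintro (_ | i) (_ | j) hij x hx y hy hxy
      · exact absurd rfl hij
      · exact key x hx j y hy hxy
      · exact key y hy i x hx hxy.symm
      · exact not_adj_of_maximal h h1 hC i.2 j.2 (hne hij) x hx y hy hxy) (by
      have key : ∀ j : κ, nbhd G j.1 ≠ nbhd G {x | x ∉ C ∧ x ≠ u ∧ x ≠ v} := by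
        intro j
        rw [hC.compl.nbhd_eq h1]
        exact h.nbhd_ne j.2.prop.nonempty j.2.prop.ssubset hC.left_notMem hC.right_notMem
      rintro (_ | i) (_ | j) hij
      · exact absurd rfl hij
      · exact (key j).symm
      · exact key i
      · exact nbhd_ne_of_maximal h h1 hC i.2 j.2 (hne hij))
  refine ⟨κ, Subtype.finite, T, rfl, rfl, rfl, ?_, fun i => i.2.prop.ssubset⟩
  refine Torso.isKConnected_three h1 hC rfl h fun F a b hF hFC => ?_
  obtain ⟨M, hFM, hM⟩ := (Set.toFinite {F | IsFragment G C F}).exists_le_maximal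
    (hF.isFragment h1 hFC)
  exact ⟨⟨M, hM⟩, hFM⟩

/-! ### The induction on regions and the choice of the root. -/

section Main

variable {n L : ℕ} {V : Type u} {G : SimpleGraph V} {C : Set V} {u v : V}

theorem classP_le_baseClass : ∀ W H, ClassP.{u} W H → BaseClass n W H := fun _ _ h => Or.inl h

theorem isRigid_or_split : IsRigid G C u v ∨ (∃ c C₁ C₂, SeriesSplit G C u v c C₁ C₂) ∨
    ∃ C₁ C₂, ParallelSplit G C C₁ C₂ := by
  by_cases h1 : ∃ c C₁ C₂, SeriesSplit G C u v c C₁ C₂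
  · exact Or.inr (Or.inl h1)
  by_cases h2 : ∃ C₁ C₂, ParallelSplit G C C₁ C₂
  · exact Or.inr (Or.inr h2)
  push Not at h1 h2
  exact Or.inl ⟨h1, h2⟩

theorem SeriesSplit.ssubset {c : V} {C₁ C₂ : Set V} (h : SeriesSplit G C u v c C₁ C₂) :
    C₁ ⊂ C ∧ C₂ ⊂ C :=
  ⟨⟨h.left_subset, fun h' => h.left_notMem (h' h.mem)⟩,
    ⟨h.right_subset, fun h' => h.right_notMem (h' h.mem)⟩⟩

/-- A piece without large rooted minors has a strip decomposition. -/
theorem hasStrip_of_not_rootedMinor (hG : ClassD n V G) (C : Set V) : ∀ (u v : V) (k : ℕ),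
    Region G C u v → ¬ RootedMinor G (Fin (k + 1)) C u v →
      1 ≤ k ∧ HasStrip (BaseClass n) (2 * k - 1) G C u v := by
  have h1 := hG.1.no1Sep
  have hfin : Finite V := hG.1.finite
  induction C using WellFoundedLT.induction with
  | _ C ih =>
  intro u v k hC hn
  -- Every region has a rooted minor with one leaf, so `k = 0` is impossible. Recording `1 ≤ k` in
  -- the conclusion keeps the truncated subtraction in `2 * k - 1` honest.
  obtain _ | j := k
  · exact absurd ((RootedMinor.of_region hC h1).reindex
      ⟨fun _ => (), fun i j _ => by omega⟩) hn
  refine ⟨by omega, ?_⟩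
  have hopt : ∀ {C' : Set V} {p q : V}, (RootedMinor G (Fin (j + 1)) C' p q →
      RootedMinor G (Option (Fin (j + 1))) C u v) → ¬ RootedMinor G (Fin (j + 1)) C' p q :=
    fun h hm => hn ((h hm).reindex (finSuccEquiv (j + 1)).toEmbedding)
  have hlev : 2 * (j + 1) - 1 = 2 * j + 1 := by omega
  rcases isRigid_or_split (G := G) (C := C) (u := u) (v := v) with h | ⟨c, C₁, C₂, h⟩ | ⟨C₁, C₂, h⟩
  · obtain ⟨κ, hκ, T, rfl, rfl, hR, h3, hsub⟩ := h.exists_torso h1 hC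
    by_cases hall : ∀ i, ∀ ι : Type, RootedMinor G ι (T.R (some i)) (T.s (some i)) (T.t (some i)) →
      RootedMinor G (Option ι) C (T.s none) (T.t none)
    · refine ⟨Strip.item hC.ne (Or.inr (Or.inl rfl)) (Or.inr (Or.inr rfl)) ?_⟩
      rw [hlev]
      -- Each child has lost a leaf: its strip has pieces of depth `2j - 1`, closing the strip makes
      -- `2j`, and the torso node makes `2j + 1`.
      refine T.fill hG h3 hR fun i => ?_
      obtain ⟨hj, hs⟩ := ih _ (hsub i) _ _ j (T.region _) (hopt (hall i _))
      have := hs.fill_full classP_le_baseClass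
      rwa [show 2 * j - 1 + 1 = 2 * j by omega] at this
    · push Not at hall
      obtain ⟨i, hi⟩ := hall
      rcases T.rootedMinor_dichotomy h1 h3 hR i with h' | ⟨hm, huniq, hne, hfour⟩
      · obtain ⟨ι, hm, hm'⟩ := hi
        exact absurd (h' ι hm) hm'
      · obtain ⟨-, hs⟩ := ih _ (hsub i) _ _ (j + 1) (T.region _) fun h => hn (hm _ h)
        exact T.hasStrip h3 hC hR i huniq hne hfour hs.full.some
  · exact h.hasStrip hC h1
      (fun hR => (ih C₁ h.ssubset.1 u c (j + 1) hR fun hm => hn (h.rootedMinor_left hC h1 hm)).2)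
      (fun hR => (ih C₂ h.ssubset.2 c v (j + 1) hR fun hm => hn (h.rootedMinor_right hC h1 hm)).2)
  · have key : ∀ {C₁ C₂}, ParallelSplit G C C₁ C₂ →
        Fill (BaseClass n) (2 * j) (C₁ ∪ {u, v}) (pieceEdges G C₁ u v) u v := by
      intro C₁ C₂ h
      obtain ⟨hj, hs⟩ := ih C₁ h.ssubset u v j (h.left hC) (hopt (h.rootedMinor hC h1))
      have := hs.fill classP_le_baseClass
      rwa [show 2 * j - 1 + 1 = 2 * j by omega] at this
    refine ⟨Strip.item hC.ne (Or.inr (Or.inl rfl)) (Or.inr (Or.inr rfl)) ?_⟩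
    rw [hlev]
    exact h.fill hC hG (key h) (key h.swap)

/-- A piece all of whose proper parts have strip decompositions. -/
theorem fill_of_forall_hasStrip (hG : ClassD n V G) (hC : Region G C u v)
    (h : ∀ F ⊂ C, ∀ p q, Region G F p q → HasStrip (BaseClass n) L G F p q) :
    Fill (BaseClass n) (L + 2) (C ∪ {u, v}) (pieceEdges G C u v) u v := by
  have h1 := hG.1.no1Sep
  have hfin : Finite V := hG.1.finite
  rcases isRigid_or_split (G := G) (C := C) (u := u) (v := v) with h' | ⟨c, C₁, C₂, h'⟩ |
    ⟨C₁, C₂, h'⟩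
  · obtain ⟨κ, hκ, T, rfl, rfl, hR, h3, hsub⟩ := h'.exists_torso h1 hC
    exact T.fill hG h3 hR fun i => (h _ (hsub i) _ _ (T.region _)).fill_full classP_le_baseClass
  -- A series node merges the strips of its parts and needs one level less than allowed.
  · exact ((h'.hasStrip hC h1 (h _ h'.ssubset.1 _ _) (h _ h'.ssubset.2 _ _)).fill
      classP_le_baseClass).succ
  · exact h'.fill hC hG ((h _ h'.ssubset _ _ (h'.left hC)).fill classP_le_baseClass)
      ((h _ h'.swap.ssubset _ _ (h'.swap.left hC)).fill classP_le_baseClass)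

/-- Without 2-separations the graph is 3-connected if it has at least four vertices, and a triangle
otherwise. -/
theorem baseClass_of_no_region (hG : ClassD n V G) (h : ∀ C u v, ¬ Region G C u v) :
    BaseClass n V G := by
  have h1 := hG.1.no1Sep
  have hfin : Finite V := hG.1.finite
  refine baseClass_of_classC ?_ hG.1 hG.2
  by_cases hcard : 3 < Nat.card V
  · have h2 : No2Sep G := by
      intro K p q o hK hp hq ho hop hoq
      by_cases hpq : p = q
      · subst hpq
        obtain ⟨x, hx, y, hy, hyp, hxy⟩ := h1 K p o hK hp ho hop
        exact ⟨x, hx, y, hy, hyp, hyp, hxy⟩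
      · by_contra! hcon
        refine h K p q ⟨hK, hpq, hp, hq, fun x hx y hxy => ?_, o, ho, hop, hoq⟩
        by_contra! hy
        exact hcon x hx y hy.1 hy.2.1 hy.2.2 hxy
    refine Or.inr (Or.inr (Or.inr (Or.inr (Or.inr (Or.inr ⟨V, G, ∅, isKConnected_three hcard h2,
      Set.empty_subset _, ⟨?_⟩⟩)))))
    exact
      { toEquiv := (Equiv.sumEmpty V (∅ : Set (Sym2 V))).symm
        map_rel_iff' := by
          intro a b
          change G.Adj a b ∧ s(a, b) ∉ (∅ : Set (Sym2 V)) ↔ _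
          simp }
  · have h3 : Nat.card V = 3 := by
      have := hG.1.1
      omega
    have hadj : ∀ x y, x ≠ y → G.Adj x y := by
      intro x y hxy
      obtain ⟨z, hzx, hzy⟩ := exists_ne_ne (by omega : 2 < Nat.card V) x y
      obtain ⟨a, rfl, b, hba, hbz, hab⟩ := h1 {x} z y ⟨x, rfl⟩ hzx hxy.symm hzy.symm
      by_cases hby : b = y
      · exact hby ▸ hab
      · exfalso
        have hsub : ({a, b, z, y} : Set V).ncard ≤ 3 := by
          rw [← h3, ← Set.ncard_univ]
          exact Set.ncard_le_ncard (Set.subset_univ _) (Set.toFinite _)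
        rw [Set.ncard_insert_of_notMem (by
            rintro (h | h | h)
            exacts [hba h.symm, hzx h.symm, hxy h]) (Set.toFinite _),
          Set.ncard_insert_of_notMem (by
            rintro (h | h)
            exacts [hbz h, hby h]) (Set.toFinite _), Set.ncard_pair hzy] at hsub
        omega
    left
    rw [SimpleGraph.cycleGraph_three_eq_top]
    have e : V ≃ Fin 3 := Finite.equivFinOfCardEq h3
    exact ⟨{ toEquiv := e, map_rel_iff' := by
              intro a b
              rw [SimpleGraph.top_adj, Ne, e.apply_eq_iff_eq]
              exact ⟨hadj a b, fun h => h.ne⟩ }⟩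

/-- The top node of `C` becomes the root, and its marked vertex `none`, reserved for a parent,
receives the complementary region. A possible edge `uv` is counted on the complementary side only.
-/
theorem powClass_of_region (hC : Region G C u v)
    (hF : Fill (BaseClass n) (L + 1) (C ∪ {u, v}) (pieceEdges G C u v) u v)
    (hF' : Fill (BaseClass n) L ({x | x ∉ C ∧ x ≠ u ∧ x ≠ v} ∪ {u, v})
      (fullEdges G {x | x ∉ C ∧ x ≠ u ∧ x ≠ v} u v) u v) : powClass (BaseClass n) (1 + L) V G := by
  have hL : 1 ≤ L := by
    obtain _ | L := L
    · exact hF'.elim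
    · omega
  obtain ⟨κ, hκ, F, Y, R, hN, hu, hv, hY, hYF, hYY, hX, hE⟩ := hF
  have hends : F.ends none = {u, v} := by rw [Frame.ends, hu, hv]
  have hverts : F.verts ⊆ C ∪ {u, v} := hX ▸ Set.subset_union_left
  have hYX : ∀ i, Y i ⊆ C ∪ {u, v} := fun i => by
    rw [hX]
    exact (Set.subset_iUnion Y i).trans Set.subset_union_right
  have hcompl : ∀ S, S ⊆ C ∪ {u, v} → ({x | x ∉ C ∧ x ≠ u ∧ x ≠ v} ∪ {u, v}) ∩ S ⊆ F.ends none := by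
    rintro S hS x ⟨hx | hx, hxS⟩
    · rcases hS hxS with h | h | h
      exacts [absurd h hx.1, absurd h hx.2.1, absurd h hx.2.2]
    · exact hends ▸ hx
  refine powClass_of_fill L 1 (Option κ) F
    (fun o => o.elim ({x | x ∉ C ∧ x ≠ u ∧ x ≠ v} ∪ {u, v}) Y)
    (fun o => o.elim (fullEdges G {x | x ∉ C ∧ x ≠ u ∧ x ≠ v} u v) R) (by omega) le_rfl hN
    ?_ ?_ ?_ ?_ ?_
  · rintro (_ | i)
    · rw [hu, hv]
      exact hF'
    · exact hY i
  · rintro (_ | i)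
    exacts [hcompl _ hverts, hYF i]
  · rintro (_ | i) (_ | j) hij
    · exact absurd rfl hij
    · exact hcompl _ (hYX j)
    · rintro x ⟨hx, hx'⟩
      exact hYF i ⟨hx, Frame.ends_subset _ (hcompl _ (hYX i) ⟨hx', hx⟩)⟩
    · exact hYY i j fun h => hij (by rw [h])
  · refine Set.eq_univ_of_forall fun x => ?_
    by_cases hx : x ∈ C ∪ {u, v}
    · rw [hX] at hx
      refine hx.imp id fun h => ?_
      obtain ⟨i, hi⟩ := Set.mem_iUnion.1 h
      exact Set.mem_iUnion.2 ⟨some i, hi⟩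
    · refine Or.inr (Set.mem_iUnion.2 ⟨none, Or.inl ?_⟩)
      simp only [Set.mem_union, Set.mem_insert_iff, Set.mem_singleton_iff, not_or] at hx
      exact hx
  · intro a b
    have key : G.Adj a b ↔ pieceEdges G C u v a b ∨
        fullEdges G {x | x ∉ C ∧ x ≠ u ∧ x ≠ v} u v a b := by
      constructor
      · intro hab
        by_cases ha : a ∈ C
        · exact Or.inl ⟨⟨hab, Or.inl ha, hC.closed a ha b hab⟩, fun h => hC.left_notMem (h.1 ▸ ha),
            fun h => hC.right_notMem (h.1 ▸ ha)⟩
        by_cases hb : b ∈ C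
        · exact Or.inl ⟨⟨hab, hC.closed b hb a hab.symm, Or.inl hb⟩,
            fun h => hC.right_notMem (h.2 ▸ hb), fun h => hC.left_notMem (h.2 ▸ hb)⟩
        have : ∀ x, x ∉ C → x ∈ {x | x ∉ C ∧ x ≠ u ∧ x ≠ v} ∪ ({u, v} : Set V) := by
          intro x hx
          by_cases h : x = u ∨ x = v
          · exact Or.inr h
          · push Not at h
            exact Or.inl ⟨hx, h⟩
        exact Or.inr ⟨hab, this a ha, this b hb⟩
      · rintro (h | h)
        exacts [h.1.1, h.1]
    rw [key, hE]
    constructor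
    · rintro ((h | ⟨i, h⟩) | h)
      exacts [Or.inl h, Or.inr ⟨some i, h⟩, Or.inr ⟨none, h⟩]
    · rintro (h | ⟨_ | i, h⟩)
      exacts [Or.inl (Or.inl h), Or.inr h, Or.inl (Or.inr ⟨i, h⟩)]

/-- Minimality bounds the proper subregions. The alternative in the middle bounds the complement:
either the chosen region has the rooted minor, or no region has it. -/
theorem exists_region_minimal [Finite V] (ι : Type) (h : ∃ C u v, Region G C u v) :
    ∃ C u v, Region G C u v ∧ (RootedMinor G ι C u v ∨ ∀ C u v, Region G C u v →
      ¬ RootedMinor G ι C u v) ∧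
      ∀ F ⊂ C, ∀ p q, Region G F p q → ¬ RootedMinor G ι F p q := by
  by_cases hm : ∃ C, ∃ u v, Region G C u v ∧ RootedMinor G ι C u v
  · obtain ⟨C, hmem, hC⟩ :=
      (Set.toFinite {C | ∃ u v, Region G C u v ∧ RootedMinor G ι C u v}).exists_minimal hm
    obtain ⟨u, v, hR, hRM⟩ := hmem
    exact ⟨C, u, v, hR, Or.inl hRM, fun F hF p q hFR hFM =>
      hF.2 (hC ⟨p, q, hFR, hFM⟩ hF.1)⟩
  · push Not at hm
    obtain ⟨C, u, v, hC⟩ := h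
    exact ⟨C, u, v, hC, Or.inr hm, fun F _ p q => hm F p q⟩

theorem powClass_of_classD (hn : 1 ≤ n) (hG : ClassD n V G) : powClass (BaseClass n) n V G := by
  have h1 := hG.1.no1Sep
  have hfin : Finite V := hG.1.finite
  by_cases hex : ∃ C u v, Region G C u v
  · have hminor : ∀ {C : Set V} {u v : V} {ι κ : Type}, Region G C u v → RootedMinor G ι C u v →
        RootedMinor G κ {x | x ∉ C ∧ x ≠ u ∧ x ≠ v} u v → (Fin n ↪ ι ⊕ κ) → False := by
      intro C u v ι κ hC hm hm' f
      exact hG.2 (hm.hasMinor hm' hC.ne ⟨hC.left_notMem, hC.compl.left_notMem⟩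
        ⟨hC.right_notMem, hC.compl.right_notMem⟩ (Set.disjoint_left.2 fun x hx hx' => hx'.1 hx) f)
    -- Each side of a 2-separation contributes a leaf, so a region already yields a `K_{2,2}`-minor.
    have hn3 : 3 ≤ n := by
      by_contra hlt
      obtain ⟨C, u, v, hC⟩ := hex
      refine hminor hC (RootedMinor.of_region hC h1) (RootedMinor.of_region hC.compl h1) ?_
      refine (Function.Embedding.nonempty_of_card_le ?_).some
      simp only [Fintype.card_fin, Fintype.card_sum, Fintype.card_unit]
      omega
    -- Two sides with `K + 1` leaves each would give `n` leaves, while `2K + 1` is the number of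
    -- levels that will be used.
    obtain ⟨K, hK, hKn, hnK⟩ : ∃ K, 1 ≤ K ∧ 2 * K + 1 ≤ n ∧ n ≤ (K + 1) + (K + 1) :=
      ⟨(n - 1) / 2, by omega, by omega, by omega⟩
    obtain ⟨C, u, v, hC, hCm, hmin⟩ := exists_region_minimal (Fin (K + 1)) hex
    have hcompl : ¬ RootedMinor G (Fin (K + 1)) {x | x ∉ C ∧ x ≠ u ∧ x ≠ v} u v := by
      intro hm'
      rcases hCm with hm | hm
      · refine hminor hC hm hm' (Function.Embedding.nonempty_of_card_le ?_).some
        simpa using hnK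
      · exact hm _ _ _ hC.compl hm'
    have hstrip := (hasStrip_of_not_rootedMinor hG _ u v K hC.compl hcompl).2
    -- The side of `C` takes `2K + 1` levels including the root, and the complement takes `2K`
    -- levels below the root.
    have hfill := fill_of_forall_hasStrip (L := 2 * K - 1) hG hC fun F hF p q hR =>
      (hasStrip_of_not_rootedMinor hG F p q K hR (hmin F hF p q hR)).2
    refine powClass_mono ?_ (powClass_of_region hC hfill (hstrip.fill_full classP_le_baseClass))
    omega
  · push Not at hex
    exact powClass_mono (k := 1) hn (baseClass_of_no_region hG hex)

end Main

end TwoSumDecomp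

theorem mainTheorem6 (n : ℕ) (hn : 1 ≤ n) (V : Type u) (G : SimpleGraph V)
    (hG : TwoSumDecomp.ClassD n V G) :
    TwoSumDecomp.powClass
      (TwoSumDecomp.unionClass TwoSumDecomp.ClassP (TwoSumDecomp.ClassD' n)) n V G :=
  TwoSumDecomp.powClass_of_classD hn hG
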